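/- Let $\mathcal B$ be a real Banach space and $(T_t)_{t\ge 0}$ a $C_0$-semigroup of bounded linear operators on $\mathcal B$ such that, for some $r\ge 0$, $T_t$ is compact for every $t\ge r$. Let $L$ be its infinitesimal generator and let $P\sigma(L)\subset\mathbb C$ be its point spectrum, i.e. the set of eigenvalues of the complexification of $L$. Put $\log 0=-\infty$. A *sequence of Lyapunov exponents* of $(T_t)$ is a sequence $(\lambda_i)_{i\ge1}$ in $[-\infty,\infty)$ with $\lambda_i\to-\infty$ and, for each $i$, either $\lambda_i>\lambda_{i+1}$ or $\lambda_i=\lambda_{i+1}=-\infty$, such that the sets $F_i=\{x\in\mathcal B:\limsup_{t\to\infty}\frac1t\log\|T_tx\|\le\lambda_i\}$ are linear subspaces with $\cdots\subset F_2\subset F_1=\mathcal B$; whenever $\lambda_i>\lambda_{i+1}$, $x\in F_i\setminus F_{i+1}$ if and only if $\lim_{t\to\infty}\frac1t\log\|T_tx\|=\lambda_i$; and there are integers $m_i\ge0$ with $\operatorname{codim}F_j=m_1+\dots+m_{j-1}$ for all $j$, where for each $i$ with $\lambda_i>\lambda_{i+1}$ one has $m_i\ge1$ and there is a unique $m_i$-dimensional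 subspace $H^i$ with $T_t(H^i)=H^i$ for all $t\ge0$, $H^i\oplus F_{i+1}=F_i$, and, for all $h\in H^i\setminus\{0\}$, $\lim_{t\to\infty}\frac1t\log\|T_th\|=\lambda_i$ and $\lim_{t\to\infty}\frac1t\log\|(T_t|_{H^i})^{-1}h\|=-\lambda_i$. **(a)** There is exactly one sequence $(\lambda_i)_{i\ge1}$ of Lyapunov exponents of $(T_t)$. If $\mu\in P\sigma(L)$, then $\mu=\lambda_j+ib$ for some $j\ge1$ with $\lambda_j\neq-\infty$ and some $b\in\mathbb R$. Conversely, for every $j$ with $\lambda_j\ne-\infty$ there is $b\in\mathbb R$ with $\lambda_j+ib\in P\sigma(L)$. **(b)** $\lambda_1=\max\{\operatorname{Re}\mu:\mu\in P\sigma(L)\}$ if $P\sigma(L)\neq\emptyset$, and $\lambda_1=-\infty$ if $P\sigma(L)=\emptyset$. If $\operatorname{Re}\mu<0$ for every $\mu\in P\sigma(L)$, then the semigroup is exponentially stable: for every $\xi\in\mathcal B$, $\limsup_{t\to\infty}\frac1t\log\|T_t\xi\|\le\lambda_1<0$. **(c)** Let $n\ge1$, $r>0$, let $A:\mathbb R^n\times\mathbb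 R^n\to\mathbb R^n$ be linear and $\pi=(\pi^{i,j})_{1\le i,j\le n}$ finite signed measures on $[-r,0]$. For $\xi\in C([-r,0],\mathbb R^n)$ let $\int\xi\,d\pi$ be the vector with $j$-th coordinate $\sum_i\int\xi^i_\theta\,\pi^{i,j}(d\theta)$. There is exactly one $C_0$-semigroup $(T_t)$ on $C([-r,0],\mathbb R^n)$ (with the supremum norm) such that, for all $t\ge0$, $\xi$ and $\tau\in[-r,0]$, $(T_t\xi)(\tau)=\xi_{t+\tau}$ if $t+\tau\le0$ and $$(T_t\xi)(\tau)=\xi_0+\int_0^{t+\tau}A\Big((T_s\xi)(0),\int T_s\xi\,d\pi\Big)\,ds\quad\text{if }t+\tau>0 .$$ It is compact for $t\ge r$. Let $\Delta(z)C=zC-A\big(C,\int e^{z\theta}C\,\pi(d\theta)\big)$ for $z\in\mathbb C$, $C\in\mathbb C^n$, with $A$ extended complex-linearly. Then $\max\{\operatorname{Re}z:\det\Delta(z)=0\}$ exists in $\mathbb R$ and is equal to the first Lyapunov exponent $\lambda_1$ of $(T_t)$. If $\operatorname{Re}z<0$ whenever $\det\Delta(z)=0$, then $\limsup_{t\to\infty}\frac1t\log\|T_t\xi\|\le\lambda_1<0$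 for every $\xi\in C([-r,0],\mathbb R^n)$. -/

import Mathlib

open Filter Topology MeasureTheory
open scoped NNReal ENNReal

noncomputable section

/-- A strongly continuous semigroup (`C₀`-semigroup) of bounded linear operators on a real normed
space `B`. -/
structure C0Semigroup (B : Type*) [NormedAddCommGroup B] [NormedSpace ℝ B] where
  /-- The operators `T t`, for `t ≥ 0`. -/
  op : ℝ≥0 → B →L[ℝ] B
  op_add : ∀ t s, op (t + s) = (op t).comp (op s)
  op_zero : op 0 = ContinuousLinearMap.id ℝ B
  continuous_orbit : ∀ x, Continuous fun t => op t x

namespace C0Semigroup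

variable {B : Type*} [NormedAddCommGroup B] [NormedSpace ℝ B]

/-- The difference quotient `(T t x - x) / t`. -/
def quotient (T : C0Semigroup B) (x : B) (t : ℝ≥0) : B := (t : ℝ)⁻¹ • (T.op t x - x)

/-- The domain of the generator: all `x` for which `(T t x - x) / t` converges as `t → 0+`. -/
def generatorDomain (T : C0Semigroup B) : Submodule ℝ B where
  carrier := {x | ∃ y, Tendsto (T.quotient x) (𝓝[>] 0) (𝓝 y)}
  add_mem' := by
    rintro a b ⟨y, hy⟩ ⟨z, hz⟩
    refine ⟨y + z, (hy.add hz).congr fun t => ?_⟩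
    simp only [quotient, map_add, ← smul_add]
    congr 1
    abel
  zero_mem' := ⟨0, by
    refine tendsto_const_nhds.congr fun t => ?_
    simp only [quotient, _root_.map_zero, sub_self, smul_zero]⟩
  smul_mem' := by
    rintro c a ⟨y, hy⟩
    refine ⟨c • y, (hy.const_smul c).congr fun t => ?_⟩
    simp only [quotient, map_smul, ← smul_sub]
    rw [smul_comm]

/-- The infinitesimal generator `L x = lim_{t → 0+} (T t x - x) / t`, as an (unbounded) linear
operator with domain `generatorDomain`. -/
def generator (T : C0Semigroup B) : B →ₗ.[ℝ] B where
  domain := T.generatorDomain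
  toFun :=
    { toFun := fun x => Classical.choose x.2
      map_add' := fun a b => by
        refine tendsto_nhds_unique (Classical.choose_spec (a + b).2) ?_
        refine ((Classical.choose_spec a.2).add (Classical.choose_spec b.2)).congr fun t => ?_
        simp only [quotient, Submodule.coe_add, map_add, ← smul_add]
        congr 1
        abel
      map_smul' := fun c a => by
        refine tendsto_nhds_unique (Classical.choose_spec (c • a).2) ?_
        refine ((Classical.choose_spec a.2).const_smul c).congr fun t => ?_
        simp only [quotient, Submodule.coe_smul, map_smul, ← smul_sub]
        rw [smul_comm] }

theorem generator_spec (T : C0Semigroup B) (x : T.generator.domain) :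
    Tendsto (T.quotient x) (𝓝[>] 0) (𝓝 (T.generator x)) :=
  Classical.choose_spec x.2

/-- The function `t ↦ (1 / t) log ‖T t x‖`, with values in `[-∞, ∞]` and `log 0 = -∞`. -/
def logGrowth (T : C0Semigroup B) (x : B) (t : ℝ≥0) : EReal :=
  ENNReal.log ‖T.op t x‖ₑ / ((t : ℝ) : EReal)

/-- The exponential growth rate `limsup_{t → ∞} (1 / t) log ‖T t x‖`. -/
def growthRate (T : C0Semigroup B) (x : B) : EReal := limsup (T.logGrowth x) atTop

/-- The set `F_lam = {x | limsup_{t → ∞} (1 / t) log ‖T t x‖ ≤ lam}`. -/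
def growthSet (T : C0Semigroup B) (lam : EReal) : Set B := {x | T.growthRate x ≤ lam}

/-- `H` is an invariant complement of `F'` in `F` on which `T` is invertible and every nonzero
vector has exact exponential rate `lam` forward, and `-lam` backward, in time. In the last clause
`g t` is the preimage `(T t)⁻¹ h` in `H`. -/
structure IsFastGrowing (T : C0Semigroup B) (lam : EReal) (F F' H : Submodule ℝ B) : Prop where
  invariant : ∀ t, H.map (T.op t : B →ₗ[ℝ] B) = H
  disjoint : Disjoint H F'
  sup_eq : H ⊔ F' = F
  forward : ∀ h ∈ H, h ≠ 0 → Tendsto (T.logGrowth h) atTop (𝓝 lam)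
  backward : ∀ h ∈ H, h ≠ 0 → ∀ g : ℝ≥0 → B, (∀ t, g t ∈ H ∧ T.op t (g t) = h) →
    Tendsto (fun t : ℝ≥0 => ENNReal.log ‖g t‖ₑ / ((t : ℝ) : EReal)) atTop (𝓝 (-lam))

/-- `lam 0, lam 1, …` is the sequence of Lyapunov exponents of the semigroup `T` (numbered from
`0`): the sequence decreases to `-∞`, strictly as long as it is finite, the spaces
`F i = {x | limsup (1 / t) log ‖T t x‖ ≤ lam i}` form a filtration of `B` by subspaces of finite
codimension such that the vectors in `F i \ F (i + 1)` are those of exact rate `lam i`, and each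
finite exponent has a positive finite multiplicity `m i`, the dimension of a unique fast-growing
complement of `F (i + 1)` in `F i`. -/
structure IsLyapunovSequence (T : C0Semigroup B) (lam : ℕ → EReal) : Prop where
  lt_top : ∀ i, lam i < ⊤
  decreasing : ∀ i, lam (i + 1) < lam i ∨ (lam i = ⊥ ∧ lam (i + 1) = ⊥)
  tendsto_bot : Tendsto lam atTop (𝓝 ⊥)
  filtration : ∃ (F : ℕ → Submodule ℝ B) (m : ℕ → ℕ),
    (∀ i, (F i : Set B) = T.growthSet (lam i)) ∧
    F 0 = ⊤ ∧
    (∀ i, F (i + 1) ≤ F i) ∧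
    (∀ i, lam (i + 1) < lam i → ∀ x,
      (x ∈ F i ∧ x ∉ F (i + 1)) ↔ Tendsto (T.logGrowth x) atTop (𝓝 (lam i))) ∧
    (∀ j, Module.rank ℝ (B ⧸ F j) = ((∑ i ∈ Finset.range j, m i : ℕ) : Cardinal)) ∧
    (∀ i, lam (i + 1) < lam i → 0 < m i ∧
      ∃! H : Submodule ℝ B, Module.finrank ℝ H = m i ∧
        T.IsFastGrowing (lam i) (F i) (F (i + 1)) H)

end C0Semigroup

/-- The point spectrum of a partially defined operator `L` on a real vector space: the complex
numbers `μ = a + i b` for which the complexification of `L` has an eigenvector `x + i y ≠ 0`, with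
`x`, `y` in the domain of `L`. Here `L (x + i y) = μ (x + i y)` is written out in real and
imaginary parts. -/
def pointSpectrum {B : Type*} [AddCommGroup B] [Module ℝ B] (L : B →ₗ.[ℝ] B) : Set ℂ :=
  {μ | ∃ x y : L.domain, (x ≠ 0 ∨ y ≠ 0) ∧
    L x = μ.re • (x : B) - μ.im • (y : B) ∧ L y = μ.im • (x : B) + μ.re • (y : B)}

section Delay

/-- The interval `[-r, 0]`. -/
abbrev DelayInterval (r : ℝ≥0) : Type := Set.Icc (-(r : ℝ)) 0

/-- The right end point `0` of `[-r, 0]`. -/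
def delayZero (r : ℝ≥0) : DelayInterval r := ⟨0, by simp⟩

/-- The space `C([-r, 0], ℝⁿ)` with the supremum norm. -/
abbrev DelaySpace (n : ℕ) (r : ℝ≥0) : Type := C(DelayInterval r, EuclideanSpace ℝ (Fin n))

variable {n : ℕ} {r : ℝ≥0}

/-- The vector `∫ ξ dπ` with `j`-th coordinate `∑ i, ∫ ξ i dπ i j`, for a matrix `π` of finite
signed measures on `[-r, 0]`. -/
def delayIntegral (π : Fin n → Fin n → SignedMeasure (DelayInterval r)) (ξ : DelaySpace n r) :
    EuclideanSpace ℝ (Fin n) :=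
  WithLp.toLp 2 fun j => ∑ i, ∫ᵛ θ, (ξ θ i) ∂<•(π i j)

/-- `T` is the semigroup on `C([-r, 0], ℝⁿ)` of the linear delay equation
`dy t = A (y t, ∫ y (t + θ) π(dθ)) dt`. -/
def IsDelaySemigroup
    (A : EuclideanSpace ℝ (Fin n) × EuclideanSpace ℝ (Fin n) →L[ℝ] EuclideanSpace ℝ (Fin n))
    (π : Fin n → Fin n → SignedMeasure (DelayInterval r))
    (T : C0Semigroup (DelaySpace n r)) : Prop :=
  ∀ (t : ℝ≥0) (ξ : DelaySpace n r) (τ : DelayInterval r),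
    (∀ h : (t : ℝ) + τ ≤ 0,
      T.op t ξ τ = ξ ⟨t + τ, by have := τ.2.1; have := t.2; exact ⟨by linarith, h⟩⟩) ∧
    (0 < (t : ℝ) + τ →
      T.op t ξ τ = ξ (delayZero r) + ∫ s in (0 : ℝ)..(t + τ),
        A (T.op s.toNNReal ξ (delayZero r), delayIntegral π (T.op s.toNNReal ξ)))

/-- The matrix over `ℂ` of the characteristic operator
`Δ(z) C = z C - A (C, ∫ exp (z θ) C π(dθ))`, where `A` is extended complex-linearly. The `j`-th
coordinate of `∫ exp (z θ) C π(dθ)` is `∑ i, (∫ exp (z θ) π i j (dθ)) C i`. -/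
def delayCharacteristic
    (A : EuclideanSpace ℝ (Fin n) × EuclideanSpace ℝ (Fin n) →L[ℝ] EuclideanSpace ℝ (Fin n))
    (π : Fin n → Fin n → SignedMeasure (DelayInterval r)) (z : ℂ) : Matrix (Fin n) (Fin n) ℂ :=
  let A₁ : Matrix (Fin n) (Fin n) ℂ :=
    Matrix.of fun k l => ((A (EuclideanSpace.single l 1, 0) k : ℝ) : ℂ)
  let A₂ : Matrix (Fin n) (Fin n) ℂ :=
    Matrix.of fun k l => ((A (0, EuclideanSpace.single l 1) k : ℝ) : ℂ)
  let P : Matrix (Fin n) (Fin n) ℂ :=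
    Matrix.of fun j i => ∫ᵛ θ, Complex.exp (z * ((θ : ℝ) : ℂ)) ∂<•(π i j)
  z • (1 : Matrix (Fin n) (Fin n) ℂ) - A₁ - A₂ * P

end Delay

end

/-! The core is a real version of Riesz theory for one compact operator `K = T.op (r + 1)`. To stay
over the reals, `K - z` is replaced by `(K - z)(K - conj z)`, which is `quadFactor K z`. Riesz's
lemma shows that, for fixed `ρ > 0`, the kernels of products of such factors with `|z| ≥ ρ` cannot
grow forever, so one product `s` has the largest kernel (`IsCompactOperator.exists_maximal`). This
kernel is finite-dimensional, and the Fredholm alternative turns it into the range of a projection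
`Q` commuting with the commutant of `K`. On `ker Q` no eigenvalue of modulus at least `ρ` is left,
so the spectral radius formula in the complexification bounds `K ^ n` by a multiple of `ρ ^ n`; on
the range every eigenvalue has modulus at least `ρ`, and the same bound for the inverse gives
expansion (`IsCompactOperator.exists_projection`). Boundedness of `T` on compact time intervals
carries this to continuous time (`C0Semigroup.exists_isSplitting`): every real `c` has a finite-rank
splitting of the semigroup at rate `c`.

Everything about Lyapunov exponents follows from these splittings. A vector with `limsup > c` has `Q
x ≠ 0`, hence `liminf ≥ c`, so every growth rate is a limit. Only finitely many rates lie above a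
given real, because the rank of `Q` bounds them. The exponents are the decreasing enumeration of the
set of rates, and for `c` in the gap below `λ_i` the space `H^i` is `range Q ⊓ F_i`. It is unique
because a backward orbit decaying faster than `exp (-c t)` forces its starting point into the range
of `Q`.

On the finite-dimensional invariant space `H^i` the generator is everywhere defined and has a
complex eigenvector, whose orbit has rate the real part of the eigenvalue; conversely, an
eigenvector of the generator has an exponential orbit with that rate. This identifies the finite
exponents with the real parts of the point spectrum.

For the delay equation, a Neumann series in a weighted space gives the semigroup, Grönwall gives
uniqueness, and Arzelà–Ascoli gives compactness from time `r` on. Eigenvectors must be exponential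
segments `exp (z θ) C` with `Δ(z) C = 0`, so the point spectrum is the zero set of `det Δ`. That set
is nonempty: a zero-free entire function of exponential type is the exponential of an affine
function, which is incompatible with `|det Δ(x)| ~ x ^ n` as `x → +∞` when `n ≥ 1`. -/

/-! ### Complexification of a real normed space -/

/-- The complexification of a real normed space `E`, modelled as the space of real-linear maps
`ℂ → E`, on which `ℂ` acts by multiplication in the source. -/
def Cplx (E : Type*) [NormedAddCommGroup E] [NormedSpace ℝ E] : Type _ := ℂ →L[ℝ] E

namespace Cplx

variable {E : Type*} [NormedAddCommGroup E] [NormedSpace ℝ E]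

noncomputable instance : NormedAddCommGroup (Cplx E) :=
  inferInstanceAs (NormedAddCommGroup (ℂ →L[ℝ] E))

instance [CompleteSpace E] : CompleteSpace (Cplx E) :=
  inferInstanceAs (CompleteSpace (ℂ →L[ℝ] E))

/-- A real-linear map `ℂ → E` as an element of the complexification. -/
def of (f : ℂ →L[ℝ] E) : Cplx E := f

/-- An element of the complexification as a real-linear map `ℂ → E`. -/
def toMap (f : Cplx E) : ℂ →L[ℝ] E := f

@[simp] theorem toMap_of (f : ℂ →L[ℝ] E) : (of f).toMap = f := rfl

@[simp] theorem toMap_add (f g : Cplx E) : (f + g).toMap = f.toMap + g.toMap := rfl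

@[simp] theorem toMap_zero : (0 : Cplx E).toMap = 0 := rfl

theorem norm_def (f : Cplx E) : ‖f‖ = ‖f.toMap‖ := rfl

@[ext] theorem ext {f g : Cplx E} (h : ∀ w, f.toMap w = g.toMap w) : f = g :=
  ContinuousLinearMap.ext h

noncomputable instance : SMul ℂ (Cplx E) :=
  ⟨fun z f => of (f.toMap.comp (ContinuousLinearMap.mul ℝ ℂ z))⟩

@[simp] theorem smul_toMap (z : ℂ) (f : Cplx E) (w : ℂ) : (z • f).toMap w = f.toMap (z * w) := rfl

noncomputable instance : Module ℂ (Cplx E) where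
  one_smul f := by ext w; simp
  mul_smul a b f := by ext w; simp [mul_comm a b, mul_assoc]
  smul_zero a := by ext w; simp
  smul_add a f g := by ext w; simp
  add_smul a b f := by ext w; simp [add_mul]
  zero_smul f := by ext w; simp

noncomputable instance : NormedSpace ℂ (Cplx E) where
  norm_smul_le z f := by
    rw [norm_def, mul_comm]
    refine (ContinuousLinearMap.opNorm_comp_le _ _).trans ?_
    gcongr
    · exact le_of_eq rfl
    · exact ContinuousLinearMap.opNorm_mul_apply_le ℝ ℂ z

/-- The complexification of a bounded operator. -/
noncomputable def mapL (K : E →L[ℝ] E) : Cplx E →L[ℂ] Cplx E :=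
  LinearMap.mkContinuous
    { toFun := fun f => of (K.comp f.toMap)
      map_add' := fun f g => by ext w; simp
      map_smul' := fun z f => by ext w; simp } ‖K‖ fun f => K.opNorm_comp_le f.toMap

theorem mapL_pow_toMap (K : E →L[ℝ] E) (n : ℕ) (f : Cplx E) (w : ℂ) :
    ((mapL K ^ n) f).toMap w = (K ^ n) (f.toMap w) := by
  induction n generalizing f with
  | zero => simp
  | succ n ih => rw [pow_succ, pow_succ]; exact ih (mapL K f)

/-- The map `w ↦ Re w • x` embeds `E` without increasing norms, and evaluation at `1` recovers `K ^
n x`. This is the only comparison needed to pull spectral radius bounds back to `E`. -/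
theorem norm_pow_le_norm_mapL_pow (K : E →L[ℝ] E) (n : ℕ) : ‖K ^ n‖ ≤ ‖mapL K ^ n‖ := by
  refine ContinuousLinearMap.opNorm_le_bound _ (norm_nonneg _) fun x => ?_
  set f : Cplx E := of (Complex.reCLM.smulRight x)
  have h1 : (K ^ n) x = ((mapL K ^ n) f).toMap 1 := by
    rw [mapL_pow_toMap]; simp [f]
  have h2 : ‖f‖ ≤ ‖x‖ := by
    rw [norm_def]
    simp [f, ContinuousLinearMap.norm_smulRight_apply, Complex.reCLM_norm]
  calc ‖(K ^ n) x‖ ≤ ‖((mapL K ^ n) f).toMap‖ * ‖(1 : ℂ)‖ := by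
        rw [h1]; exact ContinuousLinearMap.le_opNorm _ _
    _ = ‖(mapL K ^ n) f‖ := by rw [norm_one, mul_one, norm_def]
    _ ≤ ‖mapL K ^ n‖ * ‖f‖ := ContinuousLinearMap.le_opNorm _ _
    _ ≤ ‖mapL K ^ n‖ * ‖x‖ := by gcongr

theorem toMap_eq (f : ℂ →L[ℝ] E) (w : ℂ) : f w = w.re • f 1 + w.im • f Complex.I := by
  conv_lhs => rw [← Complex.re_add_im w]
  rw [map_add, ← map_smul, ← map_smul]
  simp

/-- A real-linear map on `ℂ` is determined continuously by its values at `1` and `I`, so the image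
of the unit ball lies in a continuous image of `C ×ˢ C`. -/
theorem isCompactOperator_mapL {K : E →L[ℝ] E} (hK : IsCompactOperator K) :
    IsCompactOperator (mapL K) := by
  refine (isCompactOperator_iff_image_closedBall_subset_compact (mapL K : Cplx E →ₗ[ℂ] Cplx E)
    zero_lt_one).2 ?_
  obtain ⟨C, hC, hKC⟩ := hK.image_closedBall_subset_compact (f := (K : E →ₗ[ℝ] E)) 1
  let Φ : E × E → Cplx E := fun p =>
    of (Complex.reCLM.smulRight p.1 + Complex.imCLM.smulRight p.2)
  have hΦ : Continuous Φ := by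
    have : Continuous fun p : E × E =>
        ContinuousLinearMap.smulRightL ℝ ℂ E Complex.reCLM p.1 +
          ContinuousLinearMap.smulRightL ℝ ℂ E Complex.imCLM p.2 := by fun_prop
    exact this
  refine ⟨Φ '' (C ×ˢ C), (hC.prod hC).image hΦ, ?_⟩
  rintro _ ⟨f, hf, rfl⟩
  have hf1 : ‖f.toMap‖ ≤ 1 := by simpa [norm_def] using hf
  have key : ∀ w : ℂ, ‖w‖ = 1 → K (f.toMap w) ∈ C := fun w hw => hKC ⟨f.toMap w, by
    simpa using (f.toMap.le_opNorm w).trans (by rw [hw, mul_one]; exact hf1), rfl⟩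
  refine ⟨(K (f.toMap 1), K (f.toMap Complex.I)), ⟨key _ (by simp), key _ (by simp)⟩, ?_⟩
  ext w
  change w.re • K (f.toMap 1) + w.im • K (f.toMap Complex.I) = K (f.toMap w)
  rw [toMap_eq f.toMap w]
  simp

end Cplx

/-! ### Real quadratic factors -/

section Factors

variable {E : Type*} [NormedAddCommGroup E] [NormedSpace ℝ E]

/-- The operator `(K - z) (K - conj z) = K² - 2 Re z K + |z|²`. -/
noncomputable def quadFactor (K : E →L[ℝ] E) (z : ℂ) : E →L[ℝ] E :=
  K * K - (2 * z.re) • K + (‖z‖ ^ 2) • 1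

theorem quadFactor_apply (K : E →L[ℝ] E) (z : ℂ) (x : E) :
    quadFactor K z x = K (K x) - (2 * z.re) • K x + (‖z‖ ^ 2) • x := rfl

theorem Complex.sq_norm_eq (z : ℂ) : ‖z‖ ^ 2 = z.re ^ 2 + z.im ^ 2 := by
  rw [Complex.sq_norm, Complex.normSq_apply]; ring

theorem Complex.quadratic_eq_zero (z : ℂ) : z * z - (2 * z.re) • z + (‖z‖ ^ 2 : ℝ) • (1 : ℂ) = 0 := by
  rw [Complex.sq_norm_eq]
  apply Complex.ext <;> simp [pow_two] <;> ring

/-- If a compact operator `K` has no complex eigenvalue of modulus at least `ρ`, then `‖K ^ n‖` is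
at most a multiple of `ρ ^ n`. -/
theorem IsCompactOperator.exists_norm_pow_le [CompleteSpace E] {K : E →L[ℝ] E}
    (hK : IsCompactOperator K) {ρ : ℝ} (hρ : 0 < ρ)
    (h : ∀ z : ℂ, ρ ≤ ‖z‖ → ∀ x, quadFactor K z x = 0 → x = 0) :
    ∃ C, 0 < C ∧ ∀ n, ‖K ^ n‖ ≤ C * ρ ^ n := by
  rcases subsingleton_or_nontrivial E with hE | hE
  · refine ⟨1, one_pos, fun n => ?_⟩
    rw [Subsingleton.elim (K ^ n) 0, norm_zero]
    positivity
  have : Nontrivial (Cplx E) := by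
    obtain ⟨x, hx⟩ := exists_ne (0 : E)
    refine ⟨⟨Cplx.of (Complex.reCLM.smulRight x), 0, fun h0 => hx ?_⟩⟩
    simpa using congrArg (fun f => f.toMap 1) h0
  have hspec : ∀ z ∈ spectrum ℂ (Cplx.mapL K), ‖z‖₊ < ρ.toNNReal := by
    intro z hz
    by_contra! hlt
    have hzρ : ρ ≤ ‖z‖ := by
      have := NNReal.coe_le_coe.2 hlt
      rwa [Real.coe_toNNReal _ hρ.le, coe_nnnorm] at this
    have hz0 : z ≠ 0 := norm_pos_iff.1 (hρ.trans_le hzρ)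
    obtain ⟨f, hf⟩ := (((Cplx.isCompactOperator_mapL hK).hasEigenvalue_iff_mem_spectrum hz0).2
      hz).exists_hasEigenvector
    have hKf : ∀ w, K (f.toMap w) = f.toMap (z * w) := fun w =>
      congrArg (fun f => f.toMap w) hf.apply_eq_smul
    refine hf.2 (Cplx.ext fun w => h z hzρ _ ?_)
    -- `K` acts on the values of the eigenvector `f` by multiplying the argument by `z`, and `z` is
    -- a root of its own real quadratic, so every value of `f` is killed by `quadFactor K z`.
    have hq : z * (z * w) - (2 * z.re) • (z * w) + (‖z‖ ^ 2 : ℝ) • w = 0 := by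
      have := congrArg (· * w) (Complex.quadratic_eq_zero z)
      simpa [sub_mul, add_mul, mul_assoc] using this
    rw [quadFactor_apply, hKf, hKf, ← map_smul, ← map_smul, ← map_sub, ← map_add, hq, map_zero]
  have hsr := spectrum.spectralRadius_lt_of_forall_lt (Cplx.mapL K) hspec
  have hev := (spectrum.pow_norm_pow_one_div_tendsto_nhds_spectralRadius
    (Cplx.mapL K)).eventually (gt_mem_nhds hsr)
  obtain ⟨N, hN⟩ := eventually_atTop.1 hev
  have hbig : ∀ n, N + 1 ≤ n → ‖K ^ n‖ ≤ ρ ^ n := by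
    intro n hn
    have h1 := hN n (by omega)
    have hn0 : (n : ℝ) ≠ 0 := by exact_mod_cast (by omega : n ≠ 0)
    change ENNReal.ofReal _ < ENNReal.ofReal ρ at h1
    have h2 := ((ENNReal.ofReal_lt_ofReal_iff hρ).1 h1).le
    refine (Cplx.norm_pow_le_norm_mapL_pow K n).trans ?_
    have h3 := pow_le_pow_left₀ (by positivity) h2 n
    rwa [← Real.rpow_natCast, ← Real.rpow_mul (norm_nonneg _), one_div, inv_mul_cancel₀ hn0,
      Real.rpow_one] at h3
  -- The spectral radius only controls large powers; the finite sum absorbs the powers up to `N`.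
  refine ⟨1 + ∑ k ∈ Finset.range (N + 1), ‖K ^ k‖ / ρ ^ k, by positivity, fun n => ?_⟩
  rcases lt_or_ge n (N + 1) with hn | hn
  · have h1 : ‖K ^ n‖ / ρ ^ n ≤ ∑ k ∈ Finset.range (N + 1), ‖K ^ k‖ / ρ ^ k :=
      Finset.single_le_sum (f := fun k => ‖K ^ k‖ / ρ ^ k) (fun k _ => by positivity)
        (Finset.mem_range.2 hn)
    rw [← div_le_iff₀ (by positivity)]
    linarith
  · refine (hbig n hn).trans (le_mul_of_one_le_left (by positivity) ?_)
    exact le_add_of_nonneg_right (Finset.sum_nonneg fun k _ => by positivity)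

end Factors

/-! ### Riesz theory over the reals: spectral projections of a compact operator -/

section Splitting

variable {E : Type*} [NormedAddCommGroup E] [NormedSpace ℝ E]

theorem Commute.quadFactor {K T : E →L[ℝ] E} (h : Commute T K) (z : ℂ) :
    Commute T (quadFactor K z) :=
  ((h.mul_right h).sub_right (h.smul_right _)).add_right ((Commute.one_right T).smul_right _)

theorem IsCompactOperator.smul_one_sub_quadFactor {K : E →L[ℝ] E} (hK : IsCompactOperator K)
    (z : ℂ) : IsCompactOperator (((‖z‖ ^ 2) • 1 - _root_.quadFactor K z : E →L[ℝ] E)) := by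
  have h1 : IsCompactOperator (((2 * z.re) • K - K * K : E →L[ℝ] E)) :=
    (hK.smul (2 * z.re)).sub (hK.clm_comp K)
  convert h1 using 2
  simp only [_root_.quadFactor]
  abel

/-- The products of the operators `(K - z) (K - conj z)` with `|z| ≥ ρ`. -/
noncomputable def quadMonoid (K : E →L[ℝ] E) (ρ : ℝ) : Submonoid (E →L[ℝ] E) :=
  Submonoid.closure {s | ∃ z : ℂ, ρ ≤ ‖z‖ ∧ s = quadFactor K z}

theorem quadFactor_mem_quadMonoid (K : E →L[ℝ] E) {ρ : ℝ} {z : ℂ} (hz : ρ ≤ ‖z‖) :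
    quadFactor K z ∈ quadMonoid K ρ :=
  Submonoid.subset_closure ⟨z, hz, rfl⟩

theorem Commute.of_mem_quadMonoid {K T : E →L[ℝ] E} (h : Commute T K) {ρ : ℝ} {s : E →L[ℝ] E}
    (hs : s ∈ quadMonoid K ρ) : Commute T s := by
  induction hs using Submonoid.closure_induction with
  | mem s hs => obtain ⟨z, -, rfl⟩ := hs; exact h.quadFactor z
  | one => exact Commute.one_right T
  | mul s t _ _ hs ht => exact hs.mul_right ht

/-- Each factor is `|z|²` plus a compact operator, and this form survives multiplication. It makes
the Fredholm alternative available for every product. -/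
theorem IsCompactOperator.exists_smul_one_sub {K : E →L[ℝ] E} (hK : IsCompactOperator K) {ρ : ℝ}
    (hρ : 0 < ρ) {s : E →L[ℝ] E} (hs : s ∈ quadMonoid K ρ) :
    ∃ c : ℝ, 0 < c ∧ IsCompactOperator ((c • 1 - s : E →L[ℝ] E)) := by
  induction hs using Submonoid.closure_induction with
  | mem s hs =>
    obtain ⟨z, hz, rfl⟩ := hs
    exact ⟨‖z‖ ^ 2, pow_pos (hρ.trans_le hz) 2, hK.smul_one_sub_quadFactor z⟩
  | one => exact ⟨1, one_pos, by simpa using isCompactOperator_zero⟩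
  | mul s t _ _ hs ht =>
    obtain ⟨c, hc, hs⟩ := hs
    obtain ⟨d, hd, ht⟩ := ht
    refine ⟨c * d, mul_pos hc hd, ?_⟩
    have h1 : IsCompactOperator ((d • (c • 1 - s) + s * (d • 1 - t) : E →L[ℝ] E)) :=
      (hs.smul d).add (ht.clm_comp s)
    convert h1 using 2
    simp only [smul_sub, mul_sub, mul_smul_comm, mul_one, smul_smul, mul_comm d c]
    abel

/-- Operators `(K - z) (K - conj z)` and `(K - w) (K - conj w)` with `|z| ≠ |w|` have no common
kernel. -/
theorem eq_zero_of_quadFactor_eq_zero {K : E →L[ℝ] E} {z w : ℂ} (hzw : ‖z‖ ≠ ‖w‖) {x : E}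
    (hz : quadFactor K z x = 0) (hw : quadFactor K w x = 0) : x = 0 := by
  rw [quadFactor_apply] at hz hw
  by_contra hx
  have hsq : ‖z‖ ^ 2 - ‖w‖ ^ 2 ≠ 0 := by
    rw [sub_ne_zero]
    exact fun h => hzw ((pow_left_inj₀ (norm_nonneg _) (norm_nonneg _) two_ne_zero).1 h)
  -- Subtracting the two quadratics cancels `K (K x)`. Either the real parts agree and `x = 0` at
  -- once, or `x` is an eigenvector with a real eigenvalue `k`; a real root of the quadratic of `u`
  -- forces `u = k`, contradicting `|z| ≠ |w|`.
  have h1 : (2 * (z.re - w.re)) • K x = (‖z‖ ^ 2 - ‖w‖ ^ 2) • x := by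
    have : (2 * (z.re - w.re)) • K x - (‖z‖ ^ 2 - ‖w‖ ^ 2) • x =
      (K (K x) - (2 * w.re) • K x + (‖w‖ ^ 2) • x)
        - (K (K x) - (2 * z.re) • K x + (‖z‖ ^ 2) • x) := by module
    rw [hz, hw, sub_zero] at this
    exact sub_eq_zero.1 this
  rcases eq_or_ne (z.re - w.re) 0 with h0 | h0
  · rw [h0, mul_zero, zero_smul] at h1
    exact (smul_ne_zero hsq hx) h1.symm
  obtain ⟨k, hk⟩ : ∃ k : ℝ, K x = k • x := by
    refine ⟨(2 * (z.re - w.re))⁻¹ * (‖z‖ ^ 2 - ‖w‖ ^ 2), ?_⟩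
    rw [mul_smul, ← h1, inv_smul_smul₀ (mul_ne_zero two_ne_zero h0)]
  have key : ∀ u : ℂ, K (K x) - (2 * u.re) • K x + (‖u‖ ^ 2) • x = 0 → ‖u‖ ^ 2 = k ^ 2 := by
    intro u hu
    rw [hk, map_smul, hk] at hu
    have h2 : (k * k - 2 * u.re * k + ‖u‖ ^ 2) • x = 0 := by
      rw [← hu]; module
    have h3 := (smul_eq_zero.1 h2).resolve_right hx
    rw [Complex.sq_norm_eq] at h3 ⊢
    have h4 : (k - u.re) ^ 2 + u.im ^ 2 = 0 := by linarith
    have h5 : k - u.re = 0 := by nlinarith [sq_nonneg (k - u.re), sq_nonneg u.im]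
    have h6 : u.im ^ 2 = 0 := by nlinarith [sq_nonneg (k - u.re), sq_nonneg u.im]
    rw [h6, sub_eq_zero.1 h5, add_zero]
  exact hsq (by rw [key z hz, key w hw, sub_self])

/-- This says that `K` has no complex eigenvalue of modulus below `ρ` on the kernel of `s`. The
factors of `s` are peeled off one at a time; since they commute with `quadFactor K z`, the
intermediate vectors stay in its kernel. -/
theorem eq_zero_of_quadFactor_of_mem_quadMonoid {K : E →L[ℝ] E} {ρ : ℝ} {s : E →L[ℝ] E}
    (hs : s ∈ quadMonoid K ρ) {z : ℂ} (hz : ‖z‖ < ρ) {x : E} (hx : quadFactor K z x = 0)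
    (hsx : s x = 0) : x = 0 := by
  induction hs using Submonoid.closure_induction generalizing x with
  | mem s hs =>
    obtain ⟨w, hw, rfl⟩ := hs
    exact eq_zero_of_quadFactor_eq_zero (hz.trans_le hw).ne hx hsx
  | one => exact hsx
  | mul s t _ ht ihs iht =>
    refine iht hx (ihs ?_ hsx)
    have hc : Commute (quadFactor K z) t :=
      Commute.of_mem_quadMonoid ((Commute.refl K).quadFactor z).symm ht
    have := congrArg (fun f : E →L[ℝ] E => f x) hc.eq
    simp only [mul_apply_eq_comp] at this
    rw [this, hx, map_zero]

/-- There is no infinite strictly increasing sequence of closed subspaces, invariant under a compact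
operator `K`, on the successive quotients of which `K` is annihilated by operators
`(K - z) (K - conj z)` with `|z| ≥ ρ > 0`. -/
theorem IsCompactOperator.not_exists_strictMono {K : E →L[ℝ] E} (hK : IsCompactOperator K) {ρ : ℝ}
    (hρ : 0 < ρ) (W : ℕ → Submodule ℝ E) (hW : StrictMono W) (hcl : ∀ n, IsClosed (W n : Set E))
    (hinv : ∀ n, ∀ u ∈ W n, K u ∈ W n) (z : ℕ → ℂ) (hz : ∀ n, ρ ≤ ‖z n‖)
    (hfac : ∀ n, ∀ u ∈ W (n + 1), _root_.quadFactor K (z n) u ∈ W n) : False := by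
  have hex : ∀ n, ∃ u ∈ W (n + 1), ‖u‖ ≤ 3 ∧ ∀ y ∈ W n, 1 ≤ ‖u - y‖ := by
    intro n
    have hle := hW.monotone n.le_succ
    have h1 : IsClosed ((W n).comap (W (n + 1)).subtype : Set (W (n + 1))) :=
      (hcl n).preimage continuous_subtype_val
    have h2 : ∃ x : W (n + 1), x ∉ (W n).comap (W (n + 1)).subtype := by
      obtain ⟨x, hx, hx'⟩ := SetLike.exists_of_lt (hW n.lt_succ_self)
      exact ⟨⟨x, hx⟩, hx'⟩
    obtain ⟨⟨x, hx⟩, hxn, hxy⟩ := riesz_lemma_of_norm_lt (𝕜 := ℝ) (c := 2) (R := 3)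
      (by norm_num) (by norm_num) h1 h2
    exact ⟨x, hx, hxn, fun y hy => hxy ⟨y, hle hy⟩ hy⟩
  choose u hu hu3 hud using hex
  -- Chosen so that `K (v n)` equals `u n` modulo `W n`: solve the quadratic for its constant term.
  -- The bound `|z n| ≥ ρ` keeps `v n` bounded, while the images `K (v n)` are 1-separated,
  -- contradicting compactness.
  let v : ℕ → E := fun n => (‖z n‖ ^ 2)⁻¹ • ((2 * (z n).re) • u n - K (u n))
  have hzpos : ∀ n, 0 < ‖z n‖ := fun n => hρ.trans_le (hz n)
  have hKv : ∀ n, K (v n) = u n - (‖z n‖ ^ 2)⁻¹ • _root_.quadFactor K (z n) (u n) := by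
    intro n
    have hne : ‖z n‖ ^ 2 ≠ 0 := (pow_pos (hzpos n) 2).ne'
    simp only [v, map_smul, map_sub, quadFactor_apply, smul_sub, smul_add, inv_smul_smul₀ hne]
    abel
  have hvb : ∀ n, ‖v n‖ ≤ 6 / ρ + 3 * ‖K‖ / ρ ^ 2 := by
    intro n
    have h1 : ‖(2 * (z n).re) • u n‖ ≤ 2 * ‖z n‖ * 3 := by
      rw [norm_smul, Real.norm_eq_abs, abs_mul, abs_two]
      gcongr
      · exact Complex.abs_re_le_norm _
      · exact hu3 n
    have h2 : ‖K (u n)‖ ≤ ‖K‖ * 3 := (K.le_opNorm _).trans (by gcongr; exact hu3 n)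
    have h3 : (‖z n‖)⁻¹ ≤ ρ⁻¹ := by gcongr; exact hz n
    calc ‖v n‖ = (‖z n‖ ^ 2)⁻¹ * ‖(2 * (z n).re) • u n - K (u n)‖ := by
          simp only [v]
          rw [norm_smul, norm_inv, norm_pow, norm_norm]
      _ ≤ (‖z n‖ ^ 2)⁻¹ * (2 * ‖z n‖ * 3 + ‖K‖ * 3) := by
          gcongr
          exact (norm_sub_le _ _).trans (add_le_add h1 h2)
      _ = 6 * ‖z n‖⁻¹ + 3 * ‖K‖ * (‖z n‖⁻¹) ^ 2 := by
          have := (hzpos n).ne'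
          field_simp
          ring
      _ ≤ 6 * ρ⁻¹ + 3 * ‖K‖ * (ρ⁻¹) ^ 2 := by
          have : 0 < ‖z n‖⁻¹ := inv_pos.2 (hzpos n)
          gcongr
      _ = 6 / ρ + 3 * ‖K‖ / ρ ^ 2 := by
          rw [div_eq_mul_inv, div_eq_mul_inv, inv_pow]
  have hvmem : ∀ n, v n ∈ W (n + 1) := fun n =>
    (W _).smul_mem _ ((W _).sub_mem ((W _).smul_mem _ (hu n)) (hinv _ _ (hu n)))
  have hsep : ∀ m n, m < n → 1 ≤ ‖K (v n) - K (v m)‖ := by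
    intro m n hmn
    have h1 : (‖z n‖ ^ 2)⁻¹ • _root_.quadFactor K (z n) (u n) + K (v m) ∈ W n :=
      (W n).add_mem ((W n).smul_mem _ (hfac n _ (hu n)))
        (hinv n _ (hW.monotone hmn (hvmem m)))
    have := hud n _ h1
    rwa [← sub_sub, ← hKv n] at this
  obtain ⟨C, hC, hKC⟩ := hK.image_closedBall_subset_compact (f := (K : E →ₗ[ℝ] E))
    (6 / ρ + 3 * ‖K‖ / ρ ^ 2)
  obtain ⟨y, -, ψ, hψ, hψy⟩ := hC.tendsto_subseq (x := fun n => K (v n))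
    (fun n => hKC ⟨v n, by simpa using hvb n, rfl⟩)
  obtain ⟨N, hN⟩ := Metric.cauchySeq_iff'.1 hψy.cauchySeq 1 one_pos
  have h1 := hN (N + 1) N.le_succ
  rw [dist_eq_norm] at h1
  exact absurd h1 (not_lt.2 (hsep _ _ (hψ N.lt_succ_self)))

/-- For a compact operator `K` and `ρ > 0`, there is a largest closed subspace killed by a product
of operators `(K - z) (K - conj z)` with `|z| ≥ ρ`. -/
theorem IsCompactOperator.exists_maximal {K : E →L[ℝ] E} (hK : IsCompactOperator K) {ρ : ℝ}
    (hρ : 0 < ρ) : ∃ s ∈ quadMonoid K ρ, ∀ t ∈ quadMonoid K ρ, ∀ u, s (t u) = 0 → s u = 0 := by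
  let R : Submodule ℝ E → Prop := fun H => IsClosed (H : Set E) ∧ (∀ u ∈ H, K u ∈ H) ∧
    ∃ s ∈ quadMonoid K ρ, ∀ u ∈ H, s u = 0
  have hcomap : ∀ H, R H → ∀ z : ℂ, ρ ≤ ‖z‖ →
      R (H.comap (_root_.quadFactor K z : E →ₗ[ℝ] E)) := by
    rintro H ⟨hcl, hinv, s, hs, hsH⟩ z hz
    refine ⟨hcl.preimage (_root_.quadFactor K z).continuous, fun u hu => ?_,
      s * _root_.quadFactor K z, mul_mem hs (quadFactor_mem_quadMonoid K hz), fun u hu => hsH _ hu⟩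
    have := congrArg (fun f : E →L[ℝ] E => f u) ((Commute.refl K).quadFactor z).eq
    simp only [mul_apply_eq_comp] at this
    change _root_.quadFactor K z (K u) ∈ H
    rw [← this]
    exact hinv _ hu
  have hmax : ∃ H, R H ∧ ∀ z : ℂ, ρ ≤ ‖z‖ → ∀ u, _root_.quadFactor K z u ∈ H → u ∈ H := by
    by_contra! hno
    -- If no member of the family is stable under preimages by the factors, taking such a preimage
    -- strictly enlarges the subspace, and iterating from `⊥` gives the forbidden chain.
    have hstep : ∀ H : {H // R H}, ∃ H' : {H // R H}, H.1 < H'.1 ∧ ∃ z : ℂ, ρ ≤ ‖z‖ ∧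
        ∀ u ∈ H'.1, _root_.quadFactor K z u ∈ H.1 := by
      rintro ⟨H, hH⟩
      obtain ⟨z, hz, u, hu, hu'⟩ := hno H hH
      refine ⟨⟨_, hcomap H hH z hz⟩, ?_, z, hz, fun u hu => hu⟩
      refine lt_of_le_of_ne (fun v hv => ?_) fun h => hu' ?_
      · change _root_.quadFactor K z v ∈ H
        rw [quadFactor_apply]
        exact H.add_mem (H.sub_mem (hH.2.1 _ (hH.2.1 _ hv)) (H.smul_mem _ (hH.2.1 _ hv)))
          (H.smul_mem _ hv)
      · change H = _ at h
        rw [h]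
        exact hu
    choose next hlt z hz hfac using hstep
    have hbot : R ⊥ := ⟨by simp, by simp, 1, one_mem _, by simp⟩
    let W : ℕ → {H // R H} := fun n => next^[n] ⟨⊥, hbot⟩
    have hW : ∀ n, W (n + 1) = next (W n) := fun n => Function.iterate_succ_apply' _ _ _
    refine hK.not_exists_strictMono hρ (fun n => (W n).1) (strictMono_nat_of_lt_succ fun n => ?_)
      (fun n => (W n).2.1) (fun n => (W n).2.2.1) (fun n => z (W n)) (fun n => hz _)
      fun n u hu => ?_
    · rw [hW]; exact hlt _
    · rw [hW] at hu; exact hfac _ u hu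
  obtain ⟨H, ⟨-, -, s, hs, hsH⟩, hH⟩ := hmax
  have hall : ∀ t ∈ quadMonoid K ρ, ∀ u, t u ∈ H → u ∈ H := by
    intro t ht
    induction ht using Submonoid.closure_induction with
    | mem t ht => obtain ⟨z, hz, rfl⟩ := ht; exact hH z hz
    | one => exact fun u hu => hu
    | mul a b _ _ iha ihb => exact fun u hu => ihb u (iha _ hu)
  refine ⟨s, hs, fun t ht u hu => hsH u (hall t ht u (hall s hs _ ?_))⟩
  rw [hu]
  exact H.zero_mem

/-- Spectral splitting of a compact operator `K` at the radius `ρ > 0`: a continuous projection `Q`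
of finite rank which commutes with every operator commuting with `K`, such that `K ^ n` is
`O (ρ ^ n)` on the kernel of `Q` and expands at least like `σ ^ n`, for all `σ < ρ`, on its range. -/
theorem IsCompactOperator.exists_projection [CompleteSpace E] {K : E →L[ℝ] E}
    (hK : IsCompactOperator K) {ρ : ℝ} (hρ : 0 < ρ) :
    ∃ Q : E →L[ℝ] E, (∀ x, Q (Q x) = Q x) ∧ FiniteDimensional ℝ (LinearMap.range (Q : E →ₗ[ℝ] E)) ∧
      (∀ T : E →L[ℝ] E, Commute T K → ∀ x, Q (T x) = T (Q x)) ∧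
      (∃ C, 0 < C ∧ ∀ n x, Q x = 0 → ‖(K ^ n) x‖ ≤ C * ρ ^ n * ‖x‖) ∧
      ∀ σ, 0 < σ → σ < ρ → ∃ C, 0 < C ∧ ∀ n x, Q x = x → σ ^ n * ‖x‖ ≤ C * ‖(K ^ n) x‖ := by
  obtain ⟨s, hs, hmax⟩ := hK.exists_maximal hρ
  obtain ⟨c, hc, hcs⟩ := hK.exists_smul_one_sub hρ hs
  let H : Submodule ℝ E := LinearMap.ker (s : E →ₗ[ℝ] E)
  have memH : ∀ x, x ∈ H ↔ s x = 0 := fun x => LinearMap.mem_ker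
  have hHcl : IsClosed (H : Set E) := s.isClosed_ker
  have : CompleteSpace H := hHcl.completeSpace_coe
  have hfin : FiniteDimensional ℝ H := by
    -- The compact operator `c - s` acts on `ker s` as the nonzero scalar `c`.
    refine FiniteDimensional.of_isCompactOperator_id (𝕜 := ℝ) ?_
    have hmem : ∀ v ∈ H, ((c • 1 - s : E →L[ℝ] E) : E →ₗ[ℝ] E) v ∈ H := by
      intro v hv
      have : ((c • 1 - s : E →L[ℝ] E) : E →ₗ[ℝ] E) v = c • v := by
        simp [(memH v).1 hv]
      rw [this]
      exact H.smul_mem _ hv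
    have h1 := (IsCompactOperator.restrict (f := ((c • 1 - s : E →L[ℝ] E) : E →ₗ[ℝ] E)) hcs hmem
      hHcl).smul c⁻¹
    have h2 : (id : H → H) = c⁻¹ • ⇑(((c • 1 - s : E →L[ℝ] E) : E →ₗ[ℝ] E).restrict hmem) := by
      funext v
      refine Subtype.ext ?_
      simp [hc.ne']
    rw [h2]
    exact h1
  obtain ⟨p, hp⟩ := Submodule.ClosedComplemented.of_finiteDimensional H
  let P : E →L[ℝ] E := H.subtypeL.comp p
  have hPmem : ∀ x, P x ∈ H := fun x => (p x).2
  have hPid : ∀ x ∈ H, P x = x := fun x hx => congrArg Subtype.val (hp ⟨x, hx⟩)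
  have hss : ∀ x, s (s x) = 0 → s x = 0 := hmax s hs
  -- By maximality `ker s² = ker s`, so correcting `s` by a projection `P` onto its kernel makes it
  -- injective; `c - J` is still compact, hence `J` is invertible. Then `x = s (J⁻¹ x) + P (J⁻¹ x)`
  -- splits `E` into `range s` and `ker s`, and `P * J⁻¹` is the projection along `range s`.
  let J : E →L[ℝ] E := s + P
  have hJinj : ∀ x, J x = 0 → x = 0 := by
    intro x hx
    have h1 : s x = -P x := eq_neg_of_add_eq_zero_left hx
    have h2 : s x = 0 := hss x (by rw [h1, map_neg, (memH _).1 (hPmem x), neg_zero])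
    rw [h2, hPid x ((memH x).2 h2)] at h1
    exact neg_eq_zero.1 h1.symm
  have hJcomp : IsCompactOperator ((c • 1 - J : E →L[ℝ] E)) := by
    have hP : IsCompactOperator P :=
      by
      have := FiniteDimensional.proper_real H
      have hpc : IsCompactOperator p := isCompactOperator_of_locallyCompactSpace_dom p
      exact hpc.clm_comp H.subtypeL
    have h1 : IsCompactOperator ((c • 1 - s - P : E →L[ℝ] E)) := hcs.sub hP
    rwa [sub_sub] at h1
  have hJunit : IsUnit J := by
    rcases hJcomp.hasEigenvalue_or_mem_resolventSet hc.ne' with h | h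
    · obtain ⟨x, hx⟩ := h.exists_hasEigenvector
      refine absurd (hJinj x ?_) hx.2
      have := hx.apply_eq_smul
      simp only [ContinuousLinearMap.coe_coe, sub_apply,
        smul_apply, one_apply_eq_self] at this
      exact sub_eq_self.1 this
    · rw [spectrum.mem_resolventSet_iff, Algebra.algebraMap_eq_smul_one, sub_sub_cancel] at h
      exact h
  obtain ⟨⟨J', Ji, hJJi, hJiJ⟩, rfl : J' = J⟩ := hJunit
  have hinv : ∀ x, Ji (J x) = x := fun x => congrArg (fun f : E →L[ℝ] E => f x) hJiJ
  have hinv' : ∀ x, J (Ji x) = x := fun x => congrArg (fun f : E →L[ℝ] E => f x) hJJi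
  let Q : E →L[ℝ] E := P * Ji
  have hQmem : ∀ x, Q x ∈ H := fun x => hPmem _
  have hQid : ∀ x ∈ H, Q x = x := by
    intro x hx
    have h1 : J x = x := by
      change s x + P x = x
      rw [(memH x).1 hx, hPid x hx, zero_add]
    have h2 : Ji x = x := by conv_lhs => rw [← h1, hinv]
    change P (Ji x) = x
    rw [h2, hPid x hx]
  have hQs : ∀ x, Q (s x) = 0 := by
    intro x
    have h1 : J (x - P x) = s x := by
      change s (x - P x) + P (x - P x) = s x
      rw [map_sub, map_sub, (memH _).1 (hPmem x), hPid _ (hPmem x)]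
      simp
    change P (Ji (s x)) = 0
    rw [← h1, hinv, map_sub, hPid _ (hPmem x), sub_self]
  have hdec : ∀ x, x = s (Ji x) + Q x := fun x => (hinv' x).symm
  have hcomm : ∀ T : E →L[ℝ] E, Commute T K → ∀ x, Q (T x) = T (Q x) := by
    intro T hT x
    have hTs : ∀ y, T (s y) = s (T y) := fun y =>
      congrArg (fun f : E →L[ℝ] E => f y) (hT.of_mem_quadMonoid hs).eq
    have h1 : T x = s (T (Ji x)) + T (Q x) := by
      conv_lhs => rw [hdec x]
      rw [map_add, hTs]
    have h2 : T (Q x) ∈ H := (memH _).2 (by rw [← hTs, (memH _).1 (hQmem x), map_zero])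
    rw [h1, map_add, hQs, zero_add, hQid _ h2]
  have hKQ := hcomm K (Commute.refl K)
  refine ⟨Q, fun x => hQid _ (hQmem x), ?_, hcomm, ?_, ?_⟩
  · have hr : LinearMap.range (Q : E →ₗ[ℝ] E) ≤ H := by
      rintro _ ⟨x, rfl⟩
      exact hQmem x
    exact Submodule.finiteDimensional_of_le hr
  · let F : Submodule ℝ E := LinearMap.ker (Q : E →ₗ[ℝ] E)
    have hFcl : IsClosed (F : Set E) := Q.isClosed_ker
    have : CompleteSpace F := hFcl.completeSpace_coe
    have hKF : ∀ v ∈ F, (K : E →ₗ[ℝ] E) v ∈ F := fun v hv => by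
      have hv' : Q v = 0 := hv
      change Q (K v) = 0
      rw [hKQ, hv', map_zero]
    let KF : F →L[ℝ] F := ⟨(K : E →ₗ[ℝ] E).restrict hKF,
      (K.continuous.comp continuous_subtype_val).subtype_mk _⟩
    have hKFc : IsCompactOperator KF := IsCompactOperator.restrict (f := (K : E →ₗ[ℝ] E)) hK hKF hFcl
    have hKFpow : ∀ n (x : F), ((KF ^ n) x : E) = (K ^ n) (x : E) := by
      intro n
      induction n with
      | zero => intro x; rfl
      | succ n ih => intro x; rw [pow_succ, pow_succ]; exact ih (KF x)
    -- A vector of `ker Q` killed by a factor with `|z| ≥ ρ` lies in `ker s` by maximality, where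
    -- `Q` is the identity; so it vanishes.
    obtain ⟨C, hC, hCn⟩ := hKFc.exists_norm_pow_le hρ (by
      intro z hz x hx
      have h1 : _root_.quadFactor K z (x : E) = 0 := congrArg Subtype.val hx
      have h2 : s (x : E) = 0 := hmax _ (quadFactor_mem_quadMonoid K hz) _ (by rw [h1, map_zero])
      have h3 : Q (x : E) = 0 := x.2
      rw [hQid _ ((memH _).2 h2)] at h3
      exact Subtype.ext h3)
    refine ⟨C, hC, fun n x hx => ?_⟩
    calc ‖(K ^ n) x‖ = ‖(KF ^ n) ⟨x, hx⟩‖ := by rw [← Submodule.norm_coe, hKFpow]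
      _ ≤ ‖KF ^ n‖ * ‖(⟨x, hx⟩ : F)‖ := (KF ^ n).le_opNorm _
      _ ≤ C * ρ ^ n * ‖x‖ := by
        rw [← Submodule.norm_coe]
        gcongr
        exact hCn n
  · intro σ hσ hσρ
    have hKH : ∀ v ∈ H, (K : E →ₗ[ℝ] E) v ∈ H := fun v hv => by
      have h1 : K (s v) = s (K v) :=
        congrArg (fun f : E →L[ℝ] E => f v) ((Commute.refl K).of_mem_quadMonoid hs).eq
      rw [memH, ContinuousLinearMap.coe_coe, ← h1, (memH v).1 hv, map_zero]
    let KH : H →ₗ[ℝ] H := (K : E →ₗ[ℝ] E).restrict hKH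
    have hKHpow : ∀ n (x : H), ((KH ^ n) x : E) = (K ^ n) (x : E) := by
      intro n
      induction n with
      | zero => intro x; rfl
      | succ n ih => intro x; rw [pow_succ, pow_succ]; exact ih (KH x)
    have hinj : Function.Injective KH := by
      rw [injective_iff_map_eq_zero]
      intro v hv
      have h1 : K (v : E) = 0 := congrArg Subtype.val hv
      refine Subtype.ext (eq_zero_of_quadFactor_of_mem_quadMonoid hs (z := 0) (by simpa using hρ) ?_
        ((memH _).1 v.2))
      simp [quadFactor_apply, h1]
    let e := LinearEquiv.ofInjectiveEndo KH hinj
    let L : H →L[ℝ] H := LinearMap.toContinuousLinearMap (e.symm : H →ₗ[ℝ] H)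
    have hKL : ∀ v, KH (L v) = v := fun v => e.apply_symm_apply v
    have hLK : ∀ v, L (KH v) = v := fun v => e.symm_apply_apply v
    have hLKn : ∀ n v, (L ^ n) ((KH ^ n) v) = v := by
      intro n
      induction n with
      | zero => intro v; rfl
      | succ n ih =>
        intro v
        rw [pow_succ, pow_succ']
        change (L ^ n) (L (KH ((KH ^ n) v))) = v
        rw [hLK, ih]
    have hLc : IsCompactOperator L := by
      have := FiniteDimensional.proper_real H
      exact isCompactOperator_of_locallyCompactSpace_rng L
    -- An eigenvalue `w` of the inverse `L` with `|w| ≥ σ⁻¹` would give `K` the eigenvalue `w⁻¹` of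
    -- modulus at most `σ < ρ` on `ker s`. Applying `K` twice turns the quadratic of `w` in `L` into
    -- that of `w⁻¹` in `K`, up to the factor `|w|²`.
    obtain ⟨C, hC, hCn⟩ := hLc.exists_norm_pow_le (inv_pos.2 hσ) (by
      intro w hw x hx
      have hw0 : 0 < ‖w‖ := (inv_pos.2 hσ).trans_le hw
      have hwρ : ‖w⁻¹‖ < ρ := by
        rw [norm_inv]
        exact (inv_le_of_inv_le₀ hσ hw).trans_lt hσρ
      refine Subtype.ext (eq_zero_of_quadFactor_of_mem_quadMonoid hs hwρ ?_ ((memH _).1 x.2))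
      have h1 : KH (KH (_root_.quadFactor L w x)) = 0 := by rw [hx, map_zero, map_zero]
      rw [quadFactor_apply] at h1
      simp only [map_add, map_sub, map_smul, hKL] at h1
      have h2 : (x : E) - (2 * w.re) • K x + (‖w‖ ^ 2) • K (K x) = 0 := congrArg Subtype.val h1
      have h3 : (‖w‖ ^ 2)⁻¹ • ((x : E) - (2 * w.re) • K x + (‖w‖ ^ 2) • K (K x)) = 0 := by
        rw [h2, smul_zero]
      have hne : ‖w‖ ^ 2 ≠ 0 := (pow_pos hw0 2).ne'
      rw [quadFactor_apply, norm_inv, inv_pow, Complex.inv_re, ← Complex.sq_norm, ← h3, smul_add,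
        smul_sub, inv_smul_smul₀ hne, smul_smul, show 2 * (w.re / ‖w‖ ^ 2) =
          (‖w‖ ^ 2)⁻¹ * (2 * w.re) by ring]
      abel)
    refine ⟨C, hC, fun n x hx => ?_⟩
    have hxH : x ∈ H := hx ▸ hQmem x
    have h1 : ‖x‖ ≤ ‖L ^ n‖ * ‖(K ^ n) x‖ := by
      have h2 := (L ^ n).le_opNorm ((KH ^ n) ⟨x, hxH⟩)
      rwa [hLKn, ← Submodule.norm_coe, ← Submodule.norm_coe, hKHpow] at h2
    calc σ ^ n * ‖x‖ ≤ σ ^ n * (‖L ^ n‖ * ‖(K ^ n) x‖) := by gcongr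
      _ ≤ σ ^ n * (C * (σ⁻¹) ^ n * ‖(K ^ n) x‖) := by gcongr; exact hCn n
      _ = C * ‖(K ^ n) x‖ := by
        rw [inv_pow]
        have := (pow_pos hσ n).ne'
        field_simp

end Splitting

/-! ### Exponential rates -/

section Rates

variable {B : Type*} [NormedAddCommGroup B]

theorem ENNReal.log_enorm_le_iff (v : B) (a : ℝ) :
    ENNReal.log ‖v‖ₑ ≤ (a : EReal) ↔ ‖v‖ ≤ Real.exp a := by
  rw [show (a : EReal) = ENNReal.log (ENNReal.ofReal (Real.exp a)) by
    rw [ENNReal.log_ofReal_of_pos (Real.exp_pos a), Real.log_exp], ENNReal.log_le_log_iff,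
    ← ofReal_norm, ENNReal.ofReal_le_ofReal_iff (Real.exp_pos a).le]

theorem ENNReal.le_log_enorm_iff (v : B) (a : ℝ) :
    (a : EReal) ≤ ENNReal.log ‖v‖ₑ ↔ Real.exp a ≤ ‖v‖ := by
  rw [show (a : EReal) = ENNReal.log (ENNReal.ofReal (Real.exp a)) by
    rw [ENNReal.log_ofReal_of_pos (Real.exp_pos a), Real.log_exp], ENNReal.log_le_log_iff,
    ← ofReal_norm, ENNReal.ofReal_le_ofReal_iff (norm_nonneg v)]

theorem logRate_le_iff (v : B) {t : ℝ≥0} (ht : 0 < t) (c : ℝ) :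
    ENNReal.log ‖v‖ₑ / ((t : ℝ) : EReal) ≤ (c : EReal) ↔ ‖v‖ ≤ Real.exp (c * t) := by
  rw [EReal.div_le_iff_le_mul (by exact_mod_cast ht) (EReal.coe_ne_top _), ← EReal.coe_mul,
    ENNReal.log_enorm_le_iff, mul_comm]

theorem le_logRate_iff (v : B) {t : ℝ≥0} (ht : 0 < t) (c : ℝ) :
    (c : EReal) ≤ ENNReal.log ‖v‖ₑ / ((t : ℝ) : EReal) ↔ Real.exp (c * t) ≤ ‖v‖ := by
  rw [EReal.le_div_iff_mul_le (by exact_mod_cast ht) (EReal.coe_ne_top _), ← EReal.coe_mul,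
    ENNReal.le_log_enorm_iff]

/-- The exponential rate `(1 / t) log ‖g t‖` of a function `g`. -/
noncomputable def logRate (g : ℝ≥0 → B) (t : ℝ≥0) : EReal :=
  ENNReal.log ‖g t‖ₑ / ((t : ℝ) : EReal)

theorem tendsto_const_mul_exp_zero (C : ℝ) {c d : ℝ} (h : c < d) :
    Tendsto (fun t : ℝ≥0 => C * Real.exp (c * t) * Real.exp (-(d * t))) atTop (𝓝 0) := by
  have h1 : Tendsto (fun t : ℝ≥0 => (d - c) * (t : ℝ)) atTop atTop :=
    (NNReal.tendsto_coe_atTop.2 tendsto_id).const_mul_atTop (sub_pos.2 h)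
  have h2 := ((Real.tendsto_exp_neg_atTop_nhds_zero.comp h1).const_mul C)
  rw [mul_zero] at h2
  refine h2.congr fun t => ?_
  simp only [Function.comp]
  rw [mul_assoc, ← Real.exp_add]
  congr 2
  ring

theorem eventually_const_mul_exp_le (C : ℝ) {c d : ℝ} (h : c < d) :
    ∀ᶠ t : ℝ≥0 in atTop, C * Real.exp (c * t) ≤ Real.exp (d * t) := by
  filter_upwards [(tendsto_const_mul_exp_zero C h).eventually (ge_mem_nhds one_pos)] with t ht
  rwa [Real.exp_neg, ← div_eq_mul_inv, div_le_one (Real.exp_pos _)] at ht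

theorem limsup_logRate_le {g : ℝ≥0 → B} {C c : ℝ}
    (h : ∀ᶠ t : ℝ≥0 in atTop, ‖g t‖ ≤ C * Real.exp (c * t)) :
    limsup (logRate g) atTop ≤ (c : EReal) := by
  refine EReal.le_of_forall_lt_iff_le.1 fun d hd => ?_
  refine limsup_le_of_le (by isBoundedDefault) ?_
  filter_upwards [h, eventually_const_mul_exp_le C (EReal.coe_lt_coe_iff.1 hd),
    eventually_gt_atTop 0] with t h1 h2 h3
  exact (logRate_le_iff _ h3 d).2 (h1.trans h2)

theorem eventually_norm_le_of_limsup_lt {g : ℝ≥0 → B} {c : ℝ}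
    (h : limsup (logRate g) atTop < (c : EReal)) :
    ∀ᶠ t : ℝ≥0 in atTop, ‖g t‖ ≤ Real.exp (c * t) := by
  filter_upwards [eventually_lt_of_limsup_lt h, eventually_gt_atTop 0] with t h1 h2
  exact (logRate_le_iff _ h2 c).1 h1.le

theorem le_liminf_logRate {g : ℝ≥0 → B} {k c : ℝ} (hk : 0 < k)
    (h : ∀ᶠ t : ℝ≥0 in atTop, k * Real.exp (c * t) ≤ ‖g t‖) :
    (c : EReal) ≤ liminf (logRate g) atTop := by
  refine EReal.ge_of_forall_gt_iff_ge.1 fun d hd => ?_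
  refine le_liminf_of_le (by isBoundedDefault) ?_
  filter_upwards [h, eventually_const_mul_exp_le k⁻¹ (EReal.coe_lt_coe_iff.1 hd),
    eventually_gt_atTop 0] with t h1 h2 h3
  refine (le_logRate_iff _ h3 d).2 (le_trans ?_ h1)
  rwa [inv_mul_le_iff₀ hk] at h2

theorem tendsto_logRate_of_le {g : ℝ≥0 → B} {l : EReal} (h1 : l ≤ liminf (logRate g) atTop)
    (h2 : limsup (logRate g) atTop ≤ l) : Tendsto (logRate g) atTop (𝓝 l) :=
  tendsto_of_le_liminf_of_limsup_le h1 h2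

end Rates

/-! ### Growth rates and splittings of a semigroup -/

namespace C0Semigroup

variable {B : Type*} [NormedAddCommGroup B] [NormedSpace ℝ B] (T : C0Semigroup B)

theorem op_add_apply (t s : ℝ≥0) (x : B) : T.op (t + s) x = T.op t (T.op s x) := by
  rw [T.op_add]; rfl

theorem op_zero_apply (x : B) : T.op 0 x = x := by
  rw [T.op_zero]; rfl

theorem op_comm_apply (t s : ℝ≥0) (x : B) : T.op t (T.op s x) = T.op s (T.op t x) := by
  rw [← op_add_apply, add_comm, op_add_apply]

theorem commute_op (t s : ℝ≥0) : Commute (T.op t) (T.op s) :=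
  ContinuousLinearMap.ext fun x => T.op_comm_apply t s x

theorem op_pow (t : ℝ≥0) (n : ℕ) : T.op t ^ n = T.op (n * t) := by
  induction n with
  | zero => simp [T.op_zero]; rfl
  | succ n ih => rw [pow_succ, ih, Nat.cast_succ, add_mul, one_mul, T.op_add]; rfl

variable {T}

theorem growthRate_le {x : B} {C c : ℝ}
    (h : ∀ᶠ t : ℝ≥0 in atTop, ‖T.op t x‖ ≤ C * Real.exp (c * t)) : T.growthRate x ≤ c :=
  limsup_logRate_le h

theorem eventually_norm_le {x : B} {c : ℝ} (h : T.growthRate x < c) :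
    ∀ᶠ t : ℝ≥0 in atTop, ‖T.op t x‖ ≤ Real.exp (c * t) :=
  eventually_norm_le_of_limsup_lt h

theorem growthRate_add_le {x y : B} {lam : EReal} (hx : T.growthRate x ≤ lam)
    (hy : T.growthRate y ≤ lam) : T.growthRate (x + y) ≤ lam := by
  refine EReal.le_of_forall_lt_iff_le.1 fun c hc => growthRate_le (C := 2) ?_
  filter_upwards [eventually_norm_le (hx.trans_lt hc), eventually_norm_le (hy.trans_lt hc)]
    with t h1 h2
  rw [map_add, two_mul]
  exact (norm_add_le _ _).trans (add_le_add h1 h2)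

theorem growthRate_map_le (S : B →L[ℝ] B) (hS : ∀ t x, S (T.op t x) = T.op t (S x)) (x : B) :
    T.growthRate (S x) ≤ T.growthRate x := by
  refine EReal.le_of_forall_lt_iff_le.1 fun c hc => growthRate_le (C := ‖S‖) ?_
  filter_upwards [eventually_norm_le hc] with t h1
  rw [← hS]
  exact (S.le_opNorm _).trans (by gcongr)

theorem growthRate_op_le (s : ℝ≥0) (x : B) : T.growthRate (T.op s x) ≤ T.growthRate x :=
  growthRate_map_le (T.op s) (fun _ _ => T.op_comm_apply _ _ _) x

theorem growthRate_zero : T.growthRate (0 : B) = ⊥ := by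
  refine le_bot_iff.1 (EReal.le_of_forall_lt_iff_le.1 fun c hc => growthRate_le (C := 0) ?_)
  simp

variable (T) in
/-- The subspace of vectors of growth rate at most `lam`. -/
noncomputable def growthSubmodule (lam : EReal) : Submodule ℝ B where
  carrier := T.growthSet lam
  add_mem' := growthRate_add_le
  zero_mem' := by
    change T.growthRate 0 ≤ lam
    rw [growthRate_zero]; exact bot_le
  smul_mem' c x hx := (growthRate_map_le (c • ContinuousLinearMap.id ℝ B) (by simp) x).trans hx

theorem mem_growthSubmodule {lam : EReal} {x : B} :
    x ∈ T.growthSubmodule lam ↔ T.growthRate x ≤ lam := Iff.rfl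

theorem growthSubmodule_mono {a b : EReal} (h : a ≤ b) :
    T.growthSubmodule a ≤ T.growthSubmodule b := fun _ hx => le_trans hx h

theorem exists_norm_op_le [CompleteSpace B] (T : C0Semigroup B) (t₀ : ℝ≥0) :
    ∃ M, 0 < M ∧ ∀ t ≤ t₀, ‖T.op t‖ ≤ M := by
  obtain ⟨C, hC⟩ := banach_steinhaus (g := fun t : Set.Icc 0 t₀ => T.op t) fun x => by
    obtain ⟨C, hC⟩ := isCompact_Icc.exists_bound_of_continuousOn (s := Set.Icc 0 t₀)
      (T.continuous_orbit x).continuousOn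
    exact ⟨C, fun t => hC t t.2⟩
  exact ⟨|C| + 1, by positivity, fun t ht =>
    (hC ⟨t, zero_le, ht⟩).trans ((le_abs_self C).trans (by linarith))⟩

/-- A projection `Q` of finite rank that splits the semigroup `T` at the exponential rate `c`:
`T` is `O (exp (c t))` on the kernel of `Q` and grows at least like `exp (c' t)`, for all `c' < c`,
on its range. -/
structure IsSplitting (T : C0Semigroup B) (c : ℝ) (Q : B →L[ℝ] B) : Prop where
  idem : ∀ x, Q (Q x) = Q x
  finite : FiniteDimensional ℝ (LinearMap.range (Q : B →ₗ[ℝ] B))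
  comm : ∀ t x, Q (T.op t x) = T.op t (Q x)
  upper : ∃ C, 0 < C ∧ ∀ (t : ℝ≥0) x, Q x = 0 → ‖T.op t x‖ ≤ C * Real.exp (c * t) * ‖x‖
  lower : ∀ c' < c, ∃ C, 0 < C ∧ ∀ (t : ℝ≥0) x, Q x = x → Real.exp (c' * t) * ‖x‖ ≤ C * ‖T.op t x‖

theorem exists_isSplitting [CompleteSpace B] {T : C0Semigroup B} {r : ℝ≥0}
    (hT : ∀ t, r ≤ t → IsCompactOperator (T.op t)) (c : ℝ) : ∃ Q, T.IsSplitting c Q := by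
  -- Adding `1` makes the sampling time positive even when `r = 0`.
  set t₀ : ℝ≥0 := r + 1
  have ht₀ : 0 < t₀ := by positivity
  have ht₀' : (0 : ℝ) < t₀ := ht₀
  obtain ⟨M, hM, hTM⟩ := T.exists_norm_op_le t₀
  obtain ⟨Q, h1, h2, h3, ⟨C, hC, h4⟩, h5⟩ :=
    (hT t₀ (by simp [t₀])).exists_projection (Real.exp_pos (c * t₀))
  have hexp : ∀ (d : ℝ) (n : ℕ), Real.exp (d * t₀) ^ n = Real.exp (d * (n * t₀)) := by
    intro d n
    rw [← Real.exp_nat_mul]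
    congr 1
    ring
  refine ⟨Q, h1, h2, fun t x => h3 _ (T.commute_op t t₀) x, ?_, fun c' hc' => ?_⟩
  · refine ⟨M * C * Real.exp (|c| * t₀), by positivity, fun t x hx => ?_⟩
    -- Rounding down, `T t` is `T s` after a power of `T t₀` with `s ≤ t₀`. The factor `exp (|c|
    -- t₀)` pays for replacing `n t₀` by `t`, whatever the sign of `c`.
    set n := ⌊t / t₀⌋₊
    have hn1 : (n : ℝ≥0) * t₀ ≤ t := (le_div_iff₀ ht₀).1 (Nat.floor_le zero_le)
    have hn2 : t < (n + 1) * t₀ := (div_lt_iff₀ ht₀).1 (Nat.lt_floor_add_one _)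
    obtain ⟨s, hts⟩ := exists_add_of_le hn1
    have hs : s ≤ t₀ := by
      rw [hts, add_mul, one_mul] at hn2
      exact (lt_of_add_lt_add_left hn2).le
    have h6 := h4 n x hx
    rw [T.op_pow, hexp] at h6
    have hts' : (t : ℝ) = n * t₀ + s := by exact_mod_cast hts
    rw [hts', hts, add_comm, T.op_add_apply]
    calc ‖T.op s (T.op (n * t₀) x)‖ ≤ M * (C * Real.exp (c * (n * t₀)) * ‖x‖) :=
          (T.op s).le_of_opNorm_le_of_le (hTM s hs) h6
      _ ≤ M * (C * (Real.exp (|c| * t₀) * Real.exp (c * (n * t₀ + s))) * ‖x‖) := by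
          rw [← Real.exp_add]
          gcongr
          have hs' : (s : ℝ) ≤ t₀ := hs
          nlinarith [mul_le_mul_of_nonneg_left hs' (abs_nonneg c),
            mul_le_mul_of_nonneg_right (neg_abs_le c) s.coe_nonneg]
      _ = _ := by ring
  · obtain ⟨D, hD, h6⟩ := h5 (Real.exp (c' * t₀)) (Real.exp_pos _)
      (Real.exp_lt_exp.2 (mul_lt_mul_of_pos_right hc' ht₀'))
    refine ⟨D * M * Real.exp (|c'| * t₀), by positivity, fun t x hx => ?_⟩
    -- For the lower bound `t` is rounded up: expansion is known at `n t₀ = t + s`, and `‖T s‖ ≤ M`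
    -- brings it back to time `t`.
    set n := ⌊t / t₀⌋₊ + 1
    have hn1 : t ≤ n * t₀ := by
      have := ((div_lt_iff₀ ht₀).1 (Nat.lt_floor_add_one (t / t₀))).le
      simpa [n] using this
    have hn2 : (n : ℝ≥0) * t₀ ≤ t + t₀ := by
      have := (le_div_iff₀ ht₀).1 (Nat.floor_le (zero_le (a := t / t₀)))
      simp only [n, Nat.cast_succ, add_mul, one_mul]
      gcongr
    obtain ⟨s, hs⟩ := exists_add_of_le hn1
    have hst : s ≤ t₀ := by
      rw [hs] at hn2
      exact le_of_add_le_add_left hn2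
    have h7 := h6 n x hx
    rw [T.op_pow, hexp, hs, add_comm t s, T.op_add_apply] at h7
    have hnt : (n : ℝ) * t₀ = t + s := by exact_mod_cast hs
    rw [hnt] at h7
    have hs' : (s : ℝ) ≤ t₀ := hst
    calc Real.exp (c' * t) * ‖x‖ ≤ Real.exp (|c'| * t₀) * Real.exp (c' * (t + s)) * ‖x‖ := by
          rw [← Real.exp_add]
          gcongr
          nlinarith [mul_le_mul_of_nonneg_left hs' (abs_nonneg c'),
            mul_le_mul_of_nonneg_right (neg_abs_le c') s.coe_nonneg]
      _ = Real.exp (|c'| * t₀) * (Real.exp (c' * (t + s)) * ‖x‖) := by ring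
      _ ≤ Real.exp (|c'| * t₀) * (D * ‖T.op s (T.op t x)‖) := by gcongr
      _ ≤ Real.exp (|c'| * t₀) * (D * (M * ‖T.op t x‖)) := by
          gcongr
          exact (T.op s).le_of_opNorm_le (hTM s hst) _
      _ = _ := by ring

end C0Semigroup

/-! ### Decreasing enumeration of a set of extended reals -/

/-- The decreasing enumeration of a set of extended reals, continued by `⊥` once it is exhausted. -/
noncomputable def EReal.decreasingSeq (R : Set EReal) : ℕ → EReal
  | 0 => sSup R
  | n + 1 => sSup {a ∈ R | a < EReal.decreasingSeq R n}

section DecreasingSeq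

variable {R : Set EReal}

/-- If `A` has an element above `⊥`, only finitely many elements compete with it, so a maximum
exists; otherwise `A = {⊥}`. -/
theorem EReal.sSup_mem_of_finite {A : Set EReal} (hbot : ⊥ ∈ A)
    (hfin : ∀ c : ℝ, {a ∈ A | (c : EReal) ≤ a}.Finite) : sSup A ∈ A := by
  by_cases h : ∀ a ∈ A, a = ⊥
  · have : A = {⊥} := Set.eq_singleton_iff_unique_mem.2 ⟨hbot, h⟩
    simp [this]
  · push Not at h
    obtain ⟨a, ha, ha'⟩ := h
    obtain ⟨c, -, hc⟩ := EReal.lt_iff_exists_real_btwn.1 (bot_lt_iff_ne_bot.2 ha')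
    obtain ⟨b, hb, hmax⟩ := (hfin c).exists_maximalFor id _ ⟨a, ha, hc.le⟩
    have : sSup A = b := by
      refine le_antisymm (sSup_le fun x hx => ?_) (le_sSup hb.1)
      rcases le_total b x with h1 | h1
      · exact hmax (show x ∈ {a ∈ A | (c : EReal) ≤ a} from ⟨hx, hb.2.trans h1⟩) h1
      · exact h1
    rw [this]
    exact hb.1

variable (hbot : ⊥ ∈ R) (hfin : ∀ c : ℝ, {a ∈ R | (c : EReal) ≤ a}.Finite)
include hbot hfin

theorem EReal.decreasingSeq_succ_lt {n : ℕ} (hn : EReal.decreasingSeq R n ≠ ⊥) :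
    EReal.decreasingSeq R (n + 1) ∈ {a ∈ R | a < EReal.decreasingSeq R n} :=
  EReal.sSup_mem_of_finite (A := {a ∈ R | a < EReal.decreasingSeq R n}) ⟨hbot, bot_lt_iff_ne_bot.2 hn⟩
    fun c => (hfin c).subset fun _ ha => ⟨ha.1.1, ha.2⟩

omit hfin hbot in
theorem EReal.decreasingSeq_succ_eq_bot {n : ℕ} (hn : EReal.decreasingSeq R n = ⊥) :
    EReal.decreasingSeq R (n + 1) = ⊥ := by
  simp [EReal.decreasingSeq, hn]

theorem EReal.decreasingSeq_mem (n : ℕ) : EReal.decreasingSeq R n ∈ R := by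
  cases n with
  | zero => exact EReal.sSup_mem_of_finite hbot hfin
  | succ n =>
    by_cases hn : EReal.decreasingSeq R n = ⊥
    · rwa [EReal.decreasingSeq_succ_eq_bot hn]
    · exact (EReal.decreasingSeq_succ_lt hbot hfin hn).1

theorem EReal.tendsto_decreasingSeq : Tendsto (EReal.decreasingSeq R) atTop (𝓝 ⊥) := by
  have hanti : Antitone (EReal.decreasingSeq R) := antitone_nat_of_succ_le fun n => by
    by_cases hn : EReal.decreasingSeq R n = ⊥
    · rw [EReal.decreasingSeq_succ_eq_bot hn]; exact bot_le
    · exact (EReal.decreasingSeq_succ_lt hbot hfin hn).2.le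
  rw [EReal.tendsto_nhds_bot_iff_real]
  intro c
  by_contra hno
  have hge : ∀ n, (c : EReal) ≤ EReal.decreasingSeq R n := by
    intro n
    by_contra! hn
    exact hno (eventually_atTop.2 ⟨n, fun m hm => (hanti hm).trans_lt hn⟩)
  have hstrict : StrictAnti (EReal.decreasingSeq R) := strictAnti_nat_of_succ_lt fun n =>
    (EReal.decreasingSeq_succ_lt hbot hfin fun h => by
      have := hge n
      rw [h] at this
      exact absurd this (not_le.2 (EReal.bot_lt_coe c))).2
  exact Set.infinite_of_injective_forall_mem hstrict.injective
    (s := {a ∈ R | (c : EReal) ≤ a})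
    (fun n => ⟨EReal.decreasingSeq_mem hbot hfin n, hge n⟩) (hfin c)

omit hfin hbot in
theorem EReal.le_decreasingSeq_succ {n : ℕ} {a : EReal} (ha : a ∈ R)
    (h : a < EReal.decreasingSeq R n) : a ≤ EReal.decreasingSeq R (n + 1) :=
  le_sSup ⟨ha, h⟩

omit hfin hbot in
-- Uniqueness of the exponents is reduced to this: a sequence in `R` that starts at its top and
-- skips no element is the enumeration.
theorem EReal.eq_decreasingSeq {lam : ℕ → EReal} (hmem : ∀ n, lam n ∈ R) (h0 : ∀ a ∈ R, a ≤ lam 0)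
    (hdec : ∀ n, lam (n + 1) < lam n ∨ (lam n = ⊥ ∧ lam (n + 1) = ⊥))
    (hsucc : ∀ n, ∀ a ∈ R, a < lam n → a ≤ lam (n + 1)) : lam = EReal.decreasingSeq R := by
  funext n
  induction n with
  | zero => exact le_antisymm (le_sSup (hmem 0)) (sSup_le h0)
  | succ n ih =>
    rcases hdec n with h | ⟨h, h'⟩
    · refine le_antisymm (le_sSup ⟨hmem _, ih ▸ h⟩) (sSup_le fun a ha => hsucc n a ha.1 ?_)
      rw [ih]; exact ha.2
    · rw [h', EReal.decreasingSeq_succ_eq_bot (ih ▸ h)]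

end DecreasingSeq

/-! ### Codimensions -/

section Codim

variable {B : Type*} [AddCommGroup B] [Module ℝ B]

theorem Submodule.finite_quotient_of_le {F F' : Submodule ℝ B} (h : F' ≤ F)
    [Module.Finite ℝ (B ⧸ F')] : Module.Finite ℝ (B ⧸ F) :=
  Module.Finite.of_surjective (Submodule.factor h) (Submodule.factor_surjective h)

theorem Submodule.finrank_quotient_add_of_isCompl {F F' H : Submodule ℝ B} (hd : Disjoint H F')
    (hs : H ⊔ F' = F) [Module.Finite ℝ (B ⧸ F')] :
    Module.finrank ℝ (B ⧸ F') = Module.finrank ℝ (B ⧸ F) + Module.finrank ℝ H := by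
  have hle : F' ≤ F := hs ▸ le_sup_right
  have h1 := LinearMap.finrank_range_add_finrank_ker (Submodule.factor hle)
  rw [LinearMap.range_eq_top.2 (Submodule.factor_surjective hle), finrank_top] at h1
  rw [← h1]
  congr 1
  -- The kernel of `B ⧸ F' → B ⧸ F` is `F ⧸ F'`, which the complement `H` represents isomorphically.
  have hker : LinearMap.ker (Submodule.factor hle) = LinearMap.range (F'.mkQ.domRestrict H) := by
    ext x
    obtain ⟨x, rfl⟩ := F'.mkQ_surjective x
    constructor
    · intro hx
      have hx : x ∈ F := by simpa using hx
      rw [← hs] at hx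
      obtain ⟨y, hy, z, hz, rfl⟩ := Submodule.mem_sup.1 hx
      refine ⟨⟨y, hy⟩, ?_⟩
      simp [(Submodule.Quotient.mk_eq_zero F').2 hz]
    · rintro ⟨y, hy⟩
      have hyF : (y : B) ∈ F := hs ▸ Submodule.mem_sup_left y.2
      rw [← hy]
      simpa using hyF
  rw [hker]
  refine LinearMap.finrank_range_of_inj ?_
  rw [injective_iff_map_eq_zero]
  intro y hy
  have : (y : B) ∈ F' := by simpa using hy
  exact Subtype.ext ((Submodule.disjoint_def.1 hd) y y.2 this)

theorem Submodule.finrank_quotient_le_of_le {F F' : Submodule ℝ B} (h : F' ≤ F)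
    [Module.Finite ℝ (B ⧸ F')] : Module.finrank ℝ (B ⧸ F) ≤ Module.finrank ℝ (B ⧸ F') :=
  LinearMap.finrank_le_finrank_of_surjective (f := Submodule.factor h)
    (Submodule.factor_surjective h)

theorem Submodule.finrank_quotient_lt_of_lt {F F' : Submodule ℝ B} (h : F' < F)
    [Module.Finite ℝ (B ⧸ F')] : Module.finrank ℝ (B ⧸ F) < Module.finrank ℝ (B ⧸ F') := by
  have : Module.Finite ℝ (B ⧸ F) := Submodule.finite_quotient_of_le h.le
  refine lt_of_le_of_ne (Submodule.finrank_quotient_le_of_le h.le) fun heq => h.not_ge fun x hx => ?_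
  have hinj := (LinearMap.injective_iff_surjective_of_finrank_eq_finrank heq.symm
    (f := Submodule.factor h.le)).2 (Submodule.factor_surjective h.le)
  have : F'.mkQ x = 0 := hinj (by simpa using hx)
  simpa using this

end Codim

/-! ### Consequences of a splitting for growth rates -/

namespace C0Semigroup

variable {B : Type*} [NormedAddCommGroup B] [NormedSpace ℝ B] {T : C0Semigroup B}

theorem growthRate_lt_top [CompleteSpace B] (T : C0Semigroup B) (x : B) : T.growthRate x < ⊤ := by
  obtain ⟨M, hM, hTM⟩ := T.exists_norm_op_le 1
  refine lt_of_le_of_lt (growthRate_le (c := ‖T.op 1‖) (C := M * ‖x‖) (.of_forall fun t => ?_))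
    (EReal.coe_lt_top _)
  set n := ⌊t⌋₊
  have hn1 : (n : ℝ≥0) ≤ t := Nat.floor_le zero_le
  obtain ⟨s, hs⟩ := exists_add_of_le hn1
  have hs1 : s ≤ 1 := by
    have h0 : t ≤ n + 1 := (Nat.lt_floor_add_one t).le
    have h0' : (n : ℝ≥0) + s ≤ n + 1 := hs ▸ h0
    exact le_of_add_le_add_left h0'
  have h1 : ‖T.op n x‖ ≤ Real.exp (‖T.op 1‖ * t) * ‖x‖ := by
    have h2 : T.op n = T.op 1 ^ n := by rw [T.op_pow, mul_one]
    rw [h2]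
    refine ((T.op 1 ^ n).le_opNorm x).trans ?_
    gcongr
    have h3 : ‖T.op 1‖ ≤ Real.exp ‖T.op 1‖ := (by linarith : ‖T.op 1‖ ≤ ‖T.op 1‖ + 1).trans
      (Real.add_one_le_exp _)
    rcases Nat.eq_zero_or_pos n with h0 | h0
    · rw [h0, pow_zero]
      exact (ContinuousLinearMap.norm_id_le).trans (Real.one_le_exp (by positivity))
    · calc ‖T.op 1 ^ n‖ ≤ ‖T.op 1‖ ^ n := norm_pow_le' _ h0
        _ ≤ Real.exp ‖T.op 1‖ ^ n := by gcongr
        _ = Real.exp (‖T.op 1‖ * n) := by rw [← Real.exp_nat_mul, mul_comm]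
        _ ≤ _ := by
          gcongr
          exact_mod_cast hn1
  calc ‖T.op t x‖ = ‖T.op s (T.op n x)‖ := by rw [← T.op_add_apply, hs, add_comm]
    _ ≤ M * (Real.exp (‖T.op 1‖ * t) * ‖x‖) := (T.op s).le_of_opNorm_le_of_le (hTM s hs1) h1
    _ = _ := by ring

namespace IsSplitting

variable {c : ℝ} {Q : B →L[ℝ] B} (hQ : T.IsSplitting c Q)
include hQ

theorem growthRate_le_of_eq_zero {x : B} (hx : Q x = 0) : T.growthRate x ≤ c := by
  obtain ⟨C, -, hC⟩ := hQ.upper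
  refine growthRate_le (C := C * ‖x‖) (.of_forall fun t => (hC t x hx).trans (le_of_eq (by ring)))

/-- The component `Q x` expands at every rate below `c`, and since `Q` is bounded and commutes with
`T`, the full orbit is at least a constant times as large. -/
theorem le_liminf_of_ne_zero {x : B} (hx : Q x ≠ 0) : (c : EReal) ≤ liminf (T.logGrowth x) atTop := by
  refine EReal.ge_of_forall_gt_iff_ge.1 fun d hd => ?_
  obtain ⟨C, hC, hCt⟩ := hQ.lower d (EReal.coe_lt_coe_iff.1 hd)
  have hx' : 0 < ‖Q x‖ := norm_pos_iff.2 hx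
  refine le_liminf_logRate (g := fun t => T.op t x) (k := ‖Q x‖ / (C * (‖Q‖ + 1))) (by positivity)
    (.of_forall fun t => ?_)
  have h1 := hCt t (Q x) (hQ.idem x)
  rw [← hQ.comm] at h1
  have h2 : ‖Q (T.op t x)‖ ≤ (‖Q‖ + 1) * ‖T.op t x‖ :=
    (Q.le_opNorm _).trans (by gcongr; linarith)
  rw [div_mul_eq_mul_div, div_le_iff₀ (by positivity)]
  calc ‖Q x‖ * Real.exp (d * t) = Real.exp (d * t) * ‖Q x‖ := mul_comm _ _
    _ ≤ C * ‖Q (T.op t x)‖ := h1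
    _ ≤ C * ((‖Q‖ + 1) * ‖T.op t x‖) := by gcongr
    _ = _ := by ring

theorem eq_zero_of_growthRate_lt {x : B} (hx : T.growthRate x < c) : Q x = 0 := by
  by_contra h
  exact absurd (hQ.le_liminf_of_ne_zero h) (not_le.2 (lt_of_le_of_lt (liminf_le_limsup) hx))

theorem mem_range_iff {x : B} : x ∈ LinearMap.range (Q : B →ₗ[ℝ] B) ↔ Q x = x :=
  ⟨by rintro ⟨y, rfl⟩; exact hQ.idem y, fun h => ⟨x, h⟩⟩

theorem finite_quotient {F : Submodule ℝ B} (hF : ∀ x, T.growthRate x ≤ c → x ∈ F) :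
    Module.Finite ℝ (B ⧸ F) := by
  have := hQ.finite
  have : Module.Finite ℝ (B ⧸ LinearMap.ker (Q : B →ₗ[ℝ] B)) :=
    Module.Finite.equiv (LinearMap.quotKerEquivRange (Q : B →ₗ[ℝ] B)).symm
  exact Submodule.finite_quotient_of_le (F' := LinearMap.ker (Q : B →ₗ[ℝ] B))
    fun x hx => hF x (hQ.growthRate_le_of_eq_zero hx)

/-- Vectors with a backward orbit that decays faster than `exp (-c t)` lie in the range of a
splitting projection at the rate `c`. -/
theorem apply_eq_self_of_backward {x : B} {g : ℝ≥0 → B} (hg : ∀ t, T.op t (g t) = x) {C d : ℝ}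
    (hd : c < d) (hgd : ∀ᶠ t : ℝ≥0 in atTop, ‖g t‖ ≤ C * Real.exp (-(d * t))) : Q x = x := by
  obtain ⟨D, hD, hDt⟩ := hQ.upper
  have h1 : ∀ᶠ t : ℝ≥0 in atTop, ‖x - Q x‖ ≤
      D * (1 + ‖Q‖) * C * Real.exp (c * t) * Real.exp (-(d * t)) := by
    filter_upwards [hgd] with t ht
    -- The component of `x` in `ker Q` is transported forward from `g t`, at a cost of at most `exp
    -- (c t)`; the faster decay of `g` sends it to zero.
    have h2 : x - Q x = T.op t (g t - Q (g t)) := by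
      rw [map_sub, ← hQ.comm, hg]
    have h3 : ‖g t - Q (g t)‖ ≤ (1 + ‖Q‖) * ‖g t‖ := by
      refine (norm_sub_le _ _).trans ?_
      rw [add_mul, one_mul]
      gcongr
      exact Q.le_opNorm _
    rw [h2]
    calc ‖T.op t (g t - Q (g t))‖ ≤ D * Real.exp (c * t) * ‖g t - Q (g t)‖ :=
          hDt t _ (by rw [map_sub, hQ.idem, sub_self])
      _ ≤ D * Real.exp (c * t) * ((1 + ‖Q‖) * (C * Real.exp (-(d * t)))) := by
          gcongr
          exact h3.trans (by gcongr)
      _ = _ := by ring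
  have h4 : ‖x - Q x‖ ≤ 0 := ge_of_tendsto (tendsto_const_mul_exp_zero _ hd) h1
  exact (sub_eq_zero.1 (norm_le_zero_iff.1 h4)).symm

end IsSplitting

/-! ### The Lyapunov filtration -/

section Structure

variable (hT : ∀ c : ℝ, ∃ Q, T.IsSplitting c Q)
include hT

/-- A splitting leaves no room between the two limits: if `c` lies below the limsup, then `Q x ≠ 0`,
and so `c` is at most the liminf. -/
theorem tendsto_logGrowth (x : B) : Tendsto (T.logGrowth x) atTop (𝓝 (T.growthRate x)) := by
  refine tendsto_of_le_liminf_of_limsup_le (EReal.ge_of_forall_gt_iff_ge.1 fun c hc => ?_) le_rfl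
  obtain ⟨Q, hQ⟩ := hT c
  refine hQ.le_liminf_of_ne_zero fun h => ?_
  exact absurd (hQ.growthRate_le_of_eq_zero h) (not_le.2 hc)

/-- Split at `c - 1`. The `Q`-images of the growth spaces gain dimension at each rate `≥ c`, because
`ker Q` only contains rates at most `c - 1`; their dimensions therefore label these rates
injectively by numbers up to the rank of `Q`. -/
theorem finite_growthRate_ge (c : ℝ) :
    {a ∈ Set.range T.growthRate | (c : EReal) ≤ a}.Finite := by
  obtain ⟨Q, hQ⟩ := hT (c - 1)
  have hcc : ((c - 1 : ℝ) : EReal) < c := EReal.coe_lt_coe_iff.2 (by linarith)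
  have := hQ.finite
  let N := Module.finrank ℝ (LinearMap.range (Q : B →ₗ[ℝ] B))
  let W : EReal → Submodule ℝ B := fun a => (T.growthSubmodule a).map (Q : B →ₗ[ℝ] B)
  have hWle : ∀ a, W a ≤ LinearMap.range (Q : B →ₗ[ℝ] B) := fun a => LinearMap.map_le_range
  have hWfin : ∀ a, Module.Finite ℝ (W a) := fun a => Submodule.finiteDimensional_of_le (hWle a)
  have hlt : ∀ a b, b ∈ {a ∈ Set.range T.growthRate | (c : EReal) ≤ a} → a < b →
      Module.finrank ℝ (W a) < Module.finrank ℝ (W b) := by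
    rintro a b ⟨⟨x, rfl⟩, hx⟩ hab
    refine Submodule.finrank_lt_finrank_of_lt (lt_of_le_of_ne
      (Submodule.map_mono (growthSubmodule_mono hab.le)) fun heq => ?_)
    have hxW : Q x ∈ W (T.growthRate x) := ⟨x, mem_growthSubmodule.2 le_rfl, rfl⟩
    rw [← heq] at hxW
    obtain ⟨y, hy, hyx⟩ := hxW
    have h1 : Q (x - y) = 0 := by rw [map_sub, sub_eq_zero]; exact hyx.symm
    have h2 := hQ.growthRate_le_of_eq_zero h1
    have h3 : T.growthRate (y + (x - y)) ≤ max a ((c - 1 : ℝ) : EReal) :=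
      growthRate_add_le (le_trans hy (le_max_left _ _)) (h2.trans (le_max_right _ _))
    rw [add_sub_cancel] at h3
    exact absurd h3 (not_le.2 (max_lt hab (hcc.trans_le hx)))
  refine Set.Finite.of_finite_image (f := fun a => Module.finrank ℝ (W a))
    ((Set.finite_Iic N).subset ?_) fun a ha b hb hab => ?_
  · rintro _ ⟨a, -, rfl⟩
    exact Submodule.finrank_mono (hWle a)
  · rcases lt_trichotomy a b with h | h | h
    · exact absurd hab (hlt a b hb h).ne
    · exact h
    · exact absurd hab (hlt b a ha h).ne'

omit hT in
theorem bot_mem_range_growthRate : (⊥ : EReal) ∈ Set.range T.growthRate := ⟨0, growthRate_zero⟩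

/-- The complement of `V b` in `V a`, where `V` is the filtration by growth rate and `b < c < a`,
given by the range of a splitting projection at the rate `c`. -/
theorem isFastGrowing_inf {l : ℝ} {b : EReal} (hgap : ∀ x, T.growthRate x < l → T.growthRate x ≤ b)
    {c : ℝ} (hbc : b < c) (hcl : c < l) {Q : B →L[ℝ] B} (hQ : T.IsSplitting c Q) :
    T.IsFastGrowing l (T.growthSubmodule l) (T.growthSubmodule b)
      (LinearMap.range (Q : B →ₗ[ℝ] B) ⊓ T.growthSubmodule l) := by
  have hcl' : (c : EReal) < l := EReal.coe_lt_coe_iff.2 hcl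
  have hVb : ∀ {c : ℝ} {Q : B →L[ℝ] B}, T.IsSplitting c Q → b < c → c < l → ∀ x,
      x ∈ T.growthSubmodule b ↔ Q x = 0 := fun hQ hbc hcl x =>
    ⟨fun hx => hQ.eq_zero_of_growthRate_lt (lt_of_le_of_lt hx hbc), fun hx =>
      hgap x ((hQ.growthRate_le_of_eq_zero hx).trans_lt (EReal.coe_lt_coe_iff.2 hcl))⟩
  have hdisj : ∀ {c : ℝ} {Q : B →L[ℝ] B}, T.IsSplitting c Q → b < c → c < l →
      Disjoint (LinearMap.range (Q : B →ₗ[ℝ] B) ⊓ T.growthSubmodule l) (T.growthSubmodule b) := by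
    intro c Q hQ hbc hcl
    refine Submodule.disjoint_def.2 fun x hx hx' => ?_
    rw [← hQ.mem_range_iff.1 hx.1, (hVb hQ hbc hcl x).1 hx']
  have hsup : ∀ {c : ℝ} {Q : B →L[ℝ] B}, T.IsSplitting c Q → b < c → c < l →
      (LinearMap.range (Q : B →ₗ[ℝ] B) ⊓ T.growthSubmodule l) ⊔ T.growthSubmodule b =
        T.growthSubmodule l := by
    intro c Q hQ hbc hcl
    refine le_antisymm (sup_le inf_le_right (growthSubmodule_mono
      (hbc.trans (EReal.coe_lt_coe_iff.2 hcl)).le)) fun x hx => ?_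
    rw [← add_sub_cancel (Q x) x]
    refine Submodule.add_mem_sup ⟨⟨x, rfl⟩, ?_⟩ ?_
    · exact (growthRate_map_le Q hQ.comm x).trans hx
    · rw [hVb hQ hbc hcl, map_sub, hQ.idem, sub_self]
  have hfinQ : ∀ {c : ℝ} {Q : B →L[ℝ] B}, T.IsSplitting c Q → FiniteDimensional ℝ
      (LinearMap.range (Q : B →ₗ[ℝ] B) ⊓ T.growthSubmodule l : Submodule ℝ B) := by
    intro c Q hQ
    have := hQ.finite
    exact Submodule.finiteDimensional_of_le inf_le_left
  have hinvar : ∀ {c : ℝ} {Q : B →L[ℝ] B}, T.IsSplitting c Q → ∀ t,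
      (LinearMap.range (Q : B →ₗ[ℝ] B) ⊓ T.growthSubmodule l).map (T.op t : B →ₗ[ℝ] B) =
        LinearMap.range (Q : B →ₗ[ℝ] B) ⊓ T.growthSubmodule l := by
    intro c Q hQ t
    have := hfinQ hQ
    refine Submodule.eq_of_le_of_finrank_eq ?_ ?_
    · rintro _ ⟨x, ⟨hx, hx'⟩, rfl⟩
      refine ⟨hQ.mem_range_iff.2 ?_, (growthRate_op_le t x).trans hx'⟩
      change Q (T.op t x) = T.op t x
      rw [hQ.comm, hQ.mem_range_iff.1 hx]
    · rw [← LinearMap.range_domRestrict]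
      refine LinearMap.finrank_range_of_inj (f := (T.op t : B →ₗ[ℝ] B).domRestrict
        (LinearMap.range (Q : B →ₗ[ℝ] B) ⊓ T.growthSubmodule l)) ((injective_iff_map_eq_zero _).2 fun x hx => ?_)
      -- Any rate below `c` would do: only the injectivity of `T t` on the range of `Q` is used.
      obtain ⟨C, hC, hCt⟩ := hQ.lower (c - 1) (by linarith)
      have h1 := hCt t x (hQ.mem_range_iff.1 x.2.1)
      have h2 : T.op t (x : B) = 0 := hx
      rw [h2, norm_zero, mul_zero] at h1
      exact Subtype.ext (norm_le_zero_iff.1 (nonpos_of_mul_nonpos_right h1 (Real.exp_pos _)))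
  have hfinb : Module.Finite ℝ (B ⧸ T.growthSubmodule b) :=
    hQ.finite_quotient fun x hx => hgap x (hx.trans_lt hcl')
  -- The complement does not depend on where in the gap the splitting is made: backward orbits for
  -- `Q'` decay fast enough to lie in the range of `Q`, and both spaces have the codimension jump as
  -- dimension.
  have hindep : ∀ {d : ℝ} {Q' : B →L[ℝ] B}, T.IsSplitting d Q' → c < d → d < l →
      LinearMap.range (Q' : B →ₗ[ℝ] B) ⊓ T.growthSubmodule l =
        LinearMap.range (Q : B →ₗ[ℝ] B) ⊓ T.growthSubmodule l := by
    intro d Q' hQ' hcd hdl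
    have hbd : b < d := hbc.trans (EReal.coe_lt_coe_iff.2 hcd)
    have := hfinQ hQ
    refine Submodule.eq_of_le_of_finrank_eq (le_inf (fun x hx => hQ.mem_range_iff.2 ?_)
      inf_le_right) ?_
    · have hpre : ∀ t, ∃ y ∈ LinearMap.range (Q' : B →ₗ[ℝ] B) ⊓ T.growthSubmodule l,
          T.op t y = x := fun t => by
        rw [← hinvar hQ' t] at hx
        exact hx
      choose g hg hgx using hpre
      obtain ⟨C, hC, hCt⟩ := hQ'.lower ((c + d) / 2) (by linarith)
      refine hQ.apply_eq_self_of_backward hgx (d := (c + d) / 2) (C := C * ‖x‖) (by linarith)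
        (.of_forall fun t => ?_)
      have h1 := hCt t (g t) (hQ'.mem_range_iff.1 (hg t).1)
      rw [hgx] at h1
      rwa [Real.exp_neg, ← div_eq_mul_inv, le_div_iff₀ (Real.exp_pos _), mul_comm]
    · have h1 := Submodule.finrank_quotient_add_of_isCompl (hdisj hQ' hbd hdl) (hsup hQ' hbd hdl)
      have h2 := Submodule.finrank_quotient_add_of_isCompl (hdisj hQ hbc hcl) (hsup hQ hbc hcl)
      omega
  refine ⟨hinvar hQ, hdisj hQ hbc hcl, hsup hQ hbc hcl, fun h hh hne => ?_,
    fun h hh hne g hg => ?_⟩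
  · have h1 : T.growthRate h = l := by
      refine le_antisymm hh.2 (not_lt.1 fun hlt => hne ?_)
      exact (Submodule.disjoint_def.1 (hdisj hQ hbc hcl)) h hh (hgap h hlt)
    rw [← h1]
    exact tendsto_logGrowth hT h
  · refine tendsto_logRate_of_le (EReal.ge_of_forall_gt_iff_ge.1 fun d hd => ?_)
      (EReal.le_of_forall_lt_iff_le.1 fun d hd => ?_)
    · rw [← EReal.coe_neg, EReal.coe_lt_coe_iff] at hd
      -- Here `-d > l`, so `g t` lies in the kernel of `Q'` and `‖h‖ ≤ C exp (-d t) ‖g t‖` bounds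
      -- `g` from below.
      obtain ⟨Q', hQ'⟩ := hT (-d)
      obtain ⟨C, hC, hCt⟩ := hQ'.upper
      refine le_liminf_logRate (k := ‖h‖ / C) (div_pos (norm_pos_iff.2 hne) hC)
        (.of_forall fun t => ?_)
      have h1 := hCt t (g t) (hQ'.eq_zero_of_growthRate_lt (lt_of_le_of_lt (hg t).1.2
        (EReal.coe_lt_coe_iff.2 (by linarith))))
      rw [(hg t).2, neg_mul, Real.exp_neg, ← div_eq_mul_inv, div_mul_eq_mul_div,
        le_div_iff₀ (Real.exp_pos _)] at h1
      rwa [div_mul_eq_mul_div, div_le_iff₀ hC, mul_comm ‖g t‖]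
    · rw [← EReal.coe_neg, EReal.coe_lt_coe_iff] at hd
      -- The original `c` may be far below `l`, which would give too weak a backward bound. Since
      -- the complement is independent of the splitting, the rate is moved to some `e` above `-d`
      -- and below `l`.
      obtain ⟨e, he, hel⟩ := exists_between (max_lt hcl (neg_lt.1 hd))
      obtain ⟨Q', hQ'⟩ := hT e
      obtain ⟨C, hC, hCt⟩ := hQ'.lower (-d) ((le_max_right _ _).trans_lt he)
      refine limsup_logRate_le (C := C * ‖h‖) (.of_forall fun t => ?_)
      have h0 := (hg t).1
      rw [← hindep hQ' ((le_max_left _ _).trans_lt he) hel] at h0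
      have h1 := hCt t (g t) (hQ'.mem_range_iff.1 h0.1)
      rwa [(hg t).2, neg_mul, Real.exp_neg, inv_mul_le_iff₀ (Real.exp_pos _), mul_comm] at h1

omit hT in
/-- A fast-growing complement of `V b` in `V l` is contained in the range of every splitting
projection at a rate `c < l`. -/
theorem IsFastGrowing.le_range {l : ℝ} {F F' H : Submodule ℝ B} (hH : T.IsFastGrowing l F F' H)
    {c : ℝ} (hcl : c < l) {Q : B →L[ℝ] B} (hQ : T.IsSplitting c Q) :
    H ≤ LinearMap.range (Q : B →ₗ[ℝ] B) := by
  intro x hx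
  rcases eq_or_ne x 0 with rfl | hne
  · exact Submodule.zero_mem _
  have hpre : ∀ t, ∃ y ∈ H, T.op t y = x := fun t => by
    rw [← hH.invariant t] at hx
    exact hx
  choose g hg hgx using hpre
  -- The backward rate is exactly `-l < -d`, so the backward orbit decays faster than `exp (-c t)`.
  obtain ⟨d, hcd, hdl⟩ := exists_between hcl
  refine hQ.mem_range_iff.2 (hQ.apply_eq_self_of_backward hgx (d := d) (C := 1) hcd ?_)
  have h1 := (hH.backward x hx hne g fun t => ⟨hg t, hgx t⟩).limsup_eq
  have h2 : limsup (logRate g) atTop < ((-d : ℝ) : EReal) := by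
    refine lt_of_eq_of_lt h1 ?_
    rw [← EReal.coe_neg, EReal.coe_lt_coe_iff]
    linarith
  filter_upwards [eventually_norm_le_of_limsup_lt h2] with t ht
  rwa [one_mul, ← neg_mul]

omit hT in
-- This yields finite codimension of every `F n`, even when the exponent is `⊥`: there the set of
-- rates is exhausted and leaves a gap below the last finite exponent.
theorem exists_forall_growthRate_le (n : ℕ) :
    ∃ c : ℝ, ∀ x, T.growthRate x ≤ c →
      T.growthRate x ≤ EReal.decreasingSeq (Set.range T.growthRate) n := by
  induction n with
  | zero => exact ⟨0, fun x _ => le_sSup ⟨x, rfl⟩⟩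
  | succ n ih =>
    by_cases hn : EReal.decreasingSeq (Set.range T.growthRate) n = ⊥
    · obtain ⟨c, hc⟩ := ih
      refine ⟨c, fun x hx => (hc x hx).trans ?_⟩
      rw [hn]
      exact bot_le
    · obtain ⟨c, -, hc⟩ := EReal.lt_iff_exists_real_btwn.1 (bot_lt_iff_ne_bot.2 hn)
      exact ⟨c, fun x hx => EReal.le_decreasingSeq_succ ⟨x, rfl⟩ (hx.trans_lt hc)⟩

theorem isLyapunovSequence_decreasingSeq [CompleteSpace B] :
    T.IsLyapunovSequence (EReal.decreasingSeq (Set.range T.growthRate)) := by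
  set lam := EReal.decreasingSeq (Set.range T.growthRate) with hlam
  have hfin := finite_growthRate_ge hT
  have hmem : ∀ n, lam n ∈ Set.range T.growthRate :=
    EReal.decreasingSeq_mem bot_mem_range_growthRate hfin
  have hlt_top : ∀ n, lam n < ⊤ := fun n => by
    obtain ⟨x, hx⟩ := hmem n
    rw [← hx]
    exact T.growthRate_lt_top x
  have hdec : ∀ n, lam (n + 1) < lam n ∨ (lam n = ⊥ ∧ lam (n + 1) = ⊥) := fun n => by
    by_cases hn : lam n = ⊥
    · exact .inr ⟨hn, EReal.decreasingSeq_succ_eq_bot hn⟩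
    · exact .inl (EReal.decreasingSeq_succ_lt bot_mem_range_growthRate hfin hn).2
  have hsucc : ∀ n x, T.growthRate x < lam n → T.growthRate x ≤ lam (n + 1) := fun n x hx =>
    EReal.le_decreasingSeq_succ ⟨x, rfl⟩ hx
  have hle : ∀ n, lam (n + 1) ≤ lam n := fun n => by
    rcases hdec n with h | ⟨h, h'⟩
    · exact h.le
    · rw [h, h']
  let F : ℕ → Submodule ℝ B := fun n => T.growthSubmodule (lam n)
  have hFle : ∀ n, F (n + 1) ≤ F n := fun n => growthSubmodule_mono (hle n)
  have hF0 : F 0 = ⊤ := eq_top_iff.2 fun x _ => mem_growthSubmodule.2 (le_sSup (Set.mem_range_self x))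
  have hFfin : ∀ n, Module.Finite ℝ (B ⧸ F n) := fun n => by
    obtain ⟨c, hc⟩ := exists_forall_growthRate_le (T := T) n
    obtain ⟨Q, hQ⟩ := hT c
    exact hQ.finite_quotient fun x hx => hc x hx
  -- The subtraction is exact because codimension increases along the filtration; once the exponents
  -- are `⊥` it gives `0`.
  let m : ℕ → ℕ := fun n => Module.finrank ℝ (B ⧸ F (n + 1)) - Module.finrank ℝ (B ⧸ F n)
  have hmadd : ∀ n, Module.finrank ℝ (B ⧸ F (n + 1)) = Module.finrank ℝ (B ⧸ F n) + m n :=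
    fun n => (Nat.add_sub_cancel' (Submodule.finrank_quotient_le_of_le (hFle n))).symm
  have hsum : ∀ j, Module.finrank ℝ (B ⧸ F j) = ∑ i ∈ Finset.range j, m i := by
    intro j
    induction j with
    | zero =>
      rw [Finset.range_zero, Finset.sum_empty, hF0]
      exact Module.finrank_zero_of_subsingleton
    | succ j ih => rw [Finset.sum_range_succ, hmadd, ih]
  refine ⟨hlt_top, hdec, EReal.tendsto_decreasingSeq bot_mem_range_growthRate hfin, F, m,
    fun n => rfl, hF0, hFle, fun n hn x => ⟨fun hx => ?_, fun hx => ?_⟩, fun j => ?_,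
    fun n hn => ?_⟩
  · have h1 : T.growthRate x = lam n :=
      le_antisymm hx.1 (not_lt.1 fun h => hx.2 (hsucc n x h))
    rw [← h1]
    exact tendsto_logGrowth hT x
  · have h1 : T.growthRate x = lam n := hx.limsup_eq
    exact ⟨h1.le, fun h => absurd (h1 ▸ h : lam n ≤ lam (n + 1)) (not_le.2 hn)⟩
  · rw [← hsum, Module.finrank_eq_rank]
  · have hltF : F (n + 1) < F n := by
      obtain ⟨x, hx⟩ := hmem n
      exact lt_of_le_of_ne (hFle n) fun h => absurd
        ((h ▸ (show x ∈ F n from hx.le) : x ∈ F (n + 1)) : T.growthRate x ≤ lam (n + 1))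
        (not_le.2 (hx ▸ hn))
    have hm : 0 < m n := Nat.sub_pos_of_lt (Submodule.finrank_quotient_lt_of_lt hltF)
    refine ⟨hm, ?_⟩
    obtain ⟨l, hl⟩ : ∃ l : ℝ, lam n = l :=
      ⟨(lam n).toReal, (EReal.coe_toReal (hlt_top n).ne (bot_le.trans_lt hn).ne').symm⟩
    obtain ⟨c, hbc, hcl⟩ := EReal.lt_iff_exists_real_btwn.1 hn
    rw [hl, EReal.coe_lt_coe_iff] at hcl
    obtain ⟨Q, hQ⟩ := hT c
    have hgap : ∀ x, T.growthRate x < l → T.growthRate x ≤ lam (n + 1) := fun x hx =>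
      hsucc n x (hl ▸ hx)
    have hFG := isFastGrowing_inf hT hgap hbc hcl hQ
    rw [← hl] at hFG
    have hrank : ∀ H, T.IsFastGrowing (lam n) (F n) (F (n + 1)) H → Module.finrank ℝ H = m n := by
      intro H hH
      have h1 := Submodule.finrank_quotient_add_of_isCompl hH.disjoint hH.sup_eq
      have h2 := hmadd n
      omega
    refine ⟨_, ⟨hrank _ hFG, hFG⟩, fun H hH => ?_⟩
    have : FiniteDimensional ℝ (LinearMap.range (Q : B →ₗ[ℝ] B) ⊓ T.growthSubmodule (lam n) :
        Submodule ℝ B) := Module.finite_of_finrank_pos (by rw [hrank _ hFG]; exact hm)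
    refine Submodule.eq_of_le_of_finrank_eq (le_inf ?_ ?_) (by rw [hrank _ hFG, hH.1])
    · exact IsFastGrowing.le_range (hl ▸ hH.2) hcl hQ
    · exact le_sup_left.trans hH.2.sup_eq.le

end Structure

/-- Positive multiplicity forces each finite exponent to be attained, and exactness of the rate on
`F i \ F (i + 1)` excludes rates strictly between consecutive exponents. -/
theorem IsLyapunovSequence.eq_decreasingSeq {lam : ℕ → EReal} (h : T.IsLyapunovSequence lam) :
    lam = EReal.decreasingSeq (Set.range T.growthRate) := by
  obtain ⟨F, m, hF, hF0, hFle, hex, hrank, hm⟩ := h.filtration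
  have hmemF : ∀ i x, x ∈ F i ↔ T.growthRate x ≤ lam i := fun i x => by
    rw [← SetLike.mem_coe, hF]; rfl
  refine EReal.eq_decreasingSeq (fun n => ?_) ?_ h.decreasing ?_
  · rcases h.decreasing n with hn | ⟨hn, -⟩
    · have hne : F (n + 1) ≠ F n := fun heq => by
        have h1 := hrank (n + 1)
        rw [heq, hrank n, Finset.sum_range_succ] at h1
        have h2 : ∑ i ∈ Finset.range n, m i = ∑ i ∈ Finset.range n, m i + m n := by
          exact_mod_cast h1
        have := (hm n hn).1
        omega
      obtain ⟨x, hx, hx'⟩ := SetLike.exists_of_lt (lt_of_le_of_ne (hFle n) hne)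
      exact ⟨x, ((hex n hn x).1 ⟨hx, hx'⟩).limsup_eq⟩
    · rw [hn]
      exact bot_mem_range_growthRate
  · rintro _ ⟨x, rfl⟩
    rw [← hmemF, hF0]
    trivial
  · rintro n _ ⟨x, rfl⟩ hx
    rcases h.decreasing n with hn | ⟨hn, -⟩
    · rw [← hmemF]
      by_contra hx'
      exact hx.ne ((hex n hn x).1 ⟨(hmemF n x).2 hx.le, hx'⟩).limsup_eq
    · rw [hn] at hx
      exact absurd hx not_lt_bot

end C0Semigroup

/-! ### Eigenvectors of the generator and of the semigroup -/

namespace C0Semigroup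

variable {B : Type*} [NormedAddCommGroup B] [NormedSpace ℝ B] {T : C0Semigroup B}

/-- The complex vector `x + i y` is an eigenvector of the complexification of every `T t`, with
eigenvalue `exp (t μ)`. -/
def IsEigenorbit (T : C0Semigroup B) (μ : ℂ) (x y : B) : Prop :=
  ∀ t : ℝ≥0,
    T.op t x = Real.exp (μ.re * t) • (Real.cos (μ.im * t) • x - Real.sin (μ.im * t) • y) ∧
    T.op t y = Real.exp (μ.re * t) • (Real.sin (μ.im * t) • x + Real.cos (μ.im * t) • y)

theorem tendsto_coe_nhdsGT_zero : Tendsto ((↑) : ℝ≥0 → ℝ) (𝓝[>] 0) (𝓝[>] 0) := by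
  refine tendsto_nhdsWithin_iff.2 ⟨?_, ?_⟩
  · exact (NNReal.continuous_coe.tendsto' 0 0 rfl).mono_left nhdsWithin_le_nhds
  · filter_upwards [self_mem_nhdsWithin] with t ht
    exact ht

theorem tendsto_quotient_of_hasDerivAt {x v : B} {f : ℝ → B} (hf : HasDerivAt f v 0)
    (hfx : ∀ t : ℝ≥0, T.op t x - x = f t - f 0) : Tendsto (T.quotient x) (𝓝[>] 0) (𝓝 v) := by
  have h1 := (hasDerivAt_iff_tendsto_slope.1 hf).mono_left
    (nhdsWithin_mono (0 : ℝ) (Set.subset_compl_singleton_iff.2 (Set.self_notMem_Ioi)))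
  refine (h1.comp tendsto_coe_nhdsGT_zero).congr fun t => ?_
  simp [slope, quotient, hfx]

theorem generator_eq_of_tendsto {x : T.generator.domain} {v : B}
    (h : Tendsto (T.quotient x) (𝓝[>] 0) (𝓝 v)) : T.generator x = v :=
  tendsto_nhds_unique (T.generator_spec x) h

/-- The difference quotient at `s` is `T s` applied to the one at `0`. The right derivative suffices
for the integration below. -/
theorem hasDerivWithinAt_orbit (x : T.generator.domain) {s : ℝ} (hs : 0 ≤ s) :
    HasDerivWithinAt (fun t : ℝ => T.op t.toNNReal (x : B))
      (T.op s.toNNReal (T.generator x)) (Set.Ici s) s := by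
  rw [← hasDerivWithinAt_Ioi_iff_Ici, hasDerivWithinAt_iff_tendsto_slope' (by simp)]
  have h1 : Tendsto (fun t : ℝ => (t - s).toNNReal) (𝓝[>] s) (𝓝[>] 0) := by
    refine tendsto_nhdsWithin_iff.2 ⟨?_, ?_⟩
    · refine Tendsto.mono_left (Continuous.tendsto' (by fun_prop) _ _ ?_) nhdsWithin_le_nhds
      simp
    · filter_upwards [self_mem_nhdsWithin] with t ht
      exact Real.toNNReal_pos.2 (sub_pos.2 ht)
  refine (((T.op s.toNNReal).continuous.tendsto _).comp ((T.generator_spec x).comp h1)).congr' ?_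
  filter_upwards [self_mem_nhdsWithin] with t ht
  have ht' : s < t := ht
  have h2 : t.toNNReal = s.toNNReal + (t - s).toNNReal := by
    rw [← Real.toNNReal_add hs (sub_nonneg.2 ht'.le), add_sub_cancel]
  simp only [Function.comp, quotient, map_smul, map_sub, slope, vsub_eq_sub]
  rw [← T.op_add_apply, ← h2, Real.coe_toNNReal _ (sub_nonneg.2 ht'.le)]

theorem continuous_orbit_toNNReal (T : C0Semigroup B) (x : B) :
    Continuous fun t : ℝ => T.op t.toNNReal x :=
  (T.continuous_orbit x).comp continuous_real_toNNReal

theorem _root_.hasDerivAt_const_mul_id (a s : ℝ) : HasDerivAt (fun t : ℝ => a * t) a s := by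
  simpa using (hasDerivAt_id s).const_mul a

/-- A solution of `X' = a X - b Y`, `Y' = b X + a Y` is a rotation times an exponential. -/
theorem _root_.eq_exp_smul_rotation {a b : ℝ} {X Y : ℝ → B} (hcX : Continuous X) (hcY : Continuous Y)
    (hX : ∀ s, 0 ≤ s → HasDerivWithinAt X (a • X s - b • Y s) (Set.Ici s) s)
    (hY : ∀ s, 0 ≤ s → HasDerivWithinAt Y (b • X s + a • Y s) (Set.Ici s) s) {t : ℝ} (ht : 0 ≤ t) :
    X t = Real.exp (a * t) • (Real.cos (b * t) • X 0 - Real.sin (b * t) • Y 0) ∧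
    Y t = Real.exp (a * t) • (Real.sin (b * t) • X 0 + Real.cos (b * t) • Y 0) := by
  have hE : ∀ s : ℝ, HasDerivAt (fun t : ℝ => Real.exp (-a * t)) (Real.exp (-a * s) * -a) s :=
    fun s => (hasDerivAt_const_mul_id (-a) s).exp
  have hC : ∀ s : ℝ, HasDerivAt (fun t : ℝ => Real.cos (b * t)) (-Real.sin (b * s) * b) s :=
    fun s => (hasDerivAt_const_mul_id b s).cos
  have hS : ∀ s : ℝ, HasDerivAt (fun t : ℝ => Real.sin (b * t)) (Real.cos (b * s) * b) s :=
    fun s => (hasDerivAt_const_mul_id b s).sin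
  -- Undoing the scaling and the rotation gives a continuous curve with zero right derivative, hence
  -- a constant.
  have key1 : Real.exp (-a * t) • (Real.cos (b * t) • X t + Real.sin (b * t) • Y t) = X 0 := by
    have h1 := constant_of_has_deriv_right_zero (a := 0) (b := t)
      (f := fun s : ℝ => Real.exp (-a * s) • (Real.cos (b * s) • X s + Real.sin (b * s) • Y s))
      (Continuous.continuousOn (by fun_prop)) (fun s hs => by
        have h2 := (hE s).hasDerivWithinAt.smul (((hC s).hasDerivWithinAt.smul (hX s hs.1)).add
            ((hS s).hasDerivWithinAt.smul (hY s hs.1)))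
        refine h2.congr_deriv ?_
        simp only [Pi.add_apply, Pi.smul_apply']
        module) t ⟨ht, le_rfl⟩
    simpa using h1
  have key2 : Real.exp (-a * t) • (Real.cos (b * t) • Y t - Real.sin (b * t) • X t) = Y 0 := by
    have h1 := constant_of_has_deriv_right_zero (a := 0) (b := t)
      (f := fun s : ℝ => Real.exp (-a * s) • (Real.cos (b * s) • Y s - Real.sin (b * s) • X s))
      (Continuous.continuousOn (by fun_prop)) (fun s hs => by
        have h2 := (hE s).hasDerivWithinAt.smul (((hC s).hasDerivWithinAt.smul (hY s hs.1)).sub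
            ((hS s).hasDerivWithinAt.smul (hX s hs.1)))
        refine h2.congr_deriv ?_
        simp only [Pi.sub_apply, Pi.smul_apply']
        module) t ⟨ht, le_rfl⟩
    simpa using h1
  have hexp : Real.exp (a * t) * Real.exp (-a * t) = 1 := by
    rw [← Real.exp_add, neg_mul, add_neg_cancel, Real.exp_zero]
  have hcs := Real.cos_sq_add_sin_sq (b * t)
  constructor
  · rw [← key1, ← key2]
    calc X t
      _ = ((Real.exp (a * t) * Real.exp (-a * t)) *
          (Real.cos (b * t) ^ 2 + Real.sin (b * t) ^ 2)) • X t := by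
        rw [hexp, hcs, one_mul, one_smul]
      _ = _ := by module
  · rw [← key1, ← key2]
    calc Y t
      _ = ((Real.exp (a * t) * Real.exp (-a * t)) *
          (Real.cos (b * t) ^ 2 + Real.sin (b * t) ^ 2)) • Y t := by
        rw [hexp, hcs, one_mul, one_smul]
      _ = _ := by module

/-- Eigenvectors of the generator are eigenvectors of the semigroup. -/
theorem isEigenorbit_of_generator {μ : ℂ} {x y : T.generator.domain}
    (hx : T.generator x = μ.re • (x : B) - μ.im • (y : B))
    (hy : T.generator y = μ.im • (x : B) + μ.re • (y : B)) : T.IsEigenorbit μ x y := by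
  intro t
  have h := eq_exp_smul_rotation (T.continuous_orbit_toNNReal x) (T.continuous_orbit_toNNReal y)
    (a := μ.re) (b := μ.im) (fun s hs => by
      have := hasDerivWithinAt_orbit x hs
      rwa [hx, map_sub, map_smul, map_smul] at this) (fun s hs => by
      have := hasDerivWithinAt_orbit y hs
      rwa [hy, map_add, map_smul, map_smul] at this) t.coe_nonneg
  simpa [T.op_zero] using h

theorem IsEigenorbit.mem_pointSpectrum {μ : ℂ} {x y : B} (h : T.IsEigenorbit μ x y)
    (hne : x ≠ 0 ∨ y ≠ 0) : μ ∈ pointSpectrum T.generator := by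
  have hE : HasDerivAt (fun t : ℝ => Real.exp (μ.re * t)) μ.re 0 :=
    (hasDerivAt_const_mul_id μ.re 0).exp.congr_deriv (by simp)
  have hC : HasDerivAt (fun t : ℝ => Real.cos (μ.im * t)) 0 0 :=
    (hasDerivAt_const_mul_id μ.im 0).cos.congr_deriv (by simp)
  have hS : HasDerivAt (fun t : ℝ => Real.sin (μ.im * t)) μ.im 0 :=
    (hasDerivAt_const_mul_id μ.im 0).sin.congr_deriv (by simp)
  have hx : Tendsto (T.quotient x) (𝓝[>] 0) (𝓝 (μ.re • x - μ.im • y)) := by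
    refine tendsto_quotient_of_hasDerivAt
      (f := fun t : ℝ => Real.exp (μ.re * t) • (Real.cos (μ.im * t) • x - Real.sin (μ.im * t) • y))
      ((hE.smul ((hC.smul_const x).sub (hS.smul_const y))).congr_deriv ?_) fun t => ?_
    · simp
      abel
    · rw [(h t).1]
      simp
  have hy : Tendsto (T.quotient y) (𝓝[>] 0) (𝓝 (μ.im • x + μ.re • y)) := by
    refine tendsto_quotient_of_hasDerivAt
      (f := fun t : ℝ => Real.exp (μ.re * t) • (Real.sin (μ.im * t) • x + Real.cos (μ.im * t) • y))
      ((hE.smul ((hS.smul_const x).add (hC.smul_const y))).congr_deriv ?_) fun t => ?_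
    · simp
    · rw [(h t).2]
      simp
  refine ⟨⟨x, _, hx⟩, ⟨y, _, hy⟩, ?_, generator_eq_of_tendsto hx, generator_eq_of_tendsto hy⟩
  exact hne.imp (fun h h' => h (congrArg Subtype.val h')) fun h h' => h (congrArg Subtype.val h')

theorem exists_isEigenorbit {μ : ℂ} (h : μ ∈ pointSpectrum T.generator) :
    ∃ x y, (x ≠ 0 ∨ y ≠ 0) ∧ T.IsEigenorbit μ x y := by
  obtain ⟨x, y, hne, hx, hy⟩ := h
  exact ⟨x, y, hne.imp (fun h h' => h (Subtype.ext h')) fun h h' => h (Subtype.ext h'),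
     isEigenorbit_of_generator hx hy⟩

/-- Both orbits are bounded by a multiple of `exp (μ.re t)`. If both were slower, inverting the
rotation would express `x` and `y` as `exp (-μ.re t)` times combinations of the two orbits with
bounded coefficients, forcing both to vanish. -/
theorem IsEigenorbit.growthRate_eq {μ : ℂ} {x y : B} (h : T.IsEigenorbit μ x y)
    (hne : x ≠ 0 ∨ y ≠ 0) : (x ≠ 0 ∧ T.growthRate x = μ.re) ∨ (y ≠ 0 ∧ T.growthRate y = μ.re) := by
  have hbound : ∀ (p q : ℝ), |p| ≤ 1 → |q| ≤ 1 → ∀ u v : B, ‖p • u + q • v‖ ≤ ‖u‖ + ‖v‖ := by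
    intro p q hp hq u v
    refine (norm_add_le _ _).trans (add_le_add ?_ ?_)
    · rw [norm_smul]; exact mul_le_of_le_one_left (norm_nonneg _) hp
    · rw [norm_smul]; exact mul_le_of_le_one_left (norm_nonneg _) hq
  have hx : T.growthRate x ≤ μ.re := by
    refine growthRate_le (C := ‖x‖ + ‖y‖) (.of_forall fun t => ?_)
    rw [(h t).1, norm_smul, Real.norm_eq_abs, Real.abs_exp, mul_comm, sub_eq_add_neg, ← neg_smul]
    gcongr
    exact hbound _ _ (Real.abs_cos_le_one _) ((abs_neg _).trans_le (Real.abs_sin_le_one _)) _ _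
  have hy : T.growthRate y ≤ μ.re := by
    refine growthRate_le (C := ‖x‖ + ‖y‖) (.of_forall fun t => ?_)
    rw [(h t).2, norm_smul, Real.norm_eq_abs, Real.abs_exp, mul_comm]
    gcongr
    exact hbound _ _ (Real.abs_sin_le_one _) (Real.abs_cos_le_one _) _ _
  have hne0 : ∀ z : B, T.growthRate z = μ.re → z ≠ 0 := by
    rintro z hz rfl
    rw [growthRate_zero] at hz
    exact EReal.coe_ne_bot _ hz.symm
  by_contra! hno
  have hx' : T.growthRate x < μ.re := lt_of_le_of_ne hx fun h0 => hno.1 (hne0 x h0) h0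
  have hy' : T.growthRate y < μ.re := lt_of_le_of_ne hy fun h0 => hno.2 (hne0 y h0) h0
  obtain ⟨c, hc, hcμ⟩ := EReal.lt_iff_exists_real_btwn.1 (max_lt hx' hy')
  rw [EReal.coe_lt_coe_iff] at hcμ
  have hev := (eventually_norm_le ((le_max_left _ _).trans_lt hc)).and
    (eventually_norm_le ((le_max_right _ _).trans_lt hc))
  have hzero : ∀ z : B, (∀ t : ℝ≥0, ∃ p q : ℝ, |p| ≤ 1 ∧ |q| ≤ 1 ∧
      z = Real.exp (-(μ.re * t)) • (p • T.op t x + q • T.op t y)) → z = 0 := by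
    intro z hz
    have h1 : ∀ᶠ t : ℝ≥0 in atTop, ‖z‖ ≤ 2 * Real.exp (c * t) * Real.exp (-(μ.re * t)) := by
      filter_upwards [hev] with t ht
      obtain ⟨p, q, hp, hq, hzt⟩ := hz t
      rw [hzt, norm_smul, Real.norm_eq_abs, Real.abs_exp, mul_comm]
      gcongr
      refine (hbound p q hp hq _ _).trans ?_
      linarith [ht.1, ht.2]
    exact norm_le_zero_iff.1 (ge_of_tendsto (tendsto_const_mul_exp_zero _ hcμ) h1)
  have hexp : ∀ t : ℝ≥0, Real.exp (-(μ.re * t)) * Real.exp (μ.re * t) = 1 := fun t => by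
    rw [← Real.exp_add, neg_add_cancel, Real.exp_zero]
  rcases hne with h0 | h0
  · refine h0 (hzero x fun t => ⟨Real.cos (μ.im * t), Real.sin (μ.im * t), Real.abs_cos_le_one _,
      Real.abs_sin_le_one _, ?_⟩)
    rw [(h t).1, (h t).2]
    calc x = ((Real.exp (-(μ.re * t)) * Real.exp (μ.re * t)) *
          (Real.cos (μ.im * t) ^ 2 + Real.sin (μ.im * t) ^ 2)) • x := by
          rw [hexp, Real.cos_sq_add_sin_sq, one_mul, one_smul]
      _ = _ := by module
  · refine h0 (hzero y fun t => ⟨-Real.sin (μ.im * t), Real.cos (μ.im * t),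
      (abs_neg _).trans_le (Real.abs_sin_le_one _), Real.abs_cos_le_one _, ?_⟩)
    rw [(h t).1, (h t).2]
    calc y = ((Real.exp (-(μ.re * t)) * Real.exp (μ.re * t)) *
          (Real.cos (μ.im * t) ^ 2 + Real.sin (μ.im * t) ^ 2)) • y := by
          rw [hexp, Real.cos_sq_add_sin_sq, one_mul, one_smul]
      _ = _ := by module

/-! ### Finite-dimensional semigroups -/

/-- The averages `∫ u in 0..s, T u x` lie in the domain of the generator. -/
theorem integral_mem_domain [CompleteSpace B] (T : C0Semigroup B) (x : B) {s : ℝ} (hs : 0 ≤ s) :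
    ∫ u in (0 : ℝ)..s, T.op u.toNNReal x ∈ T.generator.domain := by
  have hc := T.continuous_orbit_toNNReal x
  set u : ℝ → B := fun t => T.op t.toNNReal x with hu
  let G : ℝ → B := fun v => ∫ t in (0 : ℝ)..v, u t
  have hG : ∀ v, HasDerivAt G (u v) v := fun v =>
    intervalIntegral.integral_hasDerivAt_right (hc.intervalIntegrable _ _)
      (hc.stronglyMeasurableAtFilter _ _) hc.continuousAt
  refine ⟨u s - u 0, tendsto_quotient_of_hasDerivAt (f := fun h => G (s + h) - G h) ?_ fun h => ?_⟩
  · have h1 : HasDerivAt (fun h => G (s + h)) (u s) 0 := by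
      have := HasDerivAt.comp_const_add s 0 (f := G) (f' := u s) (by simpa using hG s)
      exact this
    exact h1.sub (hG 0)
  · have h1 : T.op h (G s) = G (s + h) - G h := by
      calc T.op h (G s) = ∫ t in (0 : ℝ)..s, T.op h (u t) :=
            ((T.op h).intervalIntegral_comp_comm (hc.intervalIntegrable _ _)).symm
        _ = ∫ t in (0 : ℝ)..s, u (t + h) := by
            refine intervalIntegral.integral_congr fun t ht => ?_
            rw [Set.uIcc_of_le hs] at ht
            simp only [hu]
            rw [← T.op_add_apply, Real.toNNReal_add ht.1 h.coe_nonneg, Real.toNNReal_coe, add_comm]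
        _ = ∫ t in (h : ℝ)..(s + h), u t := by
            rw [intervalIntegral.integral_comp_add_right, zero_add]
        _ = G (s + h) - G h := (intervalIntegral.integral_interval_sub_left
            (hc.intervalIntegrable _ _) (hc.intervalIntegrable _ _)).symm
    have h2 : G 0 = 0 := intervalIntegral.integral_same
    change T.op h (G s) - G s = _
    rw [h1, add_zero, h2, sub_zero]

/-- Averages of orbits over short intervals lie in the domain and converge to the starting point, so
the domain is dense; in finite dimension it is also closed. -/
theorem domain_eq_top [FiniteDimensional ℝ B] (T : C0Semigroup B) : T.generator.domain = ⊤ := by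
  have : CompleteSpace B := FiniteDimensional.complete ℝ B
  refine eq_top_iff.2 fun x _ => ?_
  have hcl : IsClosed (T.generator.domain : Set B) := Submodule.closed_of_finiteDimensional _
  have hc := T.continuous_orbit_toNNReal x
  have h1 : HasDerivAt (fun v : ℝ => ∫ t in (0 : ℝ)..v, T.op t.toNNReal x) x 0 := by
    have h := intervalIntegral.integral_hasDerivAt_right (hc.intervalIntegrable 0 0)
      (hc.stronglyMeasurableAtFilter _ _) hc.continuousAt
    rwa [Real.toNNReal_zero, T.op_zero_apply] at h
  have h2 : Tendsto (fun s : ℝ => s⁻¹ • ∫ t in (0 : ℝ)..s, T.op t.toNNReal x) (𝓝[>] 0) (𝓝 x) := by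
    simpa using h1.tendsto_slope_zero_right
  refine hcl.mem_of_tendsto h2 ?_
  filter_upwards [self_mem_nhdsWithin] with s hs
  exact T.generator.domain.smul_mem _ (T.integral_mem_domain x (le_of_lt hs))

theorem _root_.LinearMap.exists_complex_eigenvector {E : Type*} [NormedAddCommGroup E]
    [NormedSpace ℝ E] [FiniteDimensional ℝ E] [Nontrivial E] (A : E →ₗ[ℝ] E) :
    ∃ (μ : ℂ) (x y : E), (x ≠ 0 ∨ y ≠ 0) ∧ A x = μ.re • x - μ.im • y ∧
      A y = μ.im • x + μ.re • y := by
  have : Nontrivial (Cplx E) := by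
    obtain ⟨x, hx⟩ := exists_ne (0 : E)
    refine ⟨⟨Cplx.of (Complex.reCLM.smulRight x), 0, fun h0 => hx ?_⟩⟩
    simpa using congrArg (fun f => f.toMap 1) h0
  have h1 : FiniteDimensional ℂ (Cplx E) := by
    let Φ : Cplx E →ₗ[ℝ] E × E :=
      { toFun := fun f => (f.toMap 1, f.toMap Complex.I)
        map_add' := fun f g => rfl
        map_smul' := fun r f => by
          have h : ∀ w, (r • f).toMap w = r • f.toMap w := fun w => by
            change f.toMap ((r : ℂ) * w) = _
            rw [← map_smul, Complex.real_smul]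
          simp [h] }
    have hΦ : Function.Injective Φ := by
      refine (injective_iff_map_eq_zero _).2 fun f hf => Cplx.ext fun w => ?_
      have hf1 : f.toMap 1 = 0 := congrArg Prod.fst hf
      have hf2 : f.toMap Complex.I = 0 := congrArg Prod.snd hf
      rw [Cplx.toMap_eq, hf1, hf2]
      simp
    have := Module.Finite.of_injective Φ hΦ
    exact Module.Finite.right ℝ ℂ (Cplx E)
  obtain ⟨μ, hμ⟩ := Module.End.exists_eigenvalue
    (Cplx.mapL (LinearMap.toContinuousLinearMap A) : Cplx E →ₗ[ℂ] Cplx E)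
  obtain ⟨f, hf⟩ := hμ.exists_hasEigenvector
  have hAf : ∀ w, A (f.toMap w) = f.toMap (μ * w) := fun w =>
    congrArg (fun f => f.toMap w) hf.apply_eq_smul
  -- In this model `x + i y` is the map `w ↦ Re (w (x + i y))`, whose value at `I` is `-y`; hence
  -- the sign.
  refine ⟨μ, f.toMap 1, -f.toMap Complex.I, ?_, ?_, ?_⟩
  · by_contra! h0
    refine hf.2 (Cplx.ext fun w => ?_)
    rw [Cplx.toMap_eq, h0.1, neg_eq_zero.1 h0.2]
    simp
  · rw [hAf, Cplx.toMap_eq]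
    simp
  · rw [map_neg, hAf, Cplx.toMap_eq]
    simp [add_comm]

/-- The restriction of a semigroup to an invariant subspace. -/
noncomputable def restrict (T : C0Semigroup B) (H : Submodule ℝ B)
    (hH : ∀ t, ∀ x ∈ H, T.op t x ∈ H) : C0Semigroup H where
  op t := ((T.op t).comp H.subtypeL).codRestrict H fun x => hH t x x.2
  op_add t s := ContinuousLinearMap.ext fun x => Subtype.ext (T.op_add_apply t s x)
  op_zero := ContinuousLinearMap.ext fun x => Subtype.ext (T.op_zero_apply x)
  continuous_orbit x := (T.continuous_orbit (x : B)).subtype_mk _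

/-- A nontrivial finite-dimensional invariant subspace contains an eigenvector of the
complexification of the semigroup. -/
theorem exists_isEigenorbit_mem {H : Submodule ℝ B} [FiniteDimensional ℝ H] (hne : H ≠ ⊥)
    (hH : ∀ t, ∀ x ∈ H, T.op t x ∈ H) :
    ∃ (μ : ℂ) (x y : B), x ∈ H ∧ y ∈ H ∧ (x ≠ 0 ∨ y ≠ 0) ∧ T.IsEigenorbit μ x y := by
  have : Nontrivial H := Submodule.nontrivial_iff_ne_bot.2 hne
  let S := T.restrict H hH
  have htop : ∀ x : H, x ∈ S.generator.domain := fun x => by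
    rw [S.domain_eq_top]; trivial
  let A : H →ₗ[ℝ] H :=
    { toFun := fun x => S.generator ⟨x, htop x⟩
      map_add' := fun x y => S.generator.map_add ⟨x, htop x⟩ ⟨y, htop y⟩
      map_smul' := fun c x => S.generator.map_smul c ⟨x, htop x⟩ }
  obtain ⟨μ, x, y, hxy, hx, hy⟩ := A.exists_complex_eigenvector
  have horb : S.IsEigenorbit μ x y :=
    isEigenorbit_of_generator (x := ⟨x, htop x⟩) (y := ⟨y, htop y⟩) hx hy
  refine ⟨μ, x, y, x.2, y.2, by simpa using hxy, fun t => ⟨?_, ?_⟩⟩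
  · exact congrArg Subtype.val (horb t).1
  · exact congrArg Subtype.val (horb t).2

end C0Semigroup

/-! ### Lyapunov exponents and the point spectrum of the generator -/

namespace C0Semigroup

variable {B : Type*} [NormedAddCommGroup B] [NormedSpace ℝ B] {T : C0Semigroup B}

/-- The number `μ.re` is a growth rate; a rate missed by the enumeration would lie below all
exponents, which tend to `⊥`. -/
theorem IsLyapunovSequence.exists_eq_re {lam : ℕ → EReal} (h : T.IsLyapunovSequence lam) {μ : ℂ}
    (hμ : μ ∈ pointSpectrum T.generator) :
    ∃ j, lam j = μ.re := by
  obtain ⟨x, y, hne, horb⟩ := exists_isEigenorbit hμ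
  have hmem : (μ.re : EReal) ∈ Set.range T.growthRate := by
    rcases horb.growthRate_eq hne with h | h
    · exact ⟨x, h.2⟩
    · exact ⟨y, h.2⟩
  by_contra! hno
  have hlt : ∀ n, (μ.re : EReal) < lam n := by
    intro n
    rw [h.eq_decreasingSeq] at hno ⊢
    induction n with
    | zero => exact lt_of_le_of_ne (le_sSup hmem) (hno 0).symm
    | succ n ih => exact lt_of_le_of_ne (EReal.le_decreasingSeq_succ hmem ih) (hno _).symm
  have h1 := h.tendsto_bot.eventually (EReal.tendsto_nhds_bot_iff_real.1 tendsto_id μ.re)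
  obtain ⟨n, hn⟩ := h1.exists
  exact absurd hn (hlt n).not_gt

/-- The invariant space `H` is finite-dimensional and nonzero, so it carries a complex eigenvector,
and every nonzero vector of `H` has rate `lam j`. -/
theorem IsLyapunovSequence.exists_mem_pointSpectrum {lam : ℕ → EReal}
    (h : T.IsLyapunovSequence lam) {j : ℕ} (hj : lam j ≠ ⊥) :
    ∃ μ ∈ pointSpectrum T.generator, lam j = μ.re := by
  have hlt : lam (j + 1) < lam j := (h.decreasing j).resolve_right fun h' => hj h'.1
  obtain ⟨F, m, -, -, -, -, -, hm⟩ := h.filtration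
  obtain ⟨hmj, H, ⟨hrank, hH⟩, -⟩ := hm j hlt
  have : FiniteDimensional ℝ H := Module.finite_of_finrank_pos (by rw [hrank]; exact hmj)
  have hne : H ≠ ⊥ := by
    rintro rfl
    rw [finrank_bot] at hrank
    omega
  obtain ⟨μ, x, y, hx, hy, hxy, horb⟩ := exists_isEigenorbit_mem hne fun t x hx => by
    rw [← hH.invariant t]
    exact ⟨x, hx, rfl⟩
  refine ⟨μ, horb.mem_pointSpectrum hxy, ?_⟩
  rcases horb.growthRate_eq hxy with h0 | h0
  · rw [← h0.2]
    exact (hH.forward x hx h0.1).limsup_eq.symm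
  · rw [← h0.2]
    exact (hH.forward y hy h0.1).limsup_eq.symm

theorem IsLyapunovSequence.growthRate_le_zero {lam : ℕ → EReal} (h : T.IsLyapunovSequence lam)
    (x : B) : T.growthRate x ≤ lam 0 := by
  rw [h.eq_decreasingSeq]
  exact le_sSup ⟨x, rfl⟩

theorem IsLyapunovSequence.isGreatest {lam : ℕ → EReal} (h : T.IsLyapunovSequence lam)
    (hne : (pointSpectrum T.generator).Nonempty) :
    IsGreatest ((fun μ : ℂ => (μ.re : EReal)) '' pointSpectrum T.generator) (lam 0) := by
  have hle : ∀ μ ∈ pointSpectrum T.generator, (μ.re : EReal) ≤ lam 0 := by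
    intro μ hμ
    obtain ⟨x, y, hne, horb⟩ := exists_isEigenorbit hμ
    rcases horb.growthRate_eq hne with h' | h'
    · exact h'.2 ▸ h.growthRate_le_zero x
    · exact h'.2 ▸ h.growthRate_le_zero y
  obtain ⟨μ, hμ⟩ := hne
  have hbot : lam 0 ≠ ⊥ := ((EReal.bot_lt_coe _).trans_le (hle μ hμ)).ne'
  obtain ⟨ν, hν, hν'⟩ := h.exists_mem_pointSpectrum hbot
  refine ⟨⟨ν, hν, hν'.symm⟩, ?_⟩
  rintro _ ⟨μ, hμ, rfl⟩
  exact hle μ hμ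

end C0Semigroup

/-! ### Linear retarded functional differential equations -/

/-- Grönwall's inequality is applied to the primitive of `f`, which starts at zero and has
derivative `f`. -/
theorem eq_zero_of_le_mul_integral {f : ℝ → ℝ} (hf : Continuous f) (hf0 : ∀ t, 0 ≤ f t) {K : ℝ}
    (h : ∀ t, 0 ≤ t → f t ≤ K * ∫ s in (0 : ℝ)..t, f s) {t : ℝ} (ht : 0 ≤ t) :
    f t = 0 := by
  have hN : ∀ v, HasDerivAt (fun v => ∫ s in (0 : ℝ)..v, f s) (f v) v := fun v =>
    intervalIntegral.integral_hasDerivAt_right (hf.intervalIntegrable _ _)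
      (hf.stronglyMeasurableAtFilter _ _) hf.continuousAt
  have hN0 : ∀ v, 0 ≤ v → 0 ≤ ∫ s in (0 : ℝ)..v, f s := fun v hv =>
    intervalIntegral.integral_nonneg hv fun s _ => hf0 s
  have h1 := norm_le_gronwallBound_of_norm_deriv_right_le (δ := 0) (K := K) (ε := 0) (a := 0)
    (b := t) (f := fun v => ∫ s in (0 : ℝ)..v, f s) (f' := f)
    (fun v _ => (hN v).continuousAt.continuousWithinAt) (fun v _ => (hN v).hasDerivWithinAt)
    (by simp) (fun v hv => by
      rw [Real.norm_of_nonneg (hf0 v), Real.norm_of_nonneg (hN0 v hv.1), add_zero]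
      exact h v hv.1) t ⟨ht, le_rfl⟩
  rw [gronwallBound_ε0_δ0] at h1
  have h2 := h t ht
  rw [norm_le_zero_iff.1 h1, mul_zero] at h2
  exact le_antisymm h2 (hf0 t)

section Retarded

variable {E : Type*} [NormedAddCommGroup E] [NormedSpace ℝ E] {r : ℝ≥0}

/-- A curve of segments `U t`, `t ≥ 0`, of a solution of the retarded equation `y' = G y_t` with
initial segment `ξ`. -/
def IsRetardedCurve (G : C(DelayInterval r, E) →L[ℝ] E) (ξ : C(DelayInterval r, E))
    (U : ℝ → C(DelayInterval r, E)) : Prop :=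
  ∀ t (_ : 0 ≤ t) (τ : DelayInterval r),
    (∀ h : t + (τ : ℝ) ≤ 0, U t τ = ξ ⟨t + (τ : ℝ), by have := τ.2.1; exact ⟨by linarith, h⟩⟩) ∧
    (0 < t + (τ : ℝ) → U t τ = ξ (delayZero r) + ∫ s in (0 : ℝ)..(t + τ), G (U s))

variable {G : C(DelayInterval r, E) →L[ℝ] E}

theorem IsRetardedCurve.eq {ξ : C(DelayInterval r, E)} {U V : ℝ → C(DelayInterval r, E)}
    (hU : IsRetardedCurve G ξ U) (hV : IsRetardedCurve G ξ V) (hUc : Continuous U)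
    (hVc : Continuous V) {t : ℝ} (ht : 0 ≤ t) : U t = V t := by
  have hn : Continuous fun t => ‖U t - V t‖ := by fun_prop
  rw [← sub_eq_zero, ← norm_eq_zero]
  refine eq_zero_of_le_mul_integral (f := fun t => ‖U t - V t‖) hn (fun _ => norm_nonneg _)
    (K := ‖G‖) (fun t ht => ?_) ht
  have hint0 : 0 ≤ ∫ s in (0 : ℝ)..t, ‖U s - V s‖ :=
    intervalIntegral.integral_nonneg ht fun s _ => norm_nonneg _
  refine (ContinuousMap.norm_le _ (mul_nonneg (norm_nonneg G) hint0)).2 fun τ => ?_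
  rw [ContinuousMap.sub_apply]
  rcases le_or_gt (t + τ : ℝ) 0 with h | h
  · rw [(hU t ht τ).1 h, (hV t ht τ).1 h, sub_self, norm_zero]
    exact mul_nonneg (norm_nonneg G) hint0
  · have hGU : Continuous fun s => G (U s) := G.continuous.comp hUc
    have hGV : Continuous fun s => G (V s) := G.continuous.comp hVc
    rw [(hU t ht τ).2 h, (hV t ht τ).2 h, add_sub_add_left_eq_sub,
      ← intervalIntegral.integral_sub (hGU.intervalIntegrable _ _) (hGV.intervalIntegrable _ _)]
    have hτ : t + τ ≤ t := by have := τ.2.2; linarith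
    calc ‖∫ s in (0 : ℝ)..(t + τ), (G (U s) - G (V s))‖
        ≤ ∫ s in (0 : ℝ)..(t + τ), ‖G‖ * ‖U s - V s‖ := by
          refine intervalIntegral.norm_integral_le_of_norm_le h.le (.of_forall fun s _ => ?_)
            ((hn.const_mul _).intervalIntegrable _ _)
          rw [← map_sub]
          exact G.le_opNorm _
      _ = ‖G‖ * ∫ s in (0 : ℝ)..(t + τ), ‖U s - V s‖ :=
          intervalIntegral.integral_const_mul _ _
      _ ≤ ‖G‖ * ∫ s in (0 : ℝ)..t, ‖U s - V s‖ := by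
          gcongr
          exact intervalIntegral.integral_mono_interval le_rfl h.le hτ
            (.of_forall fun s => norm_nonneg _) (hn.intervalIntegrable _ _)

variable (r) in
/-- The segments `y_s = y (s + ·)` of a continuous function. -/
noncomputable def delaySegment (y : C(ℝ, E)) : C(ℝ, C(DelayInterval r, E)) :=
  ContinuousMap.curry ⟨fun p : ℝ × DelayInterval r => y (p.1 + p.2), by fun_prop⟩

omit [NormedSpace ℝ E] in
@[simp] theorem delaySegment_apply (y : C(ℝ, E)) (s : ℝ) (θ : DelayInterval r) :
    delaySegment r y s θ = y (s + θ) := rfl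

/-- The unweighted function `exp (γ t⁺) z t`. -/
noncomputable def unweight (γ : ℝ) (z : BoundedContinuousFunction ℝ E) : C(ℝ, E) :=
  ⟨fun t => Real.exp (γ * max t 0) • z t, by fun_prop⟩

@[simp] theorem unweight_apply (γ : ℝ) (z : BoundedContinuousFunction ℝ E) (t : ℝ) :
    unweight γ z t = Real.exp (γ * max t 0) • z t := rfl

theorem norm_delaySegment_unweight_le {γ : ℝ} (hγ : 0 ≤ γ) (z : BoundedContinuousFunction ℝ E) (s : ℝ) :
    ‖delaySegment r (unweight γ z) s‖ ≤ Real.exp (γ * max s 0) * ‖z‖ := by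
  refine (ContinuousMap.norm_le _ (by positivity)).2 fun θ => ?_
  rw [delaySegment_apply, unweight_apply, norm_smul, Real.norm_eq_abs, Real.abs_exp]
  have hθ : s + θ ≤ s := by have := θ.2.2; linarith
  gcongr
  exact z.norm_coe_le_norm _

theorem delaySegment_unweight_add (γ : ℝ) (z w : BoundedContinuousFunction ℝ E) (s : ℝ) :
    delaySegment r (unweight γ (z + w)) s = delaySegment r (unweight γ z) s + delaySegment r (unweight γ w) s := by
  ext θ
  simp

theorem delaySegment_unweight_smul (γ c : ℝ) (z : BoundedContinuousFunction ℝ E) (s : ℝ) :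
    delaySegment r (unweight γ (c • z)) s = c • delaySegment r (unweight γ z) s := by
  ext θ
  simp [smul_comm c]

/-- The weighted Volterra operator of the retarded equation `y' = G y_t`. -/
noncomputable def volterraFun (G : C(DelayInterval r, E) →L[ℝ] E) (γ : ℝ)
    (z : BoundedContinuousFunction ℝ E) (t : ℝ) : E :=
  Real.exp (-(γ * max t 0)) • ∫ s in (0 : ℝ)..(max t 0), G (delaySegment r (unweight γ z) s)

theorem continuous_retarded_rhs (G : C(DelayInterval r, E) →L[ℝ] E) (y : C(ℝ, E)) :
    Continuous fun s => G (delaySegment r y s) :=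
  G.continuous.comp (delaySegment r y).continuous

theorem continuous_volterraFun (γ : ℝ) (z : BoundedContinuousFunction ℝ E) :
    Continuous (volterraFun G γ z) := by
  have h1 : Continuous fun v : ℝ => ∫ s in (0 : ℝ)..v, G (delaySegment r (unweight γ z) s) :=
    intervalIntegral.continuous_primitive
      (fun a b => (continuous_retarded_rhs G _).intervalIntegrable a b) 0
  unfold volterraFun
  exact (by fun_prop : Continuous fun t : ℝ => Real.exp (-(γ * max t 0))).smul
    (h1.comp (by fun_prop : Continuous fun t : ℝ => max t 0))

theorem norm_volterraFun_le {γ : ℝ} (hγ : 0 < γ) (z : BoundedContinuousFunction ℝ E) (t : ℝ) :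
    ‖volterraFun G γ z t‖ ≤ ‖G‖ / γ * ‖z‖ := by
  set v := max t 0
  have hv : 0 ≤ v := le_max_right _ _
  have h1 : ‖∫ s in (0 : ℝ)..v, G (delaySegment r (unweight γ z) s)‖ ≤
      ∫ s in (0 : ℝ)..v, ‖G‖ * ‖z‖ * Real.exp (γ * s) := by
    refine intervalIntegral.norm_integral_le_of_norm_le hv (.of_forall fun s hs => ?_)
      (Continuous.intervalIntegrable (by fun_prop) _ _)
    have h2 := norm_delaySegment_unweight_le (r := r) hγ.le z s
    rw [max_eq_left hs.1.le] at h2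
    calc _ ≤ ‖G‖ * (Real.exp (γ * s) * ‖z‖) := G.le_opNorm_of_le h2
      _ = _ := by ring
  have h3 : ∫ s in (0 : ℝ)..v, Real.exp (γ * s) = (Real.exp (γ * v) - 1) / γ := by
    rw [intervalIntegral.integral_comp_mul_left (fun s => Real.exp s) hγ.ne', integral_exp]
    simp [div_eq_inv_mul]
  rw [intervalIntegral.integral_const_mul, h3] at h1
  rw [volterraFun, norm_smul, Real.norm_eq_abs, Real.abs_exp]
  calc _ ≤ Real.exp (-(γ * v)) * (‖G‖ * ‖z‖ * ((Real.exp (γ * v) - 1) / γ)) := by gcongr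
    _ ≤ Real.exp (-(γ * v)) * (‖G‖ * ‖z‖ * (Real.exp (γ * v) / γ)) := by
      gcongr
      linarith
    _ = (Real.exp (-(γ * v)) * Real.exp (γ * v)) * (‖G‖ / γ * ‖z‖) := by ring
    _ = _ := by rw [← Real.exp_add, neg_add_cancel, Real.exp_zero, one_mul]

/-- The weighted Volterra operator as a bounded operator. -/
noncomputable def volterra (G : C(DelayInterval r, E) →L[ℝ] E) {γ : ℝ} (hγ : 0 < γ) :
    BoundedContinuousFunction ℝ E →L[ℝ] BoundedContinuousFunction ℝ E :=
  LinearMap.mkContinuous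
    { toFun := fun z => BoundedContinuousFunction.ofNormedAddCommGroup (volterraFun G γ z)
        (continuous_volterraFun γ z) _ (norm_volterraFun_le hγ z)
      map_add' := fun z w => by
        ext t
        simp only [BoundedContinuousFunction.coe_ofNormedAddCommGroup,
          BoundedContinuousFunction.add_apply, volterraFun, delaySegment_unweight_add, map_add]
        rw [intervalIntegral.integral_add ((continuous_retarded_rhs G _).intervalIntegrable _ _)
          ((continuous_retarded_rhs G _).intervalIntegrable _ _), smul_add]
      map_smul' := fun c z => by
        ext t
        simp only [BoundedContinuousFunction.coe_ofNormedAddCommGroup, RingHom.id_apply,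
          BoundedContinuousFunction.smul_apply, volterraFun, delaySegment_unweight_smul, map_smul]
        rw [intervalIntegral.integral_smul, smul_comm] }
    (‖G‖ / γ) fun z => (BoundedContinuousFunction.norm_le (by positivity)).2 fun t =>
      norm_volterraFun_le hγ z t

theorem volterra_apply {γ : ℝ} (hγ : 0 < γ) (z : BoundedContinuousFunction ℝ E) (t : ℝ) :
    volterra G hγ z t = volterraFun G γ z t := rfl

theorem norm_volterra_le {γ : ℝ} (hγ : 0 < γ) : ‖volterra G hγ‖ ≤ ‖G‖ / γ :=
  LinearMap.mkContinuous_norm_le _ (by positivity) _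

/-- The projection of `ℝ` onto `[-r, 0]`. -/
noncomputable def delayProj (r : ℝ≥0) : ℝ → DelayInterval r :=
  Set.projIcc (-(r : ℝ)) 0 (by simp)

theorem continuous_delayProj : Continuous (delayProj r) := continuous_projIcc

theorem delayProj_coe (θ : DelayInterval r) : delayProj r θ = θ := Set.projIcc_val _ θ

theorem delayProj_of_nonneg {t : ℝ} (ht : 0 ≤ t) : delayProj r t = delayZero r :=
  Set.projIcc_of_right_le _ ht

/-- The weighted constant extension of an initial segment. -/
noncomputable def extendInitial {γ : ℝ} (hγ : 0 ≤ γ) :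
    C(DelayInterval r, E) →L[ℝ] BoundedContinuousFunction ℝ E :=
  have hbd : ∀ (ξ : C(DelayInterval r, E)) (t : ℝ),
      ‖Real.exp (-(γ * max t 0)) • ξ (delayProj r t)‖ ≤ 1 * ‖ξ‖ := fun ξ t => by
    rw [norm_smul, Real.norm_eq_abs, Real.abs_exp]
    gcongr
    · refine Real.exp_le_one_iff.2 (neg_nonpos.2 (mul_nonneg hγ (le_max_right _ _)))
    · exact ξ.norm_coe_le_norm _
  LinearMap.mkContinuous
    { toFun := fun ξ => BoundedContinuousFunction.ofNormedAddCommGroup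
        (fun t : ℝ => Real.exp (-(γ * max t 0)) • ξ (delayProj r t))
        (by have := continuous_delayProj (r := r); fun_prop) _ (hbd ξ)
      map_add' := fun ξ η => by ext t; simp
      map_smul' := fun c ξ => by ext t; simp [smul_comm c] }
    1 fun ξ => (BoundedContinuousFunction.norm_le (by positivity)).2 (hbd ξ)

theorem extendInitial_apply {γ : ℝ} (hγ : 0 ≤ γ) (ξ : C(DelayInterval r, E)) (t : ℝ) :
    extendInitial hγ ξ t = Real.exp (-(γ * max t 0)) • ξ (delayProj r t) := rfl

/-- The solution operator of the retarded equation `y' = G y_t`, in a weighted space. -/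
theorem exists_solution_operator [CompleteSpace E] (G : C(DelayInterval r, E) →L[ℝ] E) :
    ∃ (γ : ℝ) (S : C(DelayInterval r, E) →L[ℝ] BoundedContinuousFunction ℝ E), 0 < γ ∧
      ∀ ξ t, unweight γ (S ξ) t = ξ (delayProj r t) +
        ∫ s in (0 : ℝ)..(max t 0), G (delaySegment r (unweight γ (S ξ)) s) := by
  -- The weighted Volterra operator has norm at most `‖G‖ / γ < 1`, so a Neumann series solves the
  -- equation on the whole half-line at once; the summand `1` covers `G = 0`.
  set γ : ℝ := 2 * ‖G‖ + 1
  have hγ : 0 < γ := by positivity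
  have hlt : ‖volterra G hγ‖ < 1 := by
    refine (norm_volterra_le hγ).trans_lt ((div_lt_one hγ).2 ?_)
    have := norm_nonneg G
    simp only [γ]
    linarith
  obtain ⟨u, hu⟩ := isUnit_one_sub_of_norm_lt_one hlt
  refine ⟨γ, (↑u⁻¹ : _ →L[ℝ] _).comp (extendInitial hγ.le), hγ, fun ξ t => ?_⟩
  set z : BoundedContinuousFunction ℝ E :=
    ((↑u⁻¹ : BoundedContinuousFunction ℝ E →L[ℝ] _).comp (extendInitial hγ.le)) ξ
  have h1 : z - volterra G hγ z = extendInitial hγ.le ξ := by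
    have h2 := congrArg (fun f : BoundedContinuousFunction ℝ E →L[ℝ] _ => f (extendInitial hγ.le ξ))
      u.mul_inv
    rw [hu] at h2
    exact h2
  have h2 : z = extendInitial hγ.le ξ + volterra G hγ z := by rw [← h1, sub_add_cancel]
  have h3 := congrArg (fun f : BoundedContinuousFunction ℝ E => f t) h2
  simp only [BoundedContinuousFunction.add_apply, volterra_apply, extendInitial_apply,
    volterraFun, ← smul_add] at h3
  rw [unweight_apply, h3, smul_smul, ← Real.exp_add, add_neg_cancel, Real.exp_zero, one_smul]

/-- A semigroup on `C([-r, 0], E)` generated by the retarded equation `y' = G y_t`. -/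
def IsRetardedSemigroup (G : C(DelayInterval r, E) →L[ℝ] E)
    (T : C0Semigroup C(DelayInterval r, E)) : Prop :=
  ∀ ξ, IsRetardedCurve G ξ fun t => T.op t.toNNReal ξ

theorem IsRetardedSemigroup.unique {T T' : C0Semigroup C(DelayInterval r, E)}
    (hT : IsRetardedSemigroup G T) (hT' : IsRetardedSemigroup G T') : T = T' := by
  have h : T.op = T'.op := by
    funext t
    ext1 ξ
    have := (hT ξ).eq (hT' ξ) (T.continuous_orbit_toNNReal ξ) (T'.continuous_orbit_toNNReal ξ)
      t.coe_nonneg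
    simpa using this
  cases T
  cases T'
  cases h
  rfl

theorem exists_isRetardedSemigroup [CompleteSpace E] (G : C(DelayInterval r, E) →L[ℝ] E) :
    ∃ T, IsRetardedSemigroup G T := by
  obtain ⟨γ, S, hγ, hS⟩ := exists_solution_operator G
  let y : C(DelayInterval r, E) → C(ℝ, E) := fun ξ => unweight γ (S ξ)
  have hneg : ∀ ξ (θ : DelayInterval r), y ξ θ = ξ θ := fun ξ θ => by
    have h1 := hS ξ θ
    rwa [delayProj_coe, max_eq_right θ.2.2, intervalIntegral.integral_same, add_zero] at h1
  have hpos : ∀ ξ (t : ℝ), 0 ≤ t →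
      y ξ t = ξ (delayZero r) + ∫ s in (0 : ℝ)..t, G (delaySegment r (y ξ) s) := fun ξ t ht => by
    have h1 := hS ξ t
    rwa [delayProj_of_nonneg ht, max_eq_left ht] at h1
  have hcurve : ∀ ξ, IsRetardedCurve G ξ (delaySegment r (y ξ)) := fun ξ t ht τ =>
    ⟨fun h => hneg ξ ⟨t + τ, _⟩, fun h => hpos ξ _ h.le⟩
  -- A time shift of a solution solves the equation from the shifted segment; with uniqueness this
  -- is the semigroup law.
  have hcurve_add : ∀ ξ (s : ℝ), 0 ≤ s →
      IsRetardedCurve G (delaySegment r (y ξ) s) (fun t => delaySegment r (y ξ) (t + s)) := by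
    intro ξ s hs t ht τ
    refine ⟨fun h => ?_, fun h => ?_⟩
    · simp only [delaySegment_apply]
      congr 1
      ring
    · have hc := continuous_retarded_rhs G (y ξ)
      simp only [delaySegment_apply, delayZero, add_zero]
      rw [intervalIntegral.integral_comp_add_right (fun t => G (delaySegment r (y ξ) t)), zero_add,
        hpos ξ s hs, hpos ξ (t + s + τ) (by linarith), add_assoc (ξ _),
        intervalIntegral.integral_add_adjacent_intervals (hc.intervalIntegrable _ _)
          (hc.intervalIntegrable _ _), show t + s + (τ : ℝ) = t + τ + s by ring]
  let op : ℝ≥0 → C(DelayInterval r, E) →L[ℝ] C(DelayInterval r, E) := fun t =>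
    LinearMap.mkContinuous
      { toFun := fun ξ => delaySegment r (y ξ) t
        map_add' := fun ξ η => by simp only [y, map_add, delaySegment_unweight_add]
        map_smul' := fun c ξ => by simp only [y, map_smul, delaySegment_unweight_smul, RingHom.id_apply] }
      (Real.exp (γ * max (t : ℝ) 0) * ‖S‖) fun ξ => by
        refine (norm_delaySegment_unweight_le hγ.le (S ξ) t).trans ?_
        rw [mul_assoc]
        gcongr
        exact S.le_opNorm ξ
  have hop : ∀ t ξ, op t ξ = delaySegment r (y ξ) t := fun t ξ => rfl
  let T : C0Semigroup C(DelayInterval r, E) :=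
    { op := op
      op_add := fun t s => by
        ext1 ξ
        have h1 := (hcurve_add ξ s s.coe_nonneg).eq (hcurve (delaySegment r (y ξ) s))
          ((delaySegment r (y ξ)).continuous.comp (by fun_prop)) (delaySegment r _).continuous t.coe_nonneg
        exact h1
      op_zero := by
        ext ξ θ
        change y ξ (((0 : ℝ≥0) : ℝ) + θ) = ξ θ
        rw [NNReal.coe_zero, zero_add, hneg]
      continuous_orbit := fun ξ => (delaySegment r (y ξ)).continuous.comp NNReal.continuous_coe }
  refine ⟨T, fun ξ t ht τ => ?_⟩
  have hUs : ∀ s : ℝ, 0 ≤ s → T.op s.toNNReal ξ = delaySegment r (y ξ) s := fun s hs => by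
    change delaySegment r (y ξ) (s.toNNReal : ℝ) = _
    rw [Real.coe_toNNReal s hs]
  refine ⟨fun h => ?_, fun h => ?_⟩
  · exact (congrArg (fun f => f τ) (hUs t ht)).trans ((hcurve ξ t ht τ).1 h)
  · beta_reduce
    rw [hUs t ht, (hcurve ξ t ht τ).2 h]
    congr 1
    refine intervalIntegral.integral_congr fun s hs => ?_
    rw [Set.uIcc_of_le h.le] at hs
    rw [hUs s hs.1]

theorem isCompact_setOf_lipschitz [FiniteDimensional ℝ E] (M : ℝ) (K : ℝ≥0) :
    IsCompact {f : C(DelayInterval r, E) | (∀ θ, ‖f θ‖ ≤ M) ∧ LipschitzWith K f} := by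
  have := FiniteDimensional.proper_real E
  let A : Set (BoundedContinuousFunction (DelayInterval r) E) :=
    {f | (∀ θ, f θ ∈ Metric.closedBall (0 : E) M) ∧ LipschitzWith K f}
  have hA : IsCompact A := by
    refine BoundedContinuousFunction.arzela_ascoli₂ (Metric.closedBall (0 : E) M)
      (isCompact_closedBall _ _) A ?_ (fun f θ hf => hf.1 θ) ?_
    · have h1 : A = (⋂ θ, {f | f θ ∈ Metric.closedBall (0 : E) M}) ∩
          ⋂ (θ) (θ'), {f | dist (f θ) (f θ') ≤ K * dist θ θ'} := by
        ext f
        simp only [A, Set.mem_ofPred_eq, Set.mem_inter_iff, Set.mem_iInter,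
          lipschitzWith_iff_dist_le_mul]
      rw [h1]
      refine (isClosed_iInter fun θ => ?_).inter (isClosed_iInter fun θ => isClosed_iInter fun θ' => ?_)
      · exact Metric.isClosed_closedBall.preimage (by fun_prop : Continuous fun f : BoundedContinuousFunction (DelayInterval r) E => f θ)
      · exact isClosed_le (by fun_prop) continuous_const
    · exact (LipschitzWith.uniformEquicontinuous _ K fun f => f.2.2).equicontinuous
  have h2 := hA.image (ContinuousMap.isometryEquivBoundedOfCompact (DelayInterval r) E).symm.continuous
  refine (congrArg IsCompact (Set.ext fun f => ?_)).mpr h2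
  constructor
  · rintro hf
    exact ⟨BoundedContinuousFunction.mkOfCompact f, ⟨fun θ => by simpa using hf.1 θ, hf.2⟩, rfl⟩
  · rintro ⟨g, hg, rfl⟩
    exact ⟨fun θ => by simpa using hg.1 θ, hg.2⟩

/-- Once `t ≥ r`, the whole segment is a primitive of `G (T s ξ)`, so the image of the unit ball is
bounded and equi-Lipschitz, with constant `‖G‖ * M`. -/
theorem IsRetardedSemigroup.isCompactOperator [FiniteDimensional ℝ E]
    {T : C0Semigroup C(DelayInterval r, E)} (hT : IsRetardedSemigroup G T) {t : ℝ≥0} (ht : r ≤ t) :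
    IsCompactOperator (T.op t) := by
  have : CompleteSpace E := FiniteDimensional.complete ℝ E
  obtain ⟨M, hM, hTM⟩ := T.exists_norm_op_le t
  refine (isCompactOperator_iff_image_closedBall_subset_compact
    (T.op t : C(DelayInterval r, E) →ₗ[ℝ] C(DelayInterval r, E)) zero_lt_one).2
    ⟨_, isCompact_setOf_lipschitz M (‖G‖ * M).toNNReal, ?_⟩
  rintro _ ⟨ξ, hξ, rfl⟩
  have hξ1 : ‖ξ‖ ≤ 1 := by simpa using hξ
  have hTξ : ∀ s ≤ t, ‖T.op s ξ‖ ≤ M := fun s hs => by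
    simpa using (T.op s).le_of_opNorm_le_of_le (hTM s hs) hξ1
  have hform : ∀ τ : DelayInterval r, T.op t ξ τ =
      ξ (delayZero r) + ∫ s in (0 : ℝ)..(t + τ), G (T.op s.toNNReal ξ) := by
    intro τ
    have h1 := hT ξ t t.coe_nonneg τ
    have hrt : (r : ℝ) ≤ t := ht
    beta_reduce at h1
    rw [Real.toNNReal_coe] at h1
    -- The point `t + τ = 0`, which occurs for `t = r`, belongs to the initial clause; the integral
    -- formula still holds because the integral is empty.
    rcases (show (0 : ℝ) ≤ t + τ by have := τ.2.1; linarith).eq_or_lt with h | h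
    · have h0 : ∫ s in (0 : ℝ)..(t + τ), G (T.op s.toNNReal ξ) = 0 := by
        rw [← h, intervalIntegral.integral_same]
      rw [h0, add_zero]
      exact (h1.1 h.ge).trans (congrArg ξ (Subtype.ext h.symm))
    · exact h1.2 h
  have hGc : Continuous fun s : ℝ => G (T.op s.toNNReal ξ) :=
    G.continuous.comp (T.continuous_orbit_toNNReal ξ)
  refine ⟨fun θ => ((T.op t ξ).norm_coe_le_norm θ).trans (hTξ t le_rfl),
    LipschitzWith.of_dist_le_mul fun θ θ' => ?_⟩
  rw [Real.coe_toNNReal _ (by positivity), dist_eq_norm]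
  change ‖T.op t ξ θ - T.op t ξ θ'‖ ≤ _
  rw [hform, hform, add_sub_add_left_eq_sub, intervalIntegral.integral_interval_sub_left
    (hGc.intervalIntegrable _ _) (hGc.intervalIntegrable _ _)]
  have h2 := intervalIntegral.norm_integral_le_of_norm_le_const (a := (t + θ' : ℝ)) (b := t + θ)
    (C := ‖G‖ * M) (f := fun s : ℝ => G (T.op s.toNNReal ξ)) fun s hs => by
      refine G.le_opNorm_of_le (hTξ _ (Real.toNNReal_le_iff_le_coe.2 ?_))
      refine hs.2.trans (max_le ?_ ?_)
      · have := θ'.2.2; linarith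
      · have := θ.2.2; linarith
  refine h2.trans (le_of_eq ?_)
  rw [add_sub_add_left_eq_sub, Subtype.dist_eq, Real.dist_eq]

end Retarded

/-! ### Integration against signed measures on a compact space -/

section SignedIntegral

variable {X : Type*} [TopologicalSpace X] [CompactSpace X] [MeasurableSpace X] [BorelSpace X]
  [SecondCountableTopology X] {F : Type*} [NormedAddCommGroup F] [NormedSpace ℝ F]

omit [NormedSpace ℝ F] in
theorem ContinuousMap.integrable_of_isFiniteMeasure (μ : Measure X) [IsFiniteMeasure μ]
    (f : C(X, F)) : Integrable f μ :=
  .of_bound (C := ‖f‖) (f.continuous.aestronglyMeasurable)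
    (.of_forall f.norm_coe_le_norm)

theorem SignedMeasure.integral_eq_sub [CompleteSpace F] (ν : SignedMeasure X) (f : C(X, F)) :
    ∫ᵛ x, f x ∂<•ν = ∫ x, f x ∂ν.toJordanDecomposition.posPart -
      ∫ x, f x ∂ν.toJordanDecomposition.negPart := by
  have h : ν = ν.toJordanDecomposition.posPart.toSignedMeasure -
      ν.toJordanDecomposition.negPart.toSignedMeasure :=
    ν.toSignedMeasure_toJordanDecomposition.symm
  conv_lhs => rw [h]
  rw [VectorMeasure.integral_sub_vectorMeasure, VectorMeasure.integral_toSignedMeasure,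
    VectorMeasure.integral_toSignedMeasure]
  · rw [VectorMeasure.Integrable, Measure.variation_toSignedMeasure]
    exact f.integrable_of_isFiniteMeasure _
  · rw [VectorMeasure.Integrable, Measure.variation_toSignedMeasure]
    exact f.integrable_of_isFiniteMeasure _

variable (𝕜 : Type*) [RCLike 𝕜] [NormedSpace 𝕜 F] [SMulCommClass ℝ 𝕜 F] [CompleteSpace F]

variable (F) in
/-- Integration against a signed measure, as a bounded functional on continuous functions. -/
noncomputable def SignedMeasure.integralCLM (ν : SignedMeasure X) : C(X, F) →L[𝕜] F :=
  LinearMap.mkContinuous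
    { toFun := fun f => ∫ᵛ x, f x ∂<•ν
      map_add' := fun f g => by
        rw [SignedMeasure.integral_eq_sub, SignedMeasure.integral_eq_sub,
          SignedMeasure.integral_eq_sub]
        simp only [ContinuousMap.add_apply]
        rw [integral_add (f.integrable_of_isFiniteMeasure _) (g.integrable_of_isFiniteMeasure _),
          integral_add (f.integrable_of_isFiniteMeasure _) (g.integrable_of_isFiniteMeasure _)]
        abel
      map_smul' := fun c f => by
        rw [SignedMeasure.integral_eq_sub, SignedMeasure.integral_eq_sub]
        simp only [ContinuousMap.smul_apply, integral_smul, RingHom.id_apply, smul_sub] }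
    (ν.toJordanDecomposition.posPart.real Set.univ + ν.toJordanDecomposition.negPart.real Set.univ)
    fun f => by
      have h := fun (μ : Measure X) [IsFiniteMeasure μ] =>
        norm_integral_le_of_norm_le_const (μ := μ) (.of_forall f.norm_coe_le_norm)
      simp only [LinearMap.coe_mk, AddHom.coe_mk, SignedMeasure.integral_eq_sub]
      refine (norm_sub_le_of_le (h _) (h _)).trans (le_of_eq ?_)
      ring

theorem SignedMeasure.integralCLM_apply (ν : SignedMeasure X) (f : C(X, F)) :
    SignedMeasure.integralCLM F 𝕜 ν f = ∫ᵛ x, f x ∂<•ν := rfl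

theorem SignedMeasure.integral_re (ν : SignedMeasure X) (f : C(X, ℂ)) :
    ∫ᵛ x, (f x).re ∂<•ν = (∫ᵛ x, f x ∂<•ν).re := by
  have h := SignedMeasure.integral_eq_sub ν (⟨fun x => (f x).re, by fun_prop⟩ : C(X, ℝ))
  have h2 := fun (μ : Measure X) [IsFiniteMeasure μ] =>
    Complex.reCLM.integral_comp_comm (f.integrable_of_isFiniteMeasure μ)
  simp only [Complex.reCLM_apply] at h2
  rw [SignedMeasure.integral_eq_sub, Complex.sub_re, ← h2, ← h2]
  exact h

end SignedIntegral

/-! ### Linear delay equations -/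

section Delay

variable {n : ℕ} {r : ℝ≥0}

/-- The operator `ξ ↦ ∫ ξ dπ` as a bounded operator. -/
noncomputable def delayIntegralCLM (π : Fin n → Fin n → SignedMeasure (DelayInterval r)) :
    DelaySpace n r →L[ℝ] EuclideanSpace ℝ (Fin n) :=
  ((PiLp.continuousLinearEquiv 2 ℝ (fun _ : Fin n => ℝ)).symm : (Fin n → ℝ) →L[ℝ] _).comp
    (ContinuousLinearMap.pi fun j => ∑ i, (SignedMeasure.integralCLM ℝ ℝ (π i j)).comp
      ((EuclideanSpace.proj i).compLeftContinuous ℝ (DelayInterval r)))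

theorem delayIntegralCLM_apply (π : Fin n → Fin n → SignedMeasure (DelayInterval r))
    (ξ : DelaySpace n r) : delayIntegralCLM π ξ = delayIntegral π ξ := by
  ext j
  simp only [delayIntegralCLM, delayIntegral]
  simp [SignedMeasure.integralCLM_apply]
  rfl

/-- The right hand side `ξ ↦ A (ξ 0, ∫ ξ dπ)` of the delay equation. -/
noncomputable def delayRhs
    (A : EuclideanSpace ℝ (Fin n) × EuclideanSpace ℝ (Fin n) →L[ℝ] EuclideanSpace ℝ (Fin n))
    (π : Fin n → Fin n → SignedMeasure (DelayInterval r)) :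
    DelaySpace n r →L[ℝ] EuclideanSpace ℝ (Fin n) :=
  A.comp ((ContinuousMap.evalCLM ℝ (delayZero r)).prod (delayIntegralCLM π))

variable {A : EuclideanSpace ℝ (Fin n) × EuclideanSpace ℝ (Fin n) →L[ℝ] EuclideanSpace ℝ (Fin n)}
  {π : Fin n → Fin n → SignedMeasure (DelayInterval r)}

theorem delayRhs_apply (ξ : DelaySpace n r) :
    delayRhs A π ξ = A (ξ (delayZero r), delayIntegral π ξ) := by
  rw [← delayIntegralCLM_apply]
  rfl

theorem isDelaySemigroup_iff {T : C0Semigroup (DelaySpace n r)} :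
    IsDelaySemigroup A π T ↔ IsRetardedSemigroup (delayRhs A π) T := by
  constructor
  · intro h ξ t ht τ
    lift t to ℝ≥0 using ht
    have h1 := h t ξ τ
    simp only [← delayRhs_apply] at h1
    beta_reduce
    rw [Real.toNNReal_coe]
    exact h1
  · intro h t ξ τ
    have h1 := h ξ t t.coe_nonneg τ
    beta_reduce at h1
    rw [Real.toNNReal_coe] at h1
    simp only [← delayRhs_apply]
    exact h1

theorem EuclideanSpace.clm_apply_coord
    (L : EuclideanSpace ℝ (Fin n) →L[ℝ] EuclideanSpace ℝ (Fin n)) (u : EuclideanSpace ℝ (Fin n))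
    (k : Fin n) : L u k = ∑ l, L (EuclideanSpace.single l 1) k * u l := by
  have h : u = ∑ l, u l • EuclideanSpace.single l (1 : ℝ) := by
    ext k
    simp [Finset.sum_apply, Pi.single_apply]
  conv_lhs => rw [h, map_sum]
  simp [mul_comm]

theorem delayRhs_apply_coord (ξ : DelaySpace n r) (k : Fin n) :
    delayRhs A π ξ k = ∑ l, A (EuclideanSpace.single l 1, 0) k * ξ (delayZero r) l +
      ∑ j, A (0, EuclideanSpace.single j 1) k * ∑ i, ∫ᵛ θ, (ξ θ i) ∂<•(π i j) := by
  have h1 : ∀ u : EuclideanSpace ℝ (Fin n),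
      A (u, 0) k = ∑ l, A (EuclideanSpace.single l 1, 0) k * u l := fun u =>
    EuclideanSpace.clm_apply_coord (A.comp (ContinuousLinearMap.inl ℝ _ _)) u k
  have h2 : ∀ u : EuclideanSpace ℝ (Fin n),
      A (0, u) k = ∑ l, A (0, EuclideanSpace.single l 1) k * u l := fun u =>
    EuclideanSpace.clm_apply_coord (A.comp (ContinuousLinearMap.inr ℝ _ _)) u k
  rw [delayRhs_apply, show ((ξ (delayZero r), delayIntegral π ξ) : _ × _) =
    (ξ (delayZero r), 0) + (0, delayIntegral π ξ) by simp, map_add, PiLp.add_apply, h1, h2]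
  simp [delayIntegral]

end Delay

/-! ### Exponential solutions of linear delay equations -/

section Exponential

variable {n : ℕ} {r : ℝ≥0}

variable (r) in
/-- The segment `θ ↦ Re (exp (z θ) C)`. -/
noncomputable def expSegment (z : ℂ) (C : Fin n → ℂ) : DelaySpace n r :=
  ⟨fun θ => WithLp.toLp 2 fun l => (Complex.exp (z * (θ : ℝ)) * C l).re, by fun_prop⟩

theorem expSegment_apply (z : ℂ) (C : Fin n → ℂ) (θ : DelayInterval r) (l : Fin n) :
    expSegment r z C θ l = (Complex.exp (z * (θ : ℝ)) * C l).re := rfl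

variable {A : EuclideanSpace ℝ (Fin n) × EuclideanSpace ℝ (Fin n) →L[ℝ] EuclideanSpace ℝ (Fin n)}
  {π : Fin n → Fin n → SignedMeasure (DelayInterval r)}

theorem delayCharacteristic_mulVec (z : ℂ) (C : Fin n → ℂ) (k : Fin n) :
    (delayCharacteristic A π z).mulVec C k = z * C k -
      (∑ l, (A (EuclideanSpace.single l 1, 0) k : ℂ) * C l +
      ∑ j, (A (0, EuclideanSpace.single j 1) k : ℂ) *
        ∑ i, (∫ᵛ θ, Complex.exp (z * ((θ : ℝ) : ℂ)) ∂<•(π i j)) * C i) := by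
  simp only [delayCharacteristic, Matrix.sub_mulVec, Matrix.smul_mulVec, Matrix.one_mulVec,
    Pi.sub_apply, Pi.smul_apply, smul_eq_mul, sub_sub]
  rw [Matrix.add_mulVec, ← Matrix.mulVec_mulVec]
  rfl

/-- The defect between the right-hand side of the equation and the derivative `Re (z C)` of the
exponential is exactly `Re (Δ(z) C)`. -/
theorem delayRhs_expSegment (z : ℂ) (C : Fin n → ℂ) (k : Fin n) :
    delayRhs A π (expSegment r z C) k = (z * C k - (delayCharacteristic A π z).mulVec C k).re := by
  have hint : ∀ i j, ∫ᵛ θ, (expSegment r z C θ i) ∂<•(π i j) =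
      ((∫ᵛ θ, Complex.exp (z * ((θ : ℝ) : ℂ)) ∂<•(π i j)) * C i).re := fun i j => by
    let f : C(DelayInterval r, ℂ) := ⟨fun θ => Complex.exp (z * (θ : ℝ)), by fun_prop⟩
    have h1 := SignedMeasure.integral_re (π i j) (C i • f)
    have h2 := map_smul (SignedMeasure.integralCLM ℂ ℂ (π i j)) (C i) f
    simp only [SignedMeasure.integralCLM_apply] at h2
    rw [h2, smul_eq_mul, mul_comm] at h1
    refine Eq.trans ?_ h1
    congr 1
    funext θ
    rw [expSegment_apply, mul_comm]
    rfl
  rw [delayCharacteristic_mulVec, sub_sub_cancel, delayRhs_apply_coord]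
  simp only [Complex.add_re, Complex.re_sum, Complex.re_ofReal_mul, hint]
  simp [expSegment_apply, delayZero]

theorem isRetardedCurve_expSegment {z : ℂ} {C : Fin n → ℂ}
    (hC : (delayCharacteristic A π z).mulVec C = 0) :
    IsRetardedCurve (delayRhs A π) (expSegment r z C)
      fun t => expSegment r z (Complex.exp (z * t) • C) := by
  intro t ht τ
  have hval : ∀ k, expSegment r z (Complex.exp (z * t) • C) τ k =
      (Complex.exp (z * ((t + τ : ℝ) : ℂ)) * C k).re := fun k => by
    rw [expSegment_apply, Pi.smul_apply, smul_eq_mul, ← mul_assoc, ← Complex.exp_add]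
    push_cast
    ring_nf
  refine ⟨fun h => ?_, fun h => ?_⟩
  · ext k
    rw [hval, expSegment_apply]
  · have hcont : Continuous fun s : ℝ =>
        delayRhs A π (expSegment r z (Complex.exp (z * s) • C)) := by
      refine (delayRhs A π).continuous.comp (ContinuousMap.continuous_of_continuous_uncurry _ ?_)
      simp only [Function.uncurry_def, expSegment, Pi.smul_apply, ContinuousMap.coe_mk]
      fun_prop
    ext k
    have hG : ∀ s : ℝ, delayRhs A π (expSegment r z (Complex.exp (z * s) • C)) k =
        (Complex.exp (z * s) * z * C k).re := fun s => by
      rw [delayRhs_expSegment, Matrix.mulVec_smul, hC, smul_zero, Pi.zero_apply, sub_zero,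
        Pi.smul_apply, smul_eq_mul]
      ring_nf
    have hcomm : (∫ s in (0 : ℝ)..(t + τ),
        delayRhs A π (expSegment r z (Complex.exp (z * s) • C))) k =
        ∫ s in (0 : ℝ)..(t + τ), (Complex.exp (z * s) * z * C k).re := by
      simp only [← hG]
      exact ((EuclideanSpace.proj k : EuclideanSpace ℝ (Fin n) →L[ℝ] ℝ).intervalIntegral_comp_comm
        (hcont.intervalIntegrable _ _)).symm
    have hderiv : ∀ s : ℝ, HasDerivAt (fun s : ℝ => (Complex.exp (z * s) * C k).re)
        (Complex.exp (z * s) * z * C k).re s := fun s => by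
      have h1 : HasDerivAt (fun w : ℂ => Complex.exp (z * w) * C k)
          (Complex.exp (z * s) * z * C k) (s : ℂ) := by
        have h2 := ((hasDerivAt_id (s : ℂ)).const_mul z).cexp.mul_const (C k)
        simpa using h2
      exact h1.real_of_complex
    rw [PiLp.add_apply, hcomm, intervalIntegral.integral_eq_sub_of_hasDerivAt
      (fun s _ => hderiv s) (Continuous.intervalIntegrable (by fun_prop) _ _), hval,
      expSegment_apply]
    simp [delayZero]

theorem continuous_expSegment (z : ℂ) (C : Fin n → ℂ) :
    Continuous fun t : ℝ => expSegment r z (Complex.exp (z * t) • C) := by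
  refine ContinuousMap.continuous_of_continuous_uncurry _ ?_
  simp only [Function.uncurry_def, expSegment, Pi.smul_apply, ContinuousMap.coe_mk]
  fun_prop

/-- As `Re (-i w) = Im w`, the segments for `C` and `-i C` are the real and imaginary parts of `exp
(z θ) C`, and this is the rotation formula for them. -/
theorem expSegment_exp_smul (z : ℂ) (C : Fin n → ℂ) (t : ℝ) :
    expSegment r z (Complex.exp (z * t) • C) = Real.exp (z.re * t) •
      (Real.cos (z.im * t) • expSegment r z C -
        Real.sin (z.im * t) • expSegment r z (-Complex.I • C)) := by
  ext θ l
  simp only [expSegment_apply, ContinuousMap.smul_apply, ContinuousMap.sub_apply, PiLp.smul_apply,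
    PiLp.sub_apply, Pi.smul_apply, smul_eq_mul]
  have h1 : (Complex.exp (z * t)).re = Real.exp (z.re * t) * Real.cos (z.im * t) := by
    simp [Complex.exp_re]
  have h2 : (Complex.exp (z * t)).im = Real.exp (z.re * t) * Real.sin (z.im * t) := by
    simp [Complex.exp_im]
  rw [mul_left_comm, Complex.mul_re, h1, h2, mul_left_comm _ (-Complex.I)]
  simp only [Complex.mul_re, Complex.neg_re, Complex.neg_im, Complex.I_re, Complex.I_im]
  ring

end Exponential

/-! ### The point spectrum of a linear delay equation -/

section DelaySpectrum

variable {n : ℕ} {r : ℝ≥0}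
  {A : EuclideanSpace ℝ (Fin n) × EuclideanSpace ℝ (Fin n) →L[ℝ] EuclideanSpace ℝ (Fin n)}
  {π : Fin n → Fin n → SignedMeasure (DelayInterval r)} {T : C0Semigroup (DelaySpace n r)}

theorem IsRetardedSemigroup.op_expSegment (hT : IsRetardedSemigroup (delayRhs A π) T) {z : ℂ}
    {C : Fin n → ℂ} (hC : (delayCharacteristic A π z).mulVec C = 0) (t : ℝ≥0) :
    T.op t (expSegment r z C) = expSegment r z (Complex.exp (z * (t : ℝ)) • C) := by
  have h := (hT (expSegment r z C)).eq (isRetardedCurve_expSegment hC)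
    (T.continuous_orbit_toNNReal _) (continuous_expSegment z C) t.coe_nonneg
  beta_reduce at h
  rwa [Real.toNNReal_coe] at h

theorem expSegment_neg (z : ℂ) (C : Fin n → ℂ) : expSegment r z (-C) = -expSegment r z C := by
  ext θ l
  simp only [expSegment_apply, ContinuousMap.neg_apply, PiLp.neg_apply, Pi.neg_apply, mul_neg,
    Complex.neg_re]

theorem isEigenorbit_expSegment {z : ℂ} {C : Fin n → ℂ}
    (h : ∀ t : ℝ≥0, T.op t (expSegment r z C) = expSegment r z (Complex.exp (z * (t : ℝ)) • C))
    (h' : ∀ t : ℝ≥0, T.op t (expSegment r z (-Complex.I • C)) =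
      expSegment r z (Complex.exp (z * (t : ℝ)) • (-Complex.I • C))) :
    T.IsEigenorbit z (expSegment r z C) (expSegment r z (-Complex.I • C)) := by
  intro t
  refine ⟨(h t).trans (expSegment_exp_smul z C t), ?_⟩
  rw [h' t, expSegment_exp_smul, smul_smul,
    show -Complex.I * -Complex.I = -1 by rw [neg_mul_neg, Complex.I_mul_I], neg_one_smul,
    expSegment_neg, smul_neg, sub_neg_eq_add, add_comm]

theorem eq_zero_of_expSegment_eq_zero {z : ℂ} {C : Fin n → ℂ} (h : expSegment r z C = 0)
    (h' : expSegment r z (-Complex.I • C) = 0) : C = 0 := by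
  funext l
  have h1 := congrArg (fun ξ : DelaySpace n r => ξ (delayZero r) l) h
  have h2 := congrArg (fun ξ : DelaySpace n r => ξ (delayZero r) l) h'
  simp [expSegment_apply, delayZero] at h1 h2
  exact Complex.ext h1 h2

/-- Only the shift part of the semigroup matters: at time `-θ` the value at `θ` is the initial value
at `0`, so the eigenvector relation determines `x + i y` at `θ` as `exp (z θ)` times its value at
`0`. -/
theorem IsRetardedSemigroup.exists_eq_expSegment {G : DelaySpace n r →L[ℝ] EuclideanSpace ℝ (Fin n)}
    (hT : IsRetardedSemigroup G T) {z : ℂ} {x y : DelaySpace n r} (h : T.IsEigenorbit z x y) :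
    ∃ C, x = expSegment r z C ∧ y = expSegment r z (-Complex.I • C) := by
  have hkey : ∀ (θ : DelayInterval r) (l : Fin n), Complex.exp (z * (θ : ℝ)) *
      (x (delayZero r) l + y (delayZero r) l * Complex.I) = x θ l + y θ l * Complex.I := by
    intro θ l
    have hshift : ∀ ξ : DelaySpace n r,
        T.op (-(θ : ℝ)).toNNReal ξ θ = ξ (delayZero r) := fun ξ =>
      ((hT ξ (-θ) (neg_nonneg.2 θ.2.2) θ).1 (neg_add_cancel _).le).trans
        (congrArg ξ (Subtype.ext (neg_add_cancel _)))
    obtain ⟨h1, h2⟩ := h (-(θ : ℝ)).toNNReal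
    have hx := congrArg (fun ξ : DelaySpace n r => ξ θ l) h1
    have hy := congrArg (fun ξ : DelaySpace n r => ξ θ l) h2
    simp only [hshift, ContinuousMap.smul_apply, ContinuousMap.sub_apply, ContinuousMap.add_apply,
      PiLp.smul_apply, PiLp.sub_apply, PiLp.add_apply, smul_eq_mul,
      Real.coe_toNNReal _ (neg_nonneg.2 θ.2.2)] at hx hy
    have h3 : (x (delayZero r) l + y (delayZero r) l * Complex.I : ℂ) =
        Complex.exp (z * ((-θ : ℝ) : ℂ)) * (x θ l + y θ l * Complex.I) := by
      rw [hx, hy]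
      apply Complex.ext <;>
        simp only [Complex.add_re, Complex.mul_re, Complex.add_im, Complex.mul_im, Complex.exp_re,
          Complex.exp_im, Complex.ofReal_re, Complex.ofReal_im, Complex.I_re, Complex.I_im] <;>
        ring_nf
    rw [h3, ← mul_assoc, ← Complex.exp_add]
    simp
  refine ⟨fun l => x (delayZero r) l + y (delayZero r) l * Complex.I, ?_, ?_⟩
  · ext θ l
    rw [expSegment_apply, hkey]
    simp
  · ext θ l
    rw [expSegment_apply, Pi.smul_apply, smul_eq_mul, mul_left_comm, hkey]
    simp

/-- Differentiating the integral equation at `t = 0` in two ways gives `Re (z C) = Re (z C - Δ(z)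
C)`. Applied also to `-i C`, it yields the imaginary part. -/
theorem IsRetardedSemigroup.re_delayCharacteristic_mulVec_eq_zero
    (hT : IsRetardedSemigroup (delayRhs A π) T) {z : ℂ} {C : Fin n → ℂ}
    (h : ∀ t : ℝ≥0, T.op t (expSegment r z C) = expSegment r z (Complex.exp (z * (t : ℝ)) • C))
    (k : Fin n) : ((delayCharacteristic A π z).mulVec C k).re = 0 := by
  set w := (delayCharacteristic A π z).mulVec C k
  set f : ℝ → ℝ := fun s => (Complex.exp (z * s) * (z * C k - w)).re with hf
  have hfc : Continuous f := by fun_prop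
  have hderiv : ∀ c : ℂ, HasDerivAt (fun s : ℝ => (Complex.exp (z * s) * c).re) (z * c).re 0 := by
    intro c
    have h1 : HasDerivAt (fun w : ℂ => Complex.exp (z * w) * c) (z * c) ((0 : ℝ) : ℂ) := by
      simpa using ((hasDerivAt_id ((0 : ℝ) : ℂ)).const_mul z).cexp.mul_const c
    exact h1.real_of_complex
  have hint : ∀ t : ℝ, 0 ≤ t → (Complex.exp (z * t) * C k).re = (C k).re + ∫ s in (0 : ℝ)..t, f s := by
    intro t ht
    rcases ht.eq_or_lt with rfl | ht0
    · simp
    have h1 := (hT (expSegment r z C) t ht (delayZero r)).2 (by simpa [delayZero] using ht0)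
    beta_reduce at h1
    rw [h, Real.coe_toNNReal t ht] at h1
    have hGc : Continuous fun s : ℝ => delayRhs A π (T.op s.toNNReal (expSegment r z C)) :=
      (delayRhs A π).continuous.comp (T.continuous_orbit_toNNReal _)
    have h2 := congrArg (EuclideanSpace.proj k : EuclideanSpace ℝ (Fin n) →L[ℝ] ℝ) h1
    rw [map_add, ← ContinuousLinearMap.intervalIntegral_comp_comm _
      (hGc.intervalIntegrable _ _)] at h2
    simp only [PiLp.proj_apply, expSegment_apply, delayZero, add_zero] at h2
    simp only [Complex.ofReal_zero, mul_zero, Complex.exp_zero, one_mul, Pi.smul_apply,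
      smul_eq_mul] at h2
    rw [h2]
    congr 1
    refine intervalIntegral.integral_congr fun s hs => ?_
    rw [Set.uIcc_of_le ht] at hs
    beta_reduce
    rw [h, Real.coe_toNNReal s hs.1, delayRhs_expSegment, Matrix.mulVec_smul]
    simp only [hf, w, Pi.smul_apply, smul_eq_mul]
    ring_nf
  have h1 : HasDerivWithinAt (fun t : ℝ => (C k).re + ∫ s in (0 : ℝ)..t, f s) (f 0)
      (Set.Ici 0) 0 :=
    ((intervalIntegral.integral_hasDerivAt_right (hfc.intervalIntegrable _ _)
      (hfc.stronglyMeasurableAtFilter _ _) hfc.continuousAt).const_add _).hasDerivWithinAt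
  have h2 : HasDerivWithinAt (fun t : ℝ => (C k).re + ∫ s in (0 : ℝ)..t, f s) (z * C k).re
      (Set.Ici 0) 0 :=
    (hderiv (C k)).hasDerivWithinAt.congr (fun t ht => (hint t ht).symm) (hint 0 le_rfl).symm
  have h3 := (uniqueDiffOn_Ici (0 : ℝ) 0 Set.self_mem_Ici).eq_deriv _ h1 h2
  simp only [hf, Complex.ofReal_zero, mul_zero, Complex.exp_zero, one_mul, Complex.sub_re] at h3
  linarith

theorem IsRetardedSemigroup.mem_pointSpectrum_iff (hT : IsRetardedSemigroup (delayRhs A π) T)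
    (z : ℂ) : z ∈ pointSpectrum T.generator ↔ (delayCharacteristic A π z).det = 0 := by
  rw [← Matrix.exists_mulVec_eq_zero_iff]
  constructor
  · intro h
    obtain ⟨x, y, hne, horb⟩ := C0Semigroup.exists_isEigenorbit h
    obtain ⟨C, rfl, rfl⟩ := hT.exists_eq_expSegment horb
    have h1 : ∀ t : ℝ≥0,
        T.op t (expSegment r z C) = expSegment r z (Complex.exp (z * (t : ℝ)) • C) := fun t =>
      (horb t).1.trans (expSegment_exp_smul z C t).symm
    have h2 : ∀ t : ℝ≥0, T.op t (expSegment r z (-Complex.I • C)) =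
        expSegment r z (Complex.exp (z * (t : ℝ)) • (-Complex.I • C)) := fun t => by
      rw [(horb t).2, expSegment_exp_smul, smul_smul,
        show -Complex.I * -Complex.I = -1 by rw [neg_mul_neg, Complex.I_mul_I], neg_one_smul,
        expSegment_neg, smul_neg, sub_neg_eq_add, add_comm]
    refine ⟨C, fun hC => ?_, funext fun k => Complex.ext
      (hT.re_delayCharacteristic_mulVec_eq_zero h1 k) ?_⟩
    · have h0 : expSegment r z (0 : Fin n → ℂ) = 0 := by
        ext θ l
        simp [expSegment_apply]
      rw [hC, smul_zero, h0] at hne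
      simp at hne
    · have h3 := hT.re_delayCharacteristic_mulVec_eq_zero h2 k
      rw [Matrix.mulVec_smul] at h3
      simpa using h3
  · rintro ⟨C, hC, hMC⟩
    have horb : T.IsEigenorbit z _ _ := isEigenorbit_expSegment (hT.op_expSegment hMC)
      (hT.op_expSegment (by rw [Matrix.mulVec_smul, hMC, smul_zero]))
    refine horb.mem_pointSpectrum ?_
    by_contra! h0
    exact hC (eq_zero_of_expSegment_eq_zero h0.1 h0.2)

end DelaySpectrum

/-! ### Zeros of entire functions of exponential type -/

/-- Functions on `ℂ` of at most exponential growth. -/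
def IsExpType (f : ℂ → ℂ) : Prop := ∃ K : ℝ, 0 ≤ K ∧ ∀ z, ‖f z‖ ≤ K * Real.exp (K * ‖z‖)

theorem isExpType_of_le {f : ℂ → ℂ} {K L : ℝ} (h : ∀ z, ‖f z‖ ≤ K * Real.exp (L * ‖z‖)) :
    IsExpType f := by
  refine ⟨max (max K L) 0, le_max_right _ _, fun z => (h z).trans ?_⟩
  gcongr
  · exact (le_max_left _ _).trans (le_max_left _ _)
  · exact (le_max_right _ _).trans (le_max_left _ _)

theorem isExpType_const (c : ℂ) : IsExpType fun _ => c :=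
  isExpType_of_le (K := ‖c‖) (L := 0) fun z => by simp

theorem isExpType_id : IsExpType fun z => z :=
  isExpType_of_le (K := 1) (L := 1) fun z => by
    have := Real.add_one_le_exp ‖z‖
    rw [one_mul, one_mul]
    linarith

theorem IsExpType.add {f g : ℂ → ℂ} (hf : IsExpType f) (hg : IsExpType g) :
    IsExpType fun z => f z + g z := by
  obtain ⟨K, hK, hf⟩ := hf
  obtain ⟨L, hL, hg⟩ := hg
  refine isExpType_of_le (K := K + L) (L := K + L) fun z => ?_
  calc ‖f z + g z‖ ≤ K * Real.exp (K * ‖z‖) + L * Real.exp (L * ‖z‖) :=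
        norm_add_le_of_le (hf z) (hg z)
    _ ≤ K * Real.exp ((K + L) * ‖z‖) + L * Real.exp ((K + L) * ‖z‖) := by
      gcongr <;> linarith
    _ = _ := by ring

theorem IsExpType.mul {f g : ℂ → ℂ} (hf : IsExpType f) (hg : IsExpType g) :
    IsExpType fun z => f z * g z := by
  obtain ⟨K, hK, hf⟩ := hf
  obtain ⟨L, hL, hg⟩ := hg
  refine isExpType_of_le (K := K * L) (L := K + L) fun z => ?_
  rw [norm_mul]
  calc ‖f z‖ * ‖g z‖ ≤ (K * Real.exp (K * ‖z‖)) * (L * Real.exp (L * ‖z‖)) := by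
        gcongr
        · exact hf z
        · exact hg z
    _ = K * L * Real.exp ((K + L) * ‖z‖) := by rw [add_mul, Real.exp_add]; ring

theorem IsExpType.sum {ι : Type*} (s : Finset ι) {f : ι → ℂ → ℂ}
    (h : ∀ i ∈ s, IsExpType (f i)) : IsExpType fun z => ∑ i ∈ s, f i z := by
  induction s using Finset.cons_induction with
  | empty => simpa using isExpType_const 0
  | cons a s ha ih =>
    simp only [Finset.sum_cons]
    exact (h a (Finset.mem_cons_self a s)).add
      (ih fun i hi => h i (Finset.mem_cons_of_mem hi))

theorem IsExpType.prod {ι : Type*} (s : Finset ι) {f : ι → ℂ → ℂ}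
    (h : ∀ i ∈ s, IsExpType (f i)) : IsExpType fun z => ∏ i ∈ s, f i z := by
  induction s using Finset.cons_induction with
  | empty => simpa using isExpType_const 1
  | cons a s ha ih =>
    simp only [Finset.prod_cons]
    exact (h a (Finset.mem_cons_self a s)).mul
      (ih fun i hi => h i (Finset.mem_cons_of_mem hi))

theorem IsExpType.det {n : ℕ} {M : ℂ → Matrix (Fin n) (Fin n) ℂ}
    (h : ∀ i j, IsExpType fun z => M z i j) : IsExpType fun z => (M z).det := by
  simp only [Matrix.det_apply']
  exact .sum _ fun σ _ => (isExpType_const _).mul (.prod _ fun i _ => h _ _)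

theorem Differentiable.matrix_det {n : ℕ} {M : ℂ → Matrix (Fin n) (Fin n) ℂ}
    (h : ∀ i j, Differentiable ℂ fun z => M z i j) : Differentiable ℂ fun z => (M z).det := by
  simp only [Matrix.det_apply']
  exact .fun_sum fun σ _ => (differentiable_const _).mul (.fun_finsetProd fun i _ => h _ _)

/-- A primitive of `f' / f` is a logarithm of `f` up to an additive constant. -/
theorem Complex.exists_eq_exp_of_forall_ne_zero {f : ℂ → ℂ} (hf : Differentiable ℂ f) (h0 : ∀ z, f z ≠ 0) :
    ∃ g : ℂ → ℂ, Differentiable ℂ g ∧ ∀ z, f z = Complex.exp (g z) := by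
  have hd : Differentiable ℂ fun z => deriv f z / f z :=
    hf.deriv.fun_div hf h0
  obtain ⟨g, hg⟩ := hd.isExactOn_univ
  have hg' : ∀ z, HasDerivAt g (deriv f z / f z) z := fun z => hg z (Set.mem_univ z)
  have hq : ∀ z, HasDerivAt (fun z => f z * Complex.exp (-g z)) 0 z := fun z => by
    refine ((hf z).hasDerivAt.mul (hg' z).neg.cexp).congr_deriv ?_
    have := h0 z
    field_simp
    ring
  have hconst : ∀ z, f z * Complex.exp (-g z) = f 0 * Complex.exp (-g 0) := fun z =>
    is_const_of_deriv_eq_zero (fun z => (hq z).differentiableAt) (fun z => (hq z).deriv) z 0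
  refine ⟨fun z => g z + Complex.log (f 0 * Complex.exp (-g 0)),
    fun z => (hg' z).differentiableAt.add_const _, fun z => ?_⟩
  rw [Complex.exp_add, Complex.exp_log (mul_ne_zero (h0 0) (Complex.exp_ne_zero _)), ← hconst z,
    mul_left_comm, ← Complex.exp_add, add_neg_cancel, Complex.exp_zero, mul_one]

/-- Borel–Carathéodory on the disc of radius `2 |z|` turns the one-sided bound into linear growth of
`|g|`; Cauchy's estimate then bounds `g'`, and Liouville makes it constant. -/
theorem Complex.eq_affine_of_re_le {g : ℂ → ℂ} (hg : Differentiable ℂ g) {a b : ℝ}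
    (hb : 0 ≤ b) (h : ∀ z, (g z).re ≤ a + b * ‖z‖) : ∃ c : ℂ, ∀ z, g z = g 0 + c * z := by
  have hbound : ∀ z, ‖g z‖ ≤ 2 * (|a| + 1) + 3 * ‖g 0‖ + 4 * b * ‖z‖ := by
    intro z
    rcases eq_or_ne z 0 with rfl | hz
    · have := norm_nonneg (g 0)
      have := abs_nonneg a
      rw [norm_zero, mul_zero]
      linarith
    have hz0 : 0 < ‖z‖ := norm_pos_iff.2 hz
    have h1 := Complex.borelCaratheodory (f := g) (M := |a| + 1 + b * (2 * ‖z‖)) (R := 2 * ‖z‖)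
      (z := z) (by positivity) hg.differentiableOn
      (fun w hw => by
        have hw' : ‖w‖ ≤ 2 * ‖z‖ := (mem_ball_zero_iff.1 hw).le
        have := mul_le_mul_of_nonneg_left hw' hb
        have := le_abs_self a
        have := h w
        change (g w).re ≤ _
        linarith)
      (by positivity) (mem_ball_zero_iff.2 (by linarith))
    refine h1.trans (le_of_eq ?_)
    have : 2 * ‖z‖ - ‖z‖ = ‖z‖ := by ring
    rw [this]
    field_simp
    ring
  have hderiv : ∀ z, ‖deriv g z‖ ≤ 2 * (|a| + 1) + 3 * ‖g 0‖ + 8 * b := by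
    intro z
    have hR : 0 < ‖z‖ + 1 := by positivity
    refine (Complex.norm_deriv_le_of_forall_mem_sphere_norm_le hR hg.diffContOnCl
      (C := (2 * (|a| + 1) + 3 * ‖g 0‖ + 8 * b) * (‖z‖ + 1)) fun w hw => ?_).trans (le_of_eq ?_)
    · have h1 : ‖w‖ ≤ 2 * ‖z‖ + 1 := by
        have h2 : ‖w - z‖ = ‖z‖ + 1 := by simpa [dist_eq_norm] using hw
        have := norm_le_norm_add_norm_sub' w z
        linarith
      refine (hbound w).trans ?_
      have h3 := mul_le_mul_of_nonneg_left h1 hb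
      have h4 : 0 ≤ (2 * (|a| + 1) + 3 * ‖g 0‖) * ‖z‖ := by positivity
      nlinarith
    · field_simp
  have hconst : ∀ z, deriv g z = deriv g 0 := fun z =>
    hg.deriv.apply_eq_apply_of_bounded (isBounded_iff_forall_norm_le.2
      ⟨_, by rintro _ ⟨w, rfl⟩; exact hderiv w⟩) z 0
  refine ⟨deriv g 0, fun z => ?_⟩
  have h1 : ∀ z, HasDerivAt (fun z => g z - deriv g 0 * z) 0 z := fun z => by
    refine ((hg z).hasDerivAt.sub ((hasDerivAt_id z).const_mul (deriv g 0))).congr_deriv ?_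
    rw [hconst z, mul_one, sub_self]
  have h2 := is_const_of_deriv_eq_zero (fun z => (h1 z).differentiableAt)
    (fun z => (h1 z).deriv) z 0
  simp only [mul_zero, sub_zero] at h2
  rw [← h2, sub_add_cancel]

/-- Without zeros, `|f|` would be a pure exponential on the real axis, which is either bounded on
the positive half or outgrows every power; neither behaves like `x ^ n` with `n ≥ 1`. -/
theorem IsExpType.exists_eq_zero {f : ℂ → ℂ} (hf : IsExpType f) (hd : Differentiable ℂ f) {n : ℕ}
    (hn : n ≠ 0) (hlim : Tendsto (fun x : ℝ => ‖f x‖ / x ^ n) atTop (𝓝 1)) : ∃ z, f z = 0 := by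
  by_contra! h0
  obtain ⟨g, hg, hfg⟩ := Complex.exists_eq_exp_of_forall_ne_zero hd h0
  obtain ⟨K, hK, hfK⟩ := hf
  have hre : ∀ z, (g z).re ≤ Real.log K + K * ‖z‖ := fun z => by
    have h1 := hfK z
    rw [hfg, Complex.norm_exp] at h1
    have hK0 : 0 < K := by
      refine hK.lt_of_ne fun h => ?_
      rw [← h, zero_mul] at h1
      exact (Real.exp_pos _).not_ge h1
    rw [← Real.exp_le_exp, Real.exp_add, Real.exp_log hK0]
    exact h1
  obtain ⟨c, hc⟩ := Complex.eq_affine_of_re_le hg hK hre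
  have hnorm : ∀ x : ℝ, ‖f x‖ = Real.exp (g 0).re * Real.exp (c.re * x) := fun x => by
    rw [hfg, Complex.norm_exp, hc, ← Real.exp_add]
    simp
  simp only [hnorm] at hlim
  rcases le_or_gt c.re 0 with hc0 | hc0
  · have h1 : Tendsto (fun x : ℝ => Real.exp (g 0).re * Real.exp (c.re * x) / x ^ n) atTop
        (𝓝 0) := by
      refine squeeze_zero' ?_ ?_
        ((tendsto_const_nhds (x := Real.exp (g 0).re)).div_atTop (tendsto_pow_atTop hn))
      · filter_upwards [eventually_ge_atTop 0] with x hx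
        positivity
      · filter_upwards [eventually_ge_atTop 0] with x hx
        gcongr
        exact mul_le_of_le_one_right (Real.exp_pos _).le
          (Real.exp_le_one_iff.2 (mul_nonpos_of_nonpos_of_nonneg hc0 hx))
    exact zero_ne_one (tendsto_nhds_unique h1 hlim)
  · have h1 : Tendsto (fun x : ℝ => Real.exp (g 0).re * Real.exp (c.re * x) / x ^ n) atTop
        atTop := by
      have h2 := (tendsto_exp_mul_div_rpow_atTop n c.re hc0).const_mul_atTop
        (Real.exp_pos (g 0).re)
      refine h2.congr fun x => ?_
      rw [Real.rpow_natCast, mul_div_assoc]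
    exact not_tendsto_nhds_of_tendsto_atTop h1 1 hlim

/-! ### Zeros of the characteristic function of a linear delay equation -/

section DelayZeros

variable {n : ℕ} {r : ℝ≥0}

theorem SignedMeasure.exists_norm_laplace_le (ν : SignedMeasure (DelayInterval r)) :
    ∃ K : ℝ, 0 ≤ K ∧ ∀ (z : ℂ) (B : ℝ),
      (∀ θ : DelayInterval r, ‖Complex.exp (z * ((θ : ℝ) : ℂ))‖ ≤ B) →
      ‖∫ᵛ θ, Complex.exp (z * ((θ : ℝ) : ℂ)) ∂<•ν‖ ≤ K * B := by
  refine ⟨‖SignedMeasure.integralCLM ℂ ℂ ν‖, ContinuousLinearMap.opNorm_nonneg _, fun z B hB => ?_⟩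
  have hB0 : 0 ≤ B := (norm_nonneg _).trans (hB (delayZero r))
  exact (SignedMeasure.integralCLM ℂ ℂ ν).le_opNorm_of_le
    (x := ⟨fun θ => Complex.exp (z * ((θ : ℝ) : ℂ)), by fun_prop⟩)
    ((ContinuousMap.norm_le _ hB0).2 hB)

theorem norm_exp_mul_delay_le (z : ℂ) (θ : DelayInterval r) :
    ‖Complex.exp (z * ((θ : ℝ) : ℂ))‖ ≤ Real.exp (r * ‖z‖) := by
  refine (Complex.norm_exp_le_exp_norm _).trans (Real.exp_le_exp.2 ?_)
  rw [norm_mul, mul_comm, Complex.norm_real, Real.norm_eq_abs, abs_of_nonpos θ.2.2]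
  gcongr
  have := θ.2.1
  linarith

theorem isExpType_laplace (ν : SignedMeasure (DelayInterval r)) :
    IsExpType fun z => ∫ᵛ θ, Complex.exp (z * ((θ : ℝ) : ℂ)) ∂<•ν := by
  obtain ⟨K, -, h⟩ := SignedMeasure.exists_norm_laplace_le ν
  exact isExpType_of_le fun z => h z _ (norm_exp_mul_delay_le z)

theorem differentiable_integral_exp (μ : Measure (DelayInterval r)) [IsFiniteMeasure μ] :
    Differentiable ℂ fun z => ∫ θ, Complex.exp (z * ((θ : ℝ) : ℂ)) ∂μ := by
  -- The integral is a complex moment generating function; bounded support makes it holomorphic on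
  -- the whole plane.
  have huniv : ProbabilityTheory.integrableExpSet (fun θ : DelayInterval r => (θ : ℝ)) μ =
      Set.univ :=
    Set.eq_univ_of_forall fun t => ProbabilityTheory.integrable_exp_mul_of_mem_Icc
      (a := -(r : ℝ)) (b := 0) (by fun_prop) (.of_forall fun θ => θ.2)
  intro z
  exact (ProbabilityTheory.hasDerivAt_complexMGF (by rw [huniv, interior_univ]; trivial)).differentiableAt

theorem differentiable_laplace (ν : SignedMeasure (DelayInterval r)) :
    Differentiable ℂ fun z => ∫ᵛ θ, Complex.exp (z * ((θ : ℝ) : ℂ)) ∂<•ν := by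
  have h : ∀ z : ℂ, ∫ᵛ θ, Complex.exp (z * ((θ : ℝ) : ℂ)) ∂<•ν =
      ∫ θ : DelayInterval r, Complex.exp (z * ((θ : ℝ) : ℂ)) ∂ν.toJordanDecomposition.posPart -
      ∫ θ : DelayInterval r, Complex.exp (z * ((θ : ℝ) : ℂ)) ∂ν.toJordanDecomposition.negPart :=
    fun z => SignedMeasure.integral_eq_sub ν ⟨fun θ => Complex.exp (z * ((θ : ℝ) : ℂ)), by fun_prop⟩
  simp only [h]
  exact (differentiable_integral_exp _).sub (differentiable_integral_exp _)

variable
  (A : EuclideanSpace ℝ (Fin n) × EuclideanSpace ℝ (Fin n) →L[ℝ] EuclideanSpace ℝ (Fin n))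
  (π : Fin n → Fin n → SignedMeasure (DelayInterval r))

theorem delayCharacteristic_apply (z : ℂ) (k l : Fin n) : delayCharacteristic A π z k l =
    z * (1 : Matrix (Fin n) (Fin n) ℂ) k l + (-(A (EuclideanSpace.single l 1, 0) k : ℂ) +
      ∑ j, -(A (0, EuclideanSpace.single j 1) k : ℂ) *
        ∫ᵛ θ, Complex.exp (z * ((θ : ℝ) : ℂ)) ∂<•(π l j)) := by
  simp only [delayCharacteristic, Matrix.sub_apply, Matrix.smul_apply, Matrix.mul_apply,
    Matrix.of_apply, smul_eq_mul, neg_mul, Finset.sum_neg_distrib]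
  ring

theorem isExpType_det_delayCharacteristic :
    IsExpType fun z => (delayCharacteristic A π z).det := by
  refine .det fun k l => ?_
  simp only [delayCharacteristic_apply]
  exact (isExpType_id.mul (isExpType_const _)).add ((isExpType_const _).add
    (.sum _ fun j _ => (isExpType_const _).mul (isExpType_laplace _)))

theorem differentiable_det_delayCharacteristic :
    Differentiable ℂ fun z => (delayCharacteristic A π z).det := by
  refine .matrix_det fun k l => ?_
  simp only [delayCharacteristic_apply]
  exact (differentiable_id.mul (differentiable_const _)).add ((differentiable_const _).add
    (.fun_sum fun j _ => (differentiable_const _).mul (differentiable_laplace _)))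

/-- For `x ≥ 0` and `θ ≤ 0` one has `exp (x θ) ≤ 1`, so the measure terms stay bounded and `x⁻¹
Δ(x)` tends to the identity matrix. -/
theorem tendsto_det_delayCharacteristic_div :
    Tendsto (fun x : ℝ => ‖(delayCharacteristic A π x).det‖ / x ^ n) atTop (𝓝 1) := by
  have hinv : Tendsto (fun x : ℝ => ((x⁻¹ : ℝ) : ℂ)) atTop (𝓝 0) :=
    (Complex.continuous_ofReal.tendsto' 0 0 Complex.ofReal_zero).comp tendsto_inv_atTop_zero
  have hlap : ∀ i j, Tendsto (fun x : ℝ =>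
      ((x⁻¹ : ℝ) : ℂ) * ∫ᵛ θ, Complex.exp ((x : ℂ) * ((θ : ℝ) : ℂ)) ∂<•(π i j)) atTop (𝓝 0) := by
    intro i j
    obtain ⟨K, -, hK⟩ := SignedMeasure.exists_norm_laplace_le (π i j)
    refine Tendsto.zero_mul_isBoundedUnder_le hinv ⟨K * 1, eventually_map.2 ?_⟩
    filter_upwards [eventually_ge_atTop 0] with x hx
    refine hK x 1 fun θ => ?_
    rw [Complex.norm_exp, Real.exp_le_one_iff, ← Complex.ofReal_mul, Complex.ofReal_re]
    exact mul_nonpos_of_nonneg_of_nonpos hx θ.2.2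
  have hmat : Tendsto (fun x : ℝ => ((x⁻¹ : ℝ) : ℂ) • delayCharacteristic A π x) atTop
      (𝓝 (1 : Matrix (Fin n) (Fin n) ℂ)) := by
    refine tendsto_pi_nhds.2 fun k => tendsto_pi_nhds.2 fun l => ?_
    have h1 : Tendsto (fun x : ℝ => (1 : Matrix (Fin n) (Fin n) ℂ) k l +
        (((x⁻¹ : ℝ) : ℂ) * -(A (EuclideanSpace.single l 1, 0) k : ℂ) +
        ∑ j, -(A (0, EuclideanSpace.single j 1) k : ℂ) * (((x⁻¹ : ℝ) : ℂ) *
          ∫ᵛ θ, Complex.exp ((x : ℂ) * ((θ : ℝ) : ℂ)) ∂<•(π l j)))) atTop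
        (𝓝 ((1 : Matrix (Fin n) (Fin n) ℂ) k l +
          (0 * -(A (EuclideanSpace.single l 1, 0) k : ℂ) +
          ∑ j, -(A (0, EuclideanSpace.single j 1) k : ℂ) * 0))) :=
      tendsto_const_nhds.add ((hinv.mul_const _).add
        (tendsto_finsetSum _ fun j _ => (hlap l j).const_mul _))
    simp only [zero_mul, mul_zero, Finset.sum_const_zero, add_zero] at h1
    refine h1.congr' ?_
    filter_upwards [eventually_ne_atTop 0] with x hx
    have hx' : ((x⁻¹ : ℝ) : ℂ) * (x : ℂ) = 1 := by
      rw [← Complex.ofReal_mul, inv_mul_cancel₀ hx, Complex.ofReal_one]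
    rw [Matrix.smul_apply, delayCharacteristic_apply, smul_eq_mul, mul_add, mul_add, ← mul_assoc,
      hx', one_mul, Finset.mul_sum]
    simp only [mul_left_comm]
  have hdet := ((continuous_id.matrix_det (n := Fin n) (R := ℂ)).tendsto _).comp hmat |>.norm
  simp only [id, Matrix.det_one, norm_one] at hdet
  refine hdet.congr' ?_
  filter_upwards [eventually_gt_atTop 0] with x hx
  rw [Function.comp_apply, Matrix.det_smul, norm_mul, norm_pow, Complex.norm_real, Real.norm_eq_abs,
    abs_of_pos (inv_pos.2 hx), Fintype.card_fin, inv_pow, div_eq_inv_mul]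

theorem exists_det_delayCharacteristic_eq_zero (hn : n ≠ 0) :
    ∃ z, (delayCharacteristic A π z).det = 0 :=
  (isExpType_det_delayCharacteristic A π).exists_eq_zero
    (differentiable_det_delayCharacteristic A π) hn (tendsto_det_delayCharacteristic_div A π)

end DelayZeros

/-! ### Exponential stability and the final assembly -/

theorem C0Semigroup.IsLyapunovSequence.growthRate_le_of_forall_re_neg {B : Type*}
    [NormedAddCommGroup B] [NormedSpace ℝ B] [CompleteSpace B] {T : C0Semigroup B}
    {lam : ℕ → EReal} (h : T.IsLyapunovSequence lam)
    (hneg : ∀ μ ∈ pointSpectrum T.generator, μ.re < 0) :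
    lam 0 < 0 ∧ ∀ ξ, T.growthRate ξ ≤ lam 0 := by
  refine ⟨?_, h.growthRate_le_zero⟩
  by_cases h0 : lam 0 = ⊥
  · rw [h0]
    exact EReal.bot_lt_zero
  · obtain ⟨μ, hμ, hj⟩ := h.exists_mem_pointSpectrum h0
    rw [hj]
    exact_mod_cast hneg μ hμ

theorem theorem5p6 :
    (∀ (B : Type*) [NormedAddCommGroup B] [NormedSpace ℝ B] [CompleteSpace B]
        (T : C0Semigroup B) (r : ℝ≥0), (∀ t, r ≤ t → IsCompactOperator (T.op t)) →
      ∃ lam : ℕ → EReal, T.IsLyapunovSequence lam ∧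
        (∀ lam', T.IsLyapunovSequence lam' → lam' = lam) ∧
        (∀ μ ∈ pointSpectrum T.generator,
          ∃ (j : ℕ) (a b : ℝ), lam j = (a : EReal) ∧ μ = a + b * Complex.I) ∧
        (∀ j, lam j ≠ ⊥ →
          ∃ a b : ℝ, lam j = (a : EReal) ∧ (a + b * Complex.I : ℂ) ∈ pointSpectrum T.generator) ∧
        (pointSpectrum T.generator = ∅ → lam 0 = ⊥) ∧
        ((pointSpectrum T.generator).Nonempty →
          IsGreatest ((fun μ : ℂ => (μ.re : EReal)) '' pointSpectrum T.generator) (lam 0)) ∧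
        ((∀ μ ∈ pointSpectrum T.generator, μ.re < 0) →
          lam 0 < 0 ∧ ∀ ξ, T.growthRate ξ ≤ lam 0)) ∧
    (∀ (n : ℕ) (r : ℝ≥0), 0 < n → 0 < r →
      ∀ (A : EuclideanSpace ℝ (Fin n) × EuclideanSpace ℝ (Fin n) →L[ℝ] EuclideanSpace ℝ (Fin n))
        (π : Fin n → Fin n → SignedMeasure (DelayInterval r)),
      (∃! T : C0Semigroup (DelaySpace n r), IsDelaySemigroup A π T) ∧
      ∀ T : C0Semigroup (DelaySpace n r), IsDelaySemigroup A π T →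
        (∀ t, r ≤ t → IsCompactOperator (T.op t)) ∧
        ∃ (lam : ℕ → EReal) (x : ℝ), T.IsLyapunovSequence lam ∧ lam 0 = (x : EReal) ∧
          IsGreatest (Complex.re '' {z : ℂ | (delayCharacteristic A π z).det = 0}) x ∧
          ((∀ z : ℂ, (delayCharacteristic A π z).det = 0 → z.re < 0) →
            x < 0 ∧ ∀ ξ, T.growthRate ξ ≤ (x : EReal))) := by
  refine ⟨fun B _ _ _ T r hT => ?_, fun n r hn _ A π => ⟨?_, fun T hT => ?_⟩⟩
  · have h := T.isLyapunovSequence_decreasingSeq fun c => T.exists_isSplitting hT c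
    refine ⟨_, h, fun lam' h' => h'.eq_decreasingSeq, fun μ hμ => ?_, fun j hj => ?_, fun h0 => ?_,
      h.isGreatest, h.growthRate_le_of_forall_re_neg⟩
    · obtain ⟨j, hj⟩ := h.exists_eq_re hμ
      exact ⟨j, μ.re, μ.im, hj, (Complex.re_add_im μ).symm⟩
    · obtain ⟨μ, hμ, hj⟩ := h.exists_mem_pointSpectrum hj
      exact ⟨μ.re, μ.im, hj, by rwa [Complex.re_add_im]⟩
    · by_contra hj
      obtain ⟨μ, hμ, -⟩ := h.exists_mem_pointSpectrum hj
      exact h0.subset hμ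
  · obtain ⟨T, hT⟩ := exists_isRetardedSemigroup (delayRhs A π)
    exact ⟨T, isDelaySemigroup_iff.2 hT, fun T' hT' => (isDelaySemigroup_iff.1 hT').unique hT⟩
  · rw [isDelaySemigroup_iff] at hT
    have hcpt : ∀ t, r ≤ t → IsCompactOperator (T.op t) := fun t ht => hT.isCompactOperator ht
    have h := T.isLyapunovSequence_decreasingSeq fun c => T.exists_isSplitting hcpt c
    have hspec : pointSpectrum T.generator = {z | (delayCharacteristic A π z).det = 0} :=
      Set.ext hT.mem_pointSpectrum_iff
    -- The existence of a characteristic root is what makes the first exponent a real number rather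
    -- than `⊥`.
    have hne : (pointSpectrum T.generator).Nonempty :=
      hspec ▸ exists_det_delayCharacteristic_eq_zero A π hn.ne'
    have hgr := h.isGreatest hne
    obtain ⟨μ, hμ, hμ0⟩ := hgr.1
    beta_reduce at hμ0
    refine ⟨hcpt, _, μ.re, h, hμ0.symm, hspec ▸ ⟨⟨μ, hμ, rfl⟩, ?_⟩, fun hneg => ?_⟩
    · rintro _ ⟨z, hz, rfl⟩
      have h1 := hgr.2 ⟨z, hz, rfl⟩
      beta_reduce at h1
      rw [← hμ0] at h1
      exact_mod_cast h1
    · have h1 := h.growthRate_le_of_forall_re_neg fun z hz => hneg z (hspec.subset hz)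
      rw [← hμ0] at h1
      exact ⟨by exact_mod_cast h1.1, h1.2⟩
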